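/- **Setting.** Let $T>0$, $N\ge 1$, $\delta:=1/N$ and $x_1,\dots,x_N\in\mathbb R$. Let $\lambda\in L^\infty([0,T])$ with $\lambda\ge0$ a.e., $\kappa\in C^1([0,T];[0,\infty))$ and $\eta\in C^1([0,T];(0,\infty))$, and assume $$\lambda+\delta\dot\kappa\ge 0\ \text{ a.e.},\qquad \eta-\delta\kappa>0\ \text{ on }[0,T],\qquad \lambda-\delta\kappa\ge0\ \text{ a.e.}$$ **The game.** For $x\in\mathbb R$ and a trading rate $\xi$ put $X_t=x-\int_0^t\xi_s\,ds$. The set $\mathcal A_x$ of admissible strategies consists of all $\xi\in L^2([0,T])$ for which there is $\tau\in[0,T]$ with $|X_t|>0$ for $t\in[0,\tau)$ and $X_t=0$ for $t\in[\tau,T]$ (so $\tau>0$ if $x\neq0$, and $\mathcal A_0=\{0\}$). Player $i$, with initial position $x_i$ and portfolio $X^i_t=x_i-\int_0^t\xi^i_s\,ds$, minimizes over $\xi^i\in\mathcal A_{x_i}$ the cost $$J(\xi^i;\xi^{-i})=\int_0^T\Big(\tfrac12\eta_t(\xi^i_t)^2+\frac{\kappa_tX^i_t}{N}\sum_{j=1}^N\xi^j_t+\tfrac12\lambda_t(X^i_t)^2\Big)dt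 .$$ A Nash equilibrium is a profile $(\xi^{*,1},\dots,\xi^{*,N})\in\mathcal A_{x_1}\times\dots\times\mathcal A_{x_N}$ with $J(\xi^{*,i};\xi^{*,-i})\le J(\xi;\xi^{*,-i})$ for all $i$ and all $\xi\in\mathcal A_{x_i}$. Its aggregate (average) trading rate is $\frac1N\sum_i\xi^{*,i}$. Trading rates are identified when they agree a.e. on $[0,T]$; continuity of an aggregate rate means that it has a continuous version on $[0,T]$. **Candidate strategies.** Let $A^\delta$ be the solution on $[0,T)$ of $-\dot A=-\frac{A^2}{\eta}+\delta\frac{\kappa}{\eta}A+\lambda$, $\lim_{t\nearrow T}A_t=\infty$, and set $$h^\delta_t=e^{-\int_0^t\frac{A^\delta_r}{\eta_r}dr}\int_0^t\frac1{\eta_s}e^{\int_0^s\frac{2A^\delta_r-\delta\kappa_r}{\eta_r}dr}ds,\qquad f_\mu(t)=\int_0^t\kappa_u\mu_uh^\delta_u\,du,\qquad \tau_\mu(x)=\inf\{t\in[0,T]:f_\mu(t)=x\},$$ with $\inf\emptyset:=T$, for $\mu\in L^1([0,T])$. Let $(X^{\delta,x,\mu},Y^{\delta,x,\mu})$ be the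 continuous solution on $[0,T]$ of $$\dot X_t=-\frac{Y_t-\delta\kappa_tX_t}{\eta_t}1_{\{t\le\tau_\mu(x)\}},\qquad -\dot Y_t=(\lambda_tX_t+\kappa_t\mu_t)1_{\{t\le\tau_\mu(x)\}},\qquad X_0=x,\ X_T=0,$$ with $Y_{\tau_\mu(x)}=0$ if $\tau_\mu(x)<T$ (this last condition is automatic for $x\ne0$). Put $\xi^{\delta,x,\mu}=(Y^{\delta,x,\mu}-\delta\kappa X^{\delta,x,\mu})/\eta$ and $\xi^{\mu,i}=\xi^{1/N,x_i,\mu}$. With $\nu_0=\frac1N\sum_{j=1}^N\delta_{x_j}$, the fixed-point equation for $\mu\in L^1([0,T])$ is $$\mu_t=F(\mu)_t:=\int_{\mathbb R}\xi^{1/N,x,\mu}_t\,\nu_0(dx).$$ **Theorem.** 1. Let $(\xi^{*,1},\dots,\xi^{*,N})$ be a Nash equilibrium of the $N$-player game whose average trading rate $\mu:=\frac1N\sum_{i=1}^N\xi^{*,i}$ does not change sign, i.e. $\mu\le0$ a.e. or $\mu\ge0$ a.e. on $[0,T]$. Then $\xi^{*,i}=\xi^{\mu,i}$ for all $i=1,\dots,N$,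 and $\mu$ is the unique solution in $L^1([0,T])$ of the fixed-point equation $\mu=F(\mu)$. 2. There exists a unique Nash equilibrium of the $N$-player game with continuous aggregate trading rate. -/

import Mathlib

open MeasureTheory Set Filter Topology

noncomputable section

namespace Liquidation

/-- The data of the liquidation model: time horizon `T`, instantaneous impact `η`, permanent
impact `κ` and risk coefficient `lam` (only their values on `[0,T]` matter). -/
structure Market where
  T : ℝ
  η : ℝ → ℝ
  κ : ℝ → ℝ
  lam : ℝ → ℝ

namespace Market

/-- Lebesgue measure on `[0,T]`. -/
def vol (M : Market) : Measure ℝ := volume.restrict (Icc 0 M.T)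

/-- Portfolio process `X_t = x - ∫₀ᵗ ξ_s ds` (positive rates are sales). -/
def position (x : ℝ) (ξ : ℝ → ℝ) (t : ℝ) : ℝ := x - ∫ s in (0 : ℝ)..t, ξ s

/-- The admissible class `𝒜_x`: square integrable rates whose portfolio is nonzero on `[0,τ)` and
vanishes on `[τ,T]` for some `τ`. For `x ≠ 0` one automatically has `τ > 0`; for `x = 0` the only
admissible strategy is not to trade. -/
def Admissible (M : Market) (x : ℝ) (ξ : ℝ → ℝ) : Prop :=
  MemLp ξ 2 M.vol ∧
    ∃ τ ∈ Icc (0 : ℝ) M.T,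
      (∀ t ∈ Ico (0 : ℝ) τ, 0 < |position x ξ t|) ∧ ∀ t ∈ Icc τ M.T, position x ξ t = 0

/-- Average trading rate `(1/N) ∑ᵢ ξⁱ_t`. -/
def avgRate {N : ℕ} (ξ : Fin N → ℝ → ℝ) (t : ℝ) : ℝ := (N : ℝ)⁻¹ * ∑ j, ξ j t

/-- Cost `J(ξⁱ; ξ⁻ⁱ)` of player `i` with initial position `x`, given the whole profile `ξ`. -/
def cost (M : Market) {N : ℕ} (x : ℝ) (i : Fin N) (ξ : Fin N → ℝ → ℝ) : ℝ :=
  ∫ t in (0 : ℝ)..M.T,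
    ((1 / 2) * M.η t * (ξ i t) ^ 2
      + M.κ t * avgRate ξ t * position x (ξ i) t
      + (1 / 2) * M.lam t * (position x (ξ i) t) ^ 2)

/-- Nash equilibrium of the `N`-player game with initial positions `x₁,…,x_N`: every strategy is
admissible and no player can lower her cost by an admissible unilateral deviation. -/
def IsNash (M : Market) {N : ℕ} (x : Fin N → ℝ) (ξ : Fin N → ℝ → ℝ) : Prop :=
  (∀ i, M.Admissible (x i) (ξ i)) ∧
    ∀ i, ∀ ζ : ℝ → ℝ, M.Admissible (x i) ζ →
      M.cost (x i) i ξ ≤ M.cost (x i) i (Function.update ξ i ζ)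

/-- `A` solves, on `[0,T)`, the singular terminal value problem
`-A' = -A²/η + δ (κ/η) A + λ`, `lim_{t ↑ T} A_t = ∞` (in integrated form, `λ` being only
bounded and measurable). -/
structure IsRiccati (M : Market) (δ : ℝ) (A : ℝ → ℝ) : Prop where
  cont : ContinuousOn A (Ico 0 M.T)
  eq : ∀ t ∈ Ico (0 : ℝ) M.T,
    A t = A 0 + ∫ s in (0 : ℝ)..t,
      ((A s) ^ 2 / M.η s - δ * (M.κ s / M.η s) * A s - M.lam s)
  blowup : Tendsto A (𝓝[<] M.T) atTop

open Classical in
/-- The solution `A^δ` of the singular Riccati problem. -/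
def riccati (M : Market) (δ : ℝ) : ℝ → ℝ :=
  if h : ∃ A, M.IsRiccati δ A then h.choose else 0

/-- `h^δ_t = exp(-∫₀ᵗ A^δ/η) ∫₀ᵗ (1/η_s) exp(∫₀ˢ (2A^δ - δκ)/η) ds`. -/
def hFun (M : Market) (δ t : ℝ) : ℝ :=
  Real.exp (-∫ r in (0 : ℝ)..t, M.riccati δ r / M.η r) *
    ∫ s in (0 : ℝ)..t,
      (M.η s)⁻¹ * Real.exp (∫ r in (0 : ℝ)..s, (2 * M.riccati δ r - δ * M.κ r) / M.η r)

/-- `f_μ(t) = ∫₀ᵗ κ_u μ_u h^δ_u du`. -/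
def fFun (M : Market) (δ : ℝ) (μ : ℝ → ℝ) (t : ℝ) : ℝ :=
  ∫ u in (0 : ℝ)..t, M.κ u * μ u * M.hFun δ u

/-- Candidate liquidation time: the first time in `[0,T]` at which `f_μ` takes the value `x`,
and `T` if there is no such time. -/
def liqTime (M : Market) (δ x : ℝ) (μ : ℝ → ℝ) : ℝ :=
  sInf ({t | t ∈ Icc (0 : ℝ) M.T ∧ M.fFun δ μ t = x} ∪ {M.T})

/-- `(X,Y)` is a continuous solution on `[0,T]` of the forward-backward system
`X' = -((Y - δκX)/η) 1_{t ≤ τ}`, `-Y' = (λX + κμ) 1_{t ≤ τ}`, `X_0 = x`, `X_T = 0`,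
with `τ` the candidate liquidation time. The last field holds automatically when `x ≠ 0`; for
`x = 0`, where `τ = 0`, it fixes the otherwise free constant `Y` (as does the ansatz
`Y = A X + B` with `B_τ = 0`). -/
structure IsFBSolution (M : Market) (δ x : ℝ) (μ X Y : ℝ → ℝ) : Prop where
  contX : ContinuousOn X (Icc 0 M.T)
  contY : ContinuousOn Y (Icc 0 M.T)
  eqX : ∀ t ∈ Icc (0 : ℝ) M.T,
    X t = x - ∫ s in (0 : ℝ)..t,
      (Iic (M.liqTime δ x μ)).indicator (fun s => (Y s - δ * M.κ s * X s) / M.η s) s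
  eqY : ∀ t ∈ Icc (0 : ℝ) M.T,
    Y t = Y 0 - ∫ s in (0 : ℝ)..t,
      (Iic (M.liqTime δ x μ)).indicator (fun s => M.lam s * X s + M.κ s * μ s) s
  terminal : X M.T = 0
  dropout : M.liqTime δ x μ < M.T → Y (M.liqTime δ x μ) = 0

open Classical in
/-- The solution `(X^{δ,x,μ}, Y^{δ,x,μ})` of the forward-backward system. -/
def fbSolution (M : Market) (δ x : ℝ) (μ : ℝ → ℝ) : (ℝ → ℝ) × (ℝ → ℝ) :=
  if h : ∃ p : (ℝ → ℝ) × (ℝ → ℝ), M.IsFBSolution δ x μ p.1 p.2 then h.choose else (0, 0)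

/-- The candidate strategy `ξ^{δ,x,μ} = (Y^{δ,x,μ} - δ κ X^{δ,x,μ}) / η`. -/
def candidate (M : Market) (δ x : ℝ) (μ : ℝ → ℝ) (t : ℝ) : ℝ :=
  ((M.fbSolution δ x μ).2 t - δ * M.κ t * (M.fbSolution δ x μ).1 t) / M.η t

/-- The fixed-point map `F(μ)_t = ∫ ξ^{δ,x,μ}_t ν₀(dx)`. -/
def fixMap (M : Market) (δ : ℝ) (ν₀ : Measure ℝ) (μ : ℝ → ℝ) (t : ℝ) : ℝ :=
  ∫ x, M.candidate δ x μ t ∂ν₀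

/-- `μ ∈ L¹([0,T])` solves the fixed-point equation `μ = F(μ)`. -/
def IsFixedPoint (M : Market) (δ : ℝ) (ν₀ : Measure ℝ) (μ : ℝ → ℝ) : Prop :=
  Integrable μ M.vol ∧ μ =ᵐ[M.vol] M.fixMap δ ν₀ μ

/-- Empirical distribution `(1/N) ∑ⱼ δ_{x_j}` of the initial positions. -/
def empirical {N : ℕ} (x : Fin N → ℝ) : Measure ℝ :=
  (N : ENNReal)⁻¹ • ∑ j, Measure.dirac (x j)

/-- The aggregate trading rate is continuous, i.e. its a.e.-class has a version that is continuous
on `[0,T]`. -/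
def HasContinuousAvgRate (M : Market) {N : ℕ} (ξ : Fin N → ℝ → ℝ) : Prop :=
  ∃ m : ℝ → ℝ, ContinuousOn m (Icc 0 M.T) ∧ avgRate ξ =ᵐ[M.vol] m

end Market

end Liquidation

end

/-! Write $\delta=1/N$. Expanding the cost of a player along a perturbation $d$ of her own rate is
exact to second order, and the quadratic part is nonnegative because $\eta-\delta\kappa>0$ and
$\lambda-\delta\kappa\ge0$. Equilibria are therefore governed by first-order conditions, coupled
only through the average rate $\mu$ and the times at which positions are closed.

Necessity. Perturbations that act strictly before the closing time $\tau$ force the costate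
$\eta\xi+\delta\kappa X+\int(\lambda X+\kappa\mu)$ to be a constant $g$, and $Y=g-\int(\lambda
X+\kappa\mu)$ is the adjoint process. If $\tau<T$, a tent perturbation that keeps the position open
past $\tau$ gives $Y_\tau\le0$, while $Y_\tau<0$ would make a positive position grow just before it
closes; so $Y_\tau=0$. The discounted Wronskian of $(X,Y)$ with the homogeneous solution $(z,y)$
started at $(0,-1)$ equals $f_\mu-x$ (`flow_level`), because $h^\delta$ is $z$ times the discount
factor (`hFun_eq`). Hence $Y_\tau=0$ means $f_\mu(\tau)=x$, and for $\mu$ of constant sign $\tau$ is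
the first such time (`eq_liqTime_of_pos`).

Sign. Summing the players, $X=\delta\sum X^j$ and $W=\eta\mu$ satisfy $X'=-W/\eta$ and
$W'=-(\lambda+\delta\dot\kappa)X-\beta W$, with $\beta$ depending on the number of active players.
As $\lambda+\delta\dot\kappa\ge0$, a positive multiple of $XW$ decreases to its terminal value $0$,
so $\mu$ has the sign of $\sum x_j$ (`energy_sign`, `equilibrium_rate_sign`). By reflection one may
take $\mu\ge0$.

Fixed point. The equation for $(X,W)$ has discontinuous feedback through the number of active
players. For $\mu\ge0$ the level $f_\mu$ is nondecreasing and a positive player leaves when $f_\mu$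
crosses $x_j$. Hence the contribution of the departed players is $r\,\frac{d}{dt}P(f_\mu)$ with
$P(f)=\delta\sum_{x_j>0}(f-x_j)^+$ and $r$ the reciprocal of $z$ times the discount. In the
variables $(X,\,V=W-rP(f),\,f)$ the system is Lipschitz. Shooting in $V_0$ gives existence; a
comparison argument fixes $W_0$, and Lipschitz uniqueness does the rest (`exists_aggregate`,
`aggregate_unique`).

Sufficiency. Along a candidate flow the first variation reduces to $\int_\tau^T\kappa\mu D$, where
$D$ is the change of position. It is nonnegative since an admissible position cannot change sign
(`flow_firstVariation_nonneg`). -/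

namespace Liquidation

/-! ### Calculus of absolutely continuous functions with prescribed a.e. derivative. -/

/-- `F` is absolutely continuous on `[a,b]` with a.e. derivative `f`. -/
structure HasAEDeriv (F f : ℝ → ℝ) (a b : ℝ) : Prop where
  le : a ≤ b
  ac : AbsolutelyContinuousOnInterval F a b
  deriv : ∀ᵐ t, t ∈ Ioo a b → HasDerivAt F (f t) t

theorem _root_.AbsolutelyContinuousOnInterval.congr {F G : ℝ → ℝ} {a b : ℝ}
    (hF : AbsolutelyContinuousOnInterval F a b) (h : ∀ t ∈ uIcc a b, G t = F t) :
    AbsolutelyContinuousOnInterval G a b := by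
  rw [absolutelyContinuousOnInterval_iff] at hF ⊢
  intro ε hε
  obtain ⟨d, hd, H⟩ := hF ε hε
  refine ⟨d, hd, fun E hE hs => ?_⟩
  have := H E hE hs
  refine lt_of_eq_of_lt (Finset.sum_congr rfl fun i hi => ?_) this
  rw [h _ (hE.1 i hi).1, h _ (hE.1 i hi).2]

theorem _root_.LipschitzOnWith.comp_absolutelyContinuousOnInterval {F φ : ℝ → ℝ} {a b : ℝ}
    {K : NNReal} {s : Set ℝ} (hφ : LipschitzOnWith K φ s)
    (hF : AbsolutelyContinuousOnInterval F a b) (hs : ∀ t ∈ uIcc a b, F t ∈ s) :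
    AbsolutelyContinuousOnInterval (fun t => φ (F t)) a b := by
  rw [absolutelyContinuousOnInterval_iff] at hF ⊢
  intro ε hε
  obtain ⟨d, hd, H⟩ := hF (ε / (K + 1)) (by positivity)
  refine ⟨d, hd, fun E hE hE' => ?_⟩
  have := H E hE hE'
  calc _ ≤ ∑ i ∈ Finset.range E.1, (K + 1) * dist (F (E.2 i).1) (F (E.2 i).2) := by
        refine Finset.sum_le_sum fun i hi => ?_
        refine (hφ.dist_le_mul _ (hs _ (hE.1 i hi).1) _ (hs _ (hE.1 i hi).2)).trans ?_
        have := dist_nonneg (x := F (E.2 i).1) (y := F (E.2 i).2)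
        nlinarith
    _ = (K + 1) * ∑ i ∈ Finset.range E.1, dist (F (E.2 i).1) (F (E.2 i).2) := by
        rw [Finset.mul_sum]
    _ < (K + 1) * (ε / (K + 1)) := by gcongr
    _ = ε := by field_simp

namespace HasAEDeriv

variable {F G f g : ℝ → ℝ} {a b : ℝ}

theorem congr (h : HasAEDeriv F f a b) (hG : ∀ t ∈ Icc a b, G t = F t) :
    HasAEDeriv G f a b := by
  refine ⟨h.le, h.ac.congr (by rwa [uIcc_of_le h.le]), ?_⟩
  filter_upwards [h.deriv] with t ht htm
  refine (ht htm).congr_of_eventuallyEq ?_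
  filter_upwards [isOpen_Ioo.mem_nhds htm] with s hs
  exact hG s (Ioo_subset_Icc_self hs)

theorem congr_deriv (h : HasAEDeriv F f a b) (hg : ∀ᵐ t, t ∈ Ioo a b → g t = f t) :
    HasAEDeriv F g a b := by
  refine ⟨h.le, h.ac, ?_⟩
  filter_upwards [h.deriv, hg] with t ht ht' htm
  rw [ht' htm]; exact ht htm

theorem congr_deriv' (h : HasAEDeriv F f a b) (hg : ∀ t ∈ Ioo a b, g t = f t) :
    HasAEDeriv F g a b := h.congr_deriv (Eventually.of_forall hg)

theorem ae_Ioo_of_ae_Ioc {p : ℝ → Prop} (h : ∀ᵐ t, t ∈ Ioo a b → p t) :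
    ∀ᵐ t, t ∈ Ioc a b → p t := by
  have h1 : ∀ᵐ t : ℝ, t ≠ b := by simp [ae_iff, measure_singleton]
  filter_upwards [h, h1] with t ht ht1 htm
  exact ht ⟨htm.1, lt_of_le_of_ne htm.2 ht1⟩

theorem ae_Ioo_of_ae_Icc {p : ℝ → Prop} (h : ∀ᵐ t, t ∈ Ioo a b → p t) :
    ∀ᵐ t, t ∈ Icc a b → p t := by
  have h1 : ∀ᵐ t : ℝ, t ≠ a := by simp [ae_iff, measure_singleton]
  filter_upwards [ae_Ioo_of_ae_Ioc h, h1] with t ht ht1 htm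
  exact ht ⟨lt_of_le_of_ne htm.1 (Ne.symm ht1), htm.2⟩

theorem ae_deriv_eq (h : HasAEDeriv F f a b) : ∀ᵐ t, t ∈ Ioo a b → _root_.deriv F t = f t := by
  filter_upwards [h.deriv] with t ht htm using (ht htm).deriv

theorem intervalIntegrable (h : HasAEDeriv F f a b) : IntervalIntegrable f volume a b := by
  refine h.ac.intervalIntegrable_deriv.congr_ae ?_
  rw [uIoc_of_le h.le, EventuallyEq, ae_restrict_iff' measurableSet_Ioc]
  exact ae_Ioo_of_ae_Ioc h.ae_deriv_eq

theorem mono (h : HasAEDeriv F f a b) {c d : ℝ} (hc : a ≤ c) (hcd : c ≤ d) (hd : d ≤ b) :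
    HasAEDeriv F f c d := by
  refine ⟨hcd, h.ac.mono ?_, ?_⟩
  · rw [uIcc_of_le hcd, uIcc_of_le h.le]; exact Icc_subset_Icc hc hd
  · filter_upwards [h.deriv] with t ht htm
    exact ht ⟨hc.trans_lt htm.1, htm.2.trans_le hd⟩

theorem integral_eq (h : HasAEDeriv F f a b) : ∫ t in a..b, f t = F b - F a := by
  rw [← h.ac.integral_deriv_eq_sub]
  refine intervalIntegral.integral_congr_ae ?_
  rw [uIoc_of_le h.le]
  filter_upwards [ae_Ioo_of_ae_Ioc h.ae_deriv_eq] with t ht htm using (ht htm).symm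

theorem eq (h : HasAEDeriv F f a b) {t : ℝ} (ht : t ∈ Icc a b) :
    F t = F a + ∫ s in a..t, f s := by
  rw [(h.mono le_rfl ht.1 ht.2).integral_eq]; ring

theorem continuousOn (h : HasAEDeriv F f a b) : ContinuousOn F (Icc a b) := by
  have := h.ac.continuousOn; rwa [uIcc_of_le h.le] at this

theorem of_eq_integral (hab : a ≤ b) (hf : IntervalIntegrable f volume a b)
    (h : ∀ t ∈ Icc a b, F t = F a + ∫ s in a..t, f s) : HasAEDeriv F f a b := by
  have key : HasAEDeriv (fun t => F a + ∫ s in a..t, f s) f a b := by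
    refine ⟨hab, ?_, ?_⟩
    · have h1 : AbsolutelyContinuousOnInterval (fun _ : ℝ => F a) a b :=
        (LipschitzWith.const' (F a)).lipschitzOnWith.absolutelyContinuousOnInterval (K := 0)
      exact h1.add (hf.absolutelyContinuousOnInterval_intervalIntegral (c := a) (by simp))
    · filter_upwards [hf.ae_hasDerivAt_integral] with t ht htm
      have := ht (by rw [uIcc_of_le hab]; exact Ioo_subset_Icc_self htm) a (by simp)
      exact this.const_add _
  exact key.congr h

theorem of_hasDerivAt (hab : a ≤ b) (hF : ContinuousOn F (Icc a b))
    (hd : ∀ t ∈ Ioo a b, HasDerivAt F (f t) t) (hf : IntervalIntegrable f volume a b) :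
    HasAEDeriv F f a b := by
  refine of_eq_integral hab hf fun t ht => ?_
  rw [intervalIntegral.integral_eq_sub_of_hasDerivAt_of_le ht.1
    (hF.mono (Icc_subset_Icc_right ht.2))
    (fun s hs => hd s ⟨hs.1, hs.2.trans_le ht.2⟩)
    (hf.mono_set (by
      rw [uIcc_of_le ht.1, uIcc_of_le hab]; exact Icc_subset_Icc_right ht.2))]
  ring

theorem of_contDiffOn (hab : a < b) (hF : ContDiffOn ℝ 1 F (Icc a b)) :
    HasAEDeriv F (derivWithin F (Icc a b)) a b := by
  refine of_hasDerivAt hab.le hF.continuousOn (fun t ht => ?_) ?_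
  · have h1 := (hF.differentiableOn one_ne_zero t (Ioo_subset_Icc_self ht)).hasDerivWithinAt
    exact h1.hasDerivAt (Icc_mem_nhds ht.1 ht.2)
  · refine ContinuousOn.intervalIntegrable ?_
    rw [uIcc_of_le hab.le]
    exact hF.continuousOn_derivWithin (uniqueDiffOn_Icc hab) le_rfl

theorem const (hab : a ≤ b) (c : ℝ) : HasAEDeriv (fun _ => c) (fun _ => 0) a b :=
  of_hasDerivAt hab continuousOn_const (fun t _ => hasDerivAt_const t c)
    intervalIntegrable_const

theorem add (hF : HasAEDeriv F f a b) (hG : HasAEDeriv G g a b) :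
    HasAEDeriv (fun t => F t + G t) (fun t => f t + g t) a b := by
  refine ⟨hF.le, hF.ac.add hG.ac, ?_⟩
  filter_upwards [hF.deriv, hG.deriv] with t h1 h2 ht using (h1 ht).add (h2 ht)

theorem neg (hF : HasAEDeriv F f a b) : HasAEDeriv (fun t => -F t) (fun t => -f t) a b := by
  refine ⟨hF.le, hF.ac.neg, ?_⟩
  filter_upwards [hF.deriv] with t h1 ht using (h1 ht).neg

theorem sub (hF : HasAEDeriv F f a b) (hG : HasAEDeriv G g a b) :
    HasAEDeriv (fun t => F t - G t) (fun t => f t - g t) a b := by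
  refine ⟨hF.le, hF.ac.sub hG.ac, ?_⟩
  filter_upwards [hF.deriv, hG.deriv] with t h1 h2 ht using (h1 ht).sub (h2 ht)

theorem const_mul (c : ℝ) (hF : HasAEDeriv F f a b) :
    HasAEDeriv (fun t => c * F t) (fun t => c * f t) a b := by
  refine ⟨hF.le, hF.ac.const_mul c, ?_⟩
  filter_upwards [hF.deriv] with t h1 ht using (h1 ht).const_mul c

theorem mul (hF : HasAEDeriv F f a b) (hG : HasAEDeriv G g a b) :
    HasAEDeriv (fun t => F t * G t) (fun t => f t * G t + F t * g t) a b := by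
  refine ⟨hF.le, hF.ac.mul hG.ac, ?_⟩
  filter_upwards [hF.deriv, hG.deriv] with t h1 h2 ht using (h1 ht).mul (h2 ht)

theorem sum {ι : Type*} (s : Finset ι) {F f : ι → ℝ → ℝ} (hab : a ≤ b)
    (h : ∀ i ∈ s, HasAEDeriv (F i) (f i) a b) :
    HasAEDeriv (fun t => ∑ i ∈ s, F i t) (fun t => ∑ i ∈ s, f i t) a b := by
  classical
  induction s using Finset.induction_on with
  | empty => simpa using const hab 0
  | insert i s hi ih =>
    simp only [Finset.sum_insert hi]
    exact (h i (Finset.mem_insert_self i s)).add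
      (ih fun j hj => h j (Finset.mem_insert_of_mem hj))

theorem comp {φ φ' : ℝ → ℝ} {c d : ℝ} (hF : HasAEDeriv F f a b)
    (hFm : ∀ t ∈ Icc a b, F t ∈ Icc c d) (hφ : ContDiffOn ℝ 1 φ (Icc c d))
    (hφ' : ∀ y ∈ Icc c d, HasDerivAt φ (φ' y) y) :
    HasAEDeriv (fun t => φ (F t)) (fun t => φ' (F t) * f t) a b := by
  obtain ⟨K, hK⟩ := hφ.exists_lipschitzOnWith (by decide) (convex_Icc _ _) isCompact_Icc
  refine ⟨hF.le, hK.comp_absolutelyContinuousOnInterval hF.ac (by rwa [uIcc_of_le hF.le]), ?_⟩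
  filter_upwards [hF.deriv] with t h1 ht
  exact (hφ' _ (hFm t (Ioo_subset_Icc_self ht))).comp t (h1 ht)

theorem exp (hF : HasAEDeriv F f a b) :
    HasAEDeriv (fun t => Real.exp (F t)) (fun t => Real.exp (F t) * f t) a b := by
  obtain ⟨c, hc⟩ := (isCompact_Icc.image_of_continuousOn hF.continuousOn).bddBelow
  obtain ⟨d, hd⟩ := (isCompact_Icc.image_of_continuousOn hF.continuousOn).bddAbove
  exact hF.comp (c := c) (d := d) (φ' := Real.exp)
    (fun t ht => ⟨hc (mem_image_of_mem F ht), hd (mem_image_of_mem F ht)⟩)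
    Real.contDiff_exp.contDiffOn (fun y _ => Real.hasDerivAt_exp y)

theorem inv (hF : HasAEDeriv F f a b) (hpos : ∀ t ∈ Icc a b, 0 < F t) :
    HasAEDeriv (fun t => (F t)⁻¹) (fun t => -(F t ^ 2)⁻¹ * f t) a b := by
  obtain ⟨t₀, ht₀, hm⟩ := isCompact_Icc.exists_isMinOn (nonempty_Icc.2 hF.le) hF.continuousOn
  obtain ⟨d, hd⟩ := (isCompact_Icc.image_of_continuousOn hF.continuousOn).bddAbove
  have h0 : ∀ y ∈ Icc (F t₀) d, y ≠ 0 := fun y hy => ((hpos t₀ ht₀).trans_le hy.1).ne'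
  exact hF.comp (c := F t₀) (d := d) (φ := fun y => y⁻¹) (φ' := fun y => -(y ^ 2)⁻¹)
    (fun t ht => ⟨hm ht, hd (mem_image_of_mem F ht)⟩)
    (contDiffOn_id.inv h0) (fun y hy => hasDerivAt_inv (h0 y hy))

theorem monotoneOn (hF : HasAEDeriv F f a b) (h : ∀ᵐ t, t ∈ Ioo a b → 0 ≤ f t) :
    MonotoneOn F (Icc a b) := by
  intro s hs t ht hst
  have h1 := (hF.mono hs.1 hst ht.2).integral_eq
  have h2 : 0 ≤ ∫ r in s..t, f r := by
    refine intervalIntegral.integral_nonneg_of_ae_restrict hst ?_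
    rw [EventuallyLE, ae_restrict_iff' measurableSet_Icc]
    filter_upwards [ae_Ioo_of_ae_Icc h] with r hr hrm
    exact hr ⟨hs.1.trans hrm.1, hrm.2.trans ht.2⟩
  linarith

theorem antitoneOn (hF : HasAEDeriv F f a b) (h : ∀ᵐ t, t ∈ Ioo a b → f t ≤ 0) :
    AntitoneOn F (Icc a b) := by
  have := hF.neg.monotoneOn (h.mono fun t ht htm => by have := ht htm; simp; linarith)
  intro s hs t ht hst
  have := this hs ht hst
  simp only at this; linarith

/-- A nondecreasing function that ends no higher than it started is constant. This is how strict
monotonicity is contradicted when the derivative is known only a.e. -/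
theorem ae_eq_zero (hF : HasAEDeriv F f a b) (h : ∀ᵐ t, t ∈ Ioo a b → 0 ≤ f t)
    (hab : F b ≤ F a) : ∀ᵐ t, t ∈ Ioo a b → f t = 0 := by
  have hm := hF.monotoneOn h
  have hc : ∀ t ∈ Icc a b, F t = F a := fun t ht =>
    le_antisymm ((hm ht (right_mem_Icc.2 hF.le) ht.2).trans hab)
      (hm (left_mem_Icc.2 hF.le) ht ht.1)
  have hconst := (const hF.le (F a)).congr hc
  filter_upwards [hF.deriv, hconst.deriv] with t h1 h2 htm using (h1 htm).unique (h2 htm)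

/-- Two functions with the same a.e. derivative that agree at the left end point agree. -/
theorem eqOn (hF : HasAEDeriv F f a b) (hG : HasAEDeriv G f a b) (h : F a = G a) :
    ∀ t ∈ Icc a b, F t = G t := fun t ht => by rw [hF.eq ht, hG.eq ht, h]

end HasAEDeriv

/-- A continuous function vanishing a.e. on a nondegenerate interval vanishes there. -/
theorem eq_zero_of_ae_eq_zero {F : ℝ → ℝ} {a b : ℝ} (hab : a < b)
    (hF : ContinuousOn F (Icc a b)) (h : ∀ᵐ t, t ∈ Ioo a b → F t = 0) :
    ∀ t ∈ Icc a b, F t = 0 := by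
  have h1 : F =ᵐ[volume.restrict (Icc a b)] fun _ => 0 := by
    rw [EventuallyEq, ae_restrict_iff' measurableSet_Icc]
    exact HasAEDeriv.ae_Ioo_of_ae_Icc h
  exact fun t ht => Measure.eqOn_Icc_of_ae_eq volume hab.ne h1 hF continuousOn_const ht

end Liquidation

/-! ### Grönwall's inequality and Volterra equations with integrable time dependence. -/

namespace Liquidation

/-- Integral form of Grönwall's inequality. -/
theorem le_mul_exp_of_le_add_integral {u : ℝ → ℝ} {d K T : ℝ} (hT : 0 ≤ T) (hK : 0 ≤ K)
    (hu : ContinuousOn u (Icc 0 T))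
    (h : ∀ t ∈ Icc 0 T, u t ≤ d + K * ∫ s in (0 : ℝ)..t, u s) :
    ∀ t ∈ Icc 0 T, u t ≤ d * Real.exp (K * t) := by
  have hui : IntervalIntegrable u volume 0 T := by
    refine ContinuousOn.intervalIntegrable ?_
    rwa [uIcc_of_le hT]
  have h1 : HasAEDeriv (fun t => ∫ s in (0 : ℝ)..t, u s) u 0 T :=
    HasAEDeriv.of_eq_integral hT hui (fun t _ => by simp)
  have h2 : HasAEDeriv (fun t => d + K * ∫ s in (0 : ℝ)..t, u s) (fun t => 0 + K * u t) 0 T :=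
    (HasAEDeriv.const hT d).add (h1.const_mul K)
  have hid : HasAEDeriv (fun t => -K * t) (fun _ => -K * 1) 0 T :=
    (HasAEDeriv.of_hasDerivAt hT continuousOn_id (fun t _ => hasDerivAt_id t)
      intervalIntegrable_const).const_mul (-K)
  have h3 := h2.mul hid.exp
  have h4 := h3.antitoneOn (Eventually.of_forall fun t ht => by
    have h5 := h t (Ioo_subset_Icc_self ht)
    have h6 := Real.exp_pos (-K * t)
    have : (0 + K * u t) * Real.exp (-K * t) + (d + K * ∫ s in (0 : ℝ)..t, u s) *
      (Real.exp (-K * t) * (-K * 1))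
        = K * Real.exp (-K * t) * (u t - (d + K * ∫ s in (0 : ℝ)..t, u s)) := by ring
    rw [this]
    exact mul_nonpos_of_nonneg_of_nonpos (by positivity) (by linarith))
  intro t ht
  have h5 := h4 (left_mem_Icc.2 hT) ht ht.1
  simp only [intervalIntegral.integral_same, mul_zero, add_zero, Real.exp_zero, mul_one] at h5
  have h6 : Real.exp (-K * t) * Real.exp (K * t) = 1 := by
    rw [← Real.exp_add]; simp
  calc u t ≤ (d + K * ∫ s in (0 : ℝ)..t, u s) * (Real.exp (-K * t) * Real.exp (K * t)) := by
        rw [h6, mul_one]; exact h t ht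
    _ = (d + K * ∫ s in (0 : ℝ)..t, u s) * Real.exp (-K * t) * Real.exp (K * t) := by ring
    _ ≤ d * Real.exp (K * t) := by gcongr

variable {E : Type*} [NormedAddCommGroup E] [NormedSpace ℝ E]

/-- Grönwall applied to the distance of two solutions; it serves both for uniqueness and for
continuous dependence on the initial value in the shooting argument. -/
theorem volterra_dist_le {T K d : ℝ} (hT : 0 ≤ T) (hK : 0 ≤ K) {v : ℝ → E → E}
    (hv : ∀ᵐ t, t ∈ Icc 0 T → ∀ x y, ‖v t x - v t y‖ ≤ K * ‖x - y‖)
    (hint : ∀ φ : ℝ → E, ContinuousOn φ (Icc 0 T) →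
      IntervalIntegrable (fun s => v s (φ s)) volume 0 T)
    {φ ψ b c : ℝ → E} (hφ : ContinuousOn φ (Icc 0 T)) (hψ : ContinuousOn ψ (Icc 0 T))
    (hφe : ∀ t ∈ Icc 0 T, φ t = b t + ∫ s in (0 : ℝ)..t, v s (φ s))
    (hψe : ∀ t ∈ Icc 0 T, ψ t = c t + ∫ s in (0 : ℝ)..t, v s (ψ s))
    (hd : ∀ t ∈ Icc 0 T, ‖b t - c t‖ ≤ d) :
    ∀ t ∈ Icc 0 T, ‖φ t - ψ t‖ ≤ d * Real.exp (K * t) := by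
  refine le_mul_exp_of_le_add_integral hT hK (hφ.sub hψ).norm fun t ht => ?_
  have hsub : uIcc 0 t ⊆ uIcc 0 T := by
    rw [uIcc_of_le hT, uIcc_of_le ht.1]; exact Icc_subset_Icc_right ht.2
  have hφi := (hint φ hφ).mono_set hsub
  have hψi := (hint ψ hψ).mono_set hsub
  have hni : IntervalIntegrable (fun s => ‖φ s - ψ s‖) volume 0 t := by
    refine ContinuousOn.intervalIntegrable ?_
    rw [uIcc_of_le ht.1]
    exact (hφ.sub hψ).norm.mono (Icc_subset_Icc_right ht.2)
  rw [hφe t ht, hψe t ht, add_sub_add_comm, ← intervalIntegral.integral_sub hφi hψi]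
  refine (norm_add_le _ _).trans (add_le_add (hd t ht) ?_)
  rw [← intervalIntegral.integral_const_mul]
  refine intervalIntegral.norm_integral_le_of_norm_le ht.1 ?_ (hni.const_mul K)
  filter_upwards [hv] with s hs hsm
  exact hs ⟨hsm.1.le, hsm.2.trans ht.2⟩ _ _

/-- Solvability of a Volterra equation with a Carathéodory, globally Lipschitz kernel. -/
theorem exists_volterra [CompleteSpace E] {T K : ℝ} (hT : 0 ≤ T) (hK : 0 ≤ K) {v : ℝ → E → E}
    (hv : ∀ᵐ t, t ∈ Icc 0 T → ∀ x y, ‖v t x - v t y‖ ≤ K * ‖x - y‖)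
    (hint : ∀ φ : ℝ → E, ContinuousOn φ (Icc 0 T) →
      IntervalIntegrable (fun s => v s (φ s)) volume 0 T)
    {b : ℝ → E} (hb : ContinuousOn b (Icc 0 T)) :
    ∃ φ : ℝ → E, Continuous φ ∧
      ∀ t ∈ Icc 0 T, φ t = b t + ∫ s in (0 : ℝ)..t, v s (φ s) := by
  classical
  have hicont : ∀ φ : ℝ → E, ContinuousOn φ (Icc 0 T) →
      ContinuousOn (fun t => b t + ∫ s in (0 : ℝ)..t, v s (φ s)) (Icc 0 T) := fun φ hφ => by
    refine hb.add ?_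
    have := intervalIntegral.continuousOn_primitive_interval' (hint φ hφ) (left_mem_uIcc)
    rwa [uIcc_of_le hT] at this
  have hext : ∀ φ : C(Icc (0 : ℝ) T, E), Continuous (IccExtend hT φ) := fun φ =>
    φ.continuous.Icc_extend'
  let Φ : C(Icc (0 : ℝ) T, E) → C(Icc (0 : ℝ) T, E) := fun φ =>
    ⟨fun t => b t + ∫ s in (0 : ℝ)..t, v s (IccExtend hT φ s),
      (hicont _ (hext φ).continuousOn).domRestrict⟩
  have hΦ : ∀ φ t, Φ φ t = b t + ∫ s in (0 : ℝ)..(t : ℝ), v s (IccExtend hT φ s) :=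
    fun φ t => rfl
  -- The Picard map need not contract, but its $n$-th iterate has Lipschitz constant at most
  -- $(KT)^n/n!$, which is below $1/2$ for large $n$.
  have hiter : ∀ (n : ℕ) (φ ψ : C(Icc (0 : ℝ) T, E)) (t : Icc (0 : ℝ) T),
      ‖Φ^[n] φ t - Φ^[n] ψ t‖ ≤ (K * t) ^ n / n.factorial * dist φ ψ := by
    intro n φ ψ
    induction n with
    | zero =>
      intro t
      simpa [dist_eq_norm] using ContinuousMap.dist_apply_le_dist (f := φ) (g := ψ) t
    | succ n ih =>
      intro t
      rw [Function.iterate_succ_apply', Function.iterate_succ_apply', hΦ, hΦ]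
      have hsub : uIcc 0 (t : ℝ) ⊆ uIcc 0 T := by
        rw [uIcc_of_le hT, uIcc_of_le t.2.1]; exact Icc_subset_Icc_right t.2.2
      rw [add_sub_add_left_eq_sub, ← intervalIntegral.integral_sub
        ((hint _ (hext _).continuousOn).mono_set hsub)
        ((hint _ (hext _).continuousOn).mono_set hsub)]
      have hval : ∫ s in (0 : ℝ)..(t : ℝ), K * ((K * s) ^ n / n.factorial * dist φ ψ) =
          (K * t) ^ (n + 1) / (n + 1).factorial * dist φ ψ := by
        have : (fun s : ℝ => K * ((K * s) ^ n / n.factorial * dist φ ψ)) =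
            fun s => (K ^ (n + 1) / n.factorial * dist φ ψ) * s ^ n := by
          funext s; rw [mul_pow, pow_succ]; ring
        rw [this, intervalIntegral.integral_const_mul, integral_pow, Nat.factorial_succ]
        push_cast
        rw [mul_pow]
        have := Nat.factorial_pos n
        field_simp
        simp
      rw [← hval]
      refine intervalIntegral.norm_integral_le_of_norm_le t.2.1 ?_
        (Continuous.intervalIntegrable (by fun_prop) _ _)
      filter_upwards [hv] with s hs hsm
      have hsm' : s ∈ Icc (0 : ℝ) T := ⟨hsm.1.le, hsm.2.trans t.2.2⟩
      refine (hs hsm' _ _).trans ?_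
      rw [IccExtend_of_mem hT _ hsm', IccExtend_of_mem hT _ hsm']
      exact mul_le_mul_of_nonneg_left (ih ⟨s, hsm'⟩) hK
  obtain ⟨n, hn⟩ : ∃ n : ℕ, (K * T) ^ n / n.factorial < 1 / 2 :=
    ((FloorSemiring.tendsto_pow_div_factorial_atTop (K * T)).eventually
      (gt_mem_nhds (by norm_num))).exists
  have hcontr : ContractingWith (1 / 2) (Φ^[n]) := by
    refine ⟨by rw [div_lt_one (by norm_num)]; norm_num,
      LipschitzWith.of_dist_le_mul fun φ ψ => ?_⟩
    rw [ContinuousMap.dist_le (by positivity)]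
    intro t
    rw [dist_eq_norm]
    refine (hiter n φ ψ t).trans ?_
    refine mul_le_mul_of_nonneg_right ?_ dist_nonneg
    have h1 : (K * t) ^ n / n.factorial ≤ (K * T) ^ n / n.factorial := by
      have := t.2.1
      gcongr
      exact t.2.2
    push_cast
    linarith
  have hfix := hcontr.isFixedPt_fixedPoint_iterate
  set φ := ContractingWith.fixedPoint (Φ^[n]) hcontr
  refine ⟨IccExtend hT φ, hext φ, fun t ht => ?_⟩
  rw [IccExtend_of_mem hT _ ht]
  conv_lhs => rw [← hfix.eq]
  rfl

end Liquidation

/-! ### Planar linear systems and the energy method for boundary value problems. -/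

namespace Liquidation

section LinearSystems

variable {T B : ℝ} {p q r s g k : ℝ → ℝ}

/-- The coefficients are bounded only a.e. and the source terms merely integrable, since $\lambda$
is just an $L^\infty$ function and $\mu$ just an $L^1$ function. -/
theorem exists_linear_system (hT : 0 ≤ T)
    (hp : ∀ᵐ t, t ∈ Icc 0 T → |p t| ≤ B) (hq : ∀ᵐ t, t ∈ Icc 0 T → |q t| ≤ B)
    (hr : ∀ᵐ t, t ∈ Icc 0 T → |r t| ≤ B) (hs : ∀ᵐ t, t ∈ Icc 0 T → |s t| ≤ B)
    (ip : IntervalIntegrable p volume 0 T) (iq : IntervalIntegrable q volume 0 T)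
    (ir : IntervalIntegrable r volume 0 T) (is : IntervalIntegrable s volume 0 T)
    (ig : IntervalIntegrable g volume 0 T) (ik : IntervalIntegrable k volume 0 T) (x y : ℝ) :
    ∃ X Y : ℝ → ℝ, X 0 = x ∧ Y 0 = y ∧
      HasAEDeriv X (fun t => p t * X t + q t * Y t + g t) 0 T ∧
      HasAEDeriv Y (fun t => r t * X t + s t * Y t + k t) 0 T := by
  let v : ℝ → ℝ × ℝ → ℝ × ℝ := fun t z =>
    (p t * z.1 + q t * z.2 + g t, r t * z.1 + s t * z.2 + k t)
  have hcomp : ∀ φ : ℝ → ℝ × ℝ, ContinuousOn φ (Icc 0 T) →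
      IntervalIntegrable (fun t => p t * (φ t).1 + q t * (φ t).2 + g t) volume 0 T ∧
      IntervalIntegrable (fun t => r t * (φ t).1 + s t * (φ t).2 + k t) volume 0 T := by
    intro φ hφ
    have h1 : ContinuousOn (fun t => (φ t).1) (uIcc 0 T) := by
      rw [uIcc_of_le hT]; exact hφ.fst
    have h2 : ContinuousOn (fun t => (φ t).2) (uIcc 0 T) := by
      rw [uIcc_of_le hT]; exact hφ.snd
    exact ⟨((ip.mul_continuousOn h1).add (iq.mul_continuousOn h2)).add ig,
      ((ir.mul_continuousOn h1).add (is.mul_continuousOn h2)).add ik⟩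
  have hint : ∀ φ : ℝ → ℝ × ℝ, ContinuousOn φ (Icc 0 T) →
      IntervalIntegrable (fun t => v t (φ t)) volume 0 T := by
    intro φ hφ
    obtain ⟨h1, h2⟩ := hcomp φ hφ
    rw [intervalIntegrable_iff] at h1 h2 ⊢
    exact h1.prodMk h2
  have hB : 0 ≤ |B| := abs_nonneg B
  obtain ⟨φ, hφ, hφe⟩ := exists_volterra (E := ℝ × ℝ) hT (K := 2 * |B|) (by positivity)
    (v := v) (by
      filter_upwards [hp, hq, hr, hs] with t h1 h2 h3 h4 ht z w
      have key : ∀ c d : ℝ, |c| ≤ B → |d| ≤ B → ∀ e : ℝ,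
          |c * z.1 + d * z.2 + e - (c * w.1 + d * w.2 + e)| ≤ 2 * |B| * ‖z - w‖ := by
        intro c d hc hd e
        have e1 : |z.1 - w.1| ≤ ‖z - w‖ := norm_fst_le (z - w)
        have e2 : |z.2 - w.2| ≤ ‖z - w‖ := norm_snd_le (z - w)
        have : c * z.1 + d * z.2 + e - (c * w.1 + d * w.2 + e)
            = c * (z.1 - w.1) + d * (z.2 - w.2) := by ring
        rw [this]
        calc _ ≤ |c| * |z.1 - w.1| + |d| * |z.2 - w.2| := by
              rw [← abs_mul, ← abs_mul]; exact abs_add_le _ _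
          _ ≤ |B| * ‖z - w‖ + |B| * ‖z - w‖ := by
              have hc' := hc.trans (le_abs_self B)
              have hd' := hd.trans (le_abs_self B)
              gcongr
          _ = _ := by ring
      exact max_le (key _ _ (h1 ht) (h2 ht) _) (key _ _ (h3 ht) (h4 ht) _))
    hint (b := fun _ => (x, y)) continuousOn_const
  have h1 := (hcomp φ hφ.continuousOn).1
  have h2 := (hcomp φ hφ.continuousOn).2
  have hsub : ∀ t ∈ Icc 0 T, uIcc 0 t ⊆ uIcc 0 T := fun t ht => by
    rw [uIcc_of_le hT, uIcc_of_le ht.1]; exact Icc_subset_Icc_right ht.2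
  have e1 : ∀ t ∈ Icc 0 T, (φ t).1 = x + ∫ u in (0 : ℝ)..t, (v u (φ u)).1 := by
    intro t ht
    rw [hφe t ht, intervalIntegral.integral_of_le ht.1,
      intervalIntegral.integral_of_le ht.1, Prod.fst_add, fst_integral]
    exact ((hint φ hφ.continuousOn).mono_set (hsub t ht)).1
  have e2 : ∀ t ∈ Icc 0 T, (φ t).2 = y + ∫ u in (0 : ℝ)..t, (v u (φ u)).2 := by
    intro t ht
    rw [hφe t ht, intervalIntegral.integral_of_le ht.1,
      intervalIntegral.integral_of_le ht.1, Prod.snd_add, snd_integral]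
    exact ((hint φ hφ.continuousOn).mono_set (hsub t ht)).1
  have z1 : (φ 0).1 = x := by simpa using e1 0 (left_mem_Icc.2 hT)
  have z2 : (φ 0).2 = y := by simpa using e2 0 (left_mem_Icc.2 hT)
  exact ⟨fun t => (φ t).1, fun t => (φ t).2, z1, z2,
    HasAEDeriv.of_eq_integral hT h1 fun t ht => by simpa only [z1] using e1 t ht,
    HasAEDeriv.of_eq_integral hT h2 fun t ht => by simpa only [z2] using e2 t ht⟩

theorem linear_system_eq_zero {X Y : ℝ → ℝ} (hT : 0 ≤ T)
    (hp : ∀ᵐ t, t ∈ Icc 0 T → |p t| ≤ B) (hq : ∀ᵐ t, t ∈ Icc 0 T → |q t| ≤ B)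
    (hr : ∀ᵐ t, t ∈ Icc 0 T → |r t| ≤ B) (hs : ∀ᵐ t, t ∈ Icc 0 T → |s t| ≤ B)
    (hX : HasAEDeriv X (fun t => p t * X t + q t * Y t) 0 T)
    (hY : HasAEDeriv Y (fun t => r t * X t + s t * Y t) 0 T)
    (hX0 : X 0 = 0) (hY0 : Y 0 = 0) : ∀ t ∈ Icc 0 T, X t = 0 ∧ Y t = 0 := by
  have hB : 0 ≤ |B| := abs_nonneg B
  have hcont : ContinuousOn (fun t => |X t| + |Y t|) (Icc 0 T) :=
    hX.continuousOn.abs.add hY.continuousOn.abs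
  have key := le_mul_exp_of_le_add_integral (d := 0) (K := 2 * |B|) hT (by positivity) hcont
    (fun t ht => by
      have hi : IntervalIntegrable (fun s => |B| * (|X s| + |Y s|)) volume 0 t := by
        refine ContinuousOn.intervalIntegrable ?_
        rw [uIcc_of_le ht.1]
        exact (hcont.mono (Icc_subset_Icc_right ht.2)).const_smul |B|
      have hb : ∀ {c d : ℝ → ℝ}, (∀ᵐ t, t ∈ Icc 0 T → |c t| ≤ B) →
          (∀ᵐ t, t ∈ Icc 0 T → |d t| ≤ B) →
          |∫ s in (0 : ℝ)..t, (c s * X s + d s * Y s)| ≤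
            ∫ s in (0 : ℝ)..t, |B| * (|X s| + |Y s|) := by
        intro c d hc hd
        rw [← Real.norm_eq_abs]
        refine intervalIntegral.norm_integral_le_of_norm_le ht.1 ?_ hi
        filter_upwards [hc, hd] with u h1 h2 hu
        have hu' : u ∈ Icc 0 T := ⟨hu.1.le, hu.2.trans ht.2⟩
        have h1 := (h1 hu').trans (le_abs_self B)
        have h2 := (h2 hu').trans (le_abs_self B)
        calc _ ≤ |c u| * |X u| + |d u| * |Y u| := by
              rw [← abs_mul, ← abs_mul]; exact abs_add_le _ _
          _ ≤ |B| * |X u| + |B| * |Y u| := by gcongr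
          _ = _ := by ring
      have e1 := hX.eq ht
      have e2 := hY.eq ht
      rw [hX0, zero_add] at e1
      rw [hY0, zero_add] at e2
      have := hb hp hq
      have := hb hr hs
      rw [intervalIntegral.integral_const_mul] at *
      rw [e1, e2]
      linarith)
  intro t ht
  have := key t ht
  rw [zero_mul] at this
  have h1 := abs_nonneg (X t)
  have h2 := abs_nonneg (Y t)
  exact ⟨abs_eq_zero.1 (by linarith), abs_eq_zero.1 (by linarith)⟩

end LinearSystems

section Energy

variable {X W e c β : ℝ → ℝ} {a b : ℝ}

/-- The dissipation identity: a positive multiple of `X W` is nonincreasing along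
`X' = -e W`, `W' = -c X - β W`. -/
theorem exists_weight_antitone
    (hX : HasAEDeriv X (fun t => -(e t * W t)) a b)
    (hW : HasAEDeriv W (fun t => -(c t * X t) - β t * W t) a b)
    (hβ : IntervalIntegrable β volume a b) :
    ∃ E : ℝ → ℝ, (∀ t, 0 < E t) ∧
      HasAEDeriv (fun t => X t * W t * E t)
        (fun t => -(e t * W t ^ 2 * E t + c t * X t ^ 2 * E t)) a b := by
  refine ⟨fun t => Real.exp (∫ s in a..t, β s), fun t => Real.exp_pos _, ?_⟩
  have hE : HasAEDeriv (fun t => Real.exp (∫ s in a..t, β s))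
      (fun t => Real.exp (∫ s in a..t, β s) * β t) a b :=
    (HasAEDeriv.of_eq_integral hX.le hβ (fun t _ => by simp)).exp
  exact ((hX.mul hW).mul hE).congr_deriv' fun t _ => by ring

variable (hX : HasAEDeriv X (fun t => -(e t * W t)) a b)
  (hW : HasAEDeriv W (fun t => -(c t * X t) - β t * W t) a b)
  (hβ : IntervalIntegrable β volume a b)
  (he : ∀ t ∈ Icc a b, 0 < e t) (hc : ∀ᵐ t, t ∈ Icc a b → 0 ≤ c t) (hXb : X b = 0)

include hX hW hβ he hc hXb

/-- The weighted product $XWE$ is nonincreasing and vanishes at $b$, where $X$ does. -/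
theorem energy_nonneg : ∀ t ∈ Icc a b, 0 ≤ X t * W t := by
  obtain ⟨E, hE, hd⟩ := exists_weight_antitone hX hW hβ
  have hanti := hd.antitoneOn (by
    filter_upwards [hc] with t ht htm
    have h1 := ht (Ioo_subset_Icc_self htm)
    have h2 := he t (Ioo_subset_Icc_self htm)
    have h3 := hE t
    have : 0 ≤ e t * W t ^ 2 * E t + c t * X t ^ 2 * E t := by positivity
    linarith)
  intro t ht
  have h := hanti ht (right_mem_Icc.2 hX.le) ht.2
  simp only [hXb, zero_mul] at h
  exact nonneg_of_mul_nonneg_left h (hE t)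

/-- If $XW\le0$ at $s$, then the nonincreasing product $XWE$ is constant on $[s,b]$. Its derivative
vanishes, and since $e>0$ this kills $W$, hence $X'$, hence $X$. -/
theorem energy_eq_zero {s : ℝ} (hs : s ∈ Ico a b) (h0 : X s * W s ≤ 0) :
    ∀ t ∈ Icc s b, X t = 0 ∧ W t = 0 := by
  obtain ⟨E, hE, hd⟩ := exists_weight_antitone hX hW hβ
  have hd' := (hd.mono hs.1 hs.2.le le_rfl).neg
  have hsub : ∀ t ∈ Ioo s b, t ∈ Icc a b := fun t ht => ⟨hs.1.trans ht.1.le, ht.2.le⟩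
  have hz := hd'.ae_eq_zero (by
    filter_upwards [hc] with t ht htm
    have h1 := ht (hsub t htm)
    have h2 := he t (hsub t htm)
    have h3 := hE t
    rw [neg_neg]; positivity) (by
      simp only [hXb, zero_mul, neg_zero]
      have := mul_nonpos_of_nonpos_of_nonneg h0 (hE s).le
      linarith)
  have hW0 : ∀ t ∈ Icc s b, W t = 0 := by
    refine eq_zero_of_ae_eq_zero hs.2 (hW.continuousOn.mono (Icc_subset_Icc_left hs.1)) ?_
    filter_upwards [hc, hz] with t ht hz htm
    have h1 := ht (hsub t htm)
    have h2 := he t (hsub t htm)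
    have h3 := hE t
    have h4 := hz htm
    have h5 : 0 ≤ c t * X t ^ 2 * E t := by positivity
    have h6 : 0 ≤ e t * W t ^ 2 * E t := by positivity
    have h7 : e t * W t ^ 2 * E t = 0 := by linarith
    have h8 : W t ^ 2 = 0 := by
      rcases mul_eq_zero.1 h7 with h | h
      · exact (mul_eq_zero.1 h).resolve_left h2.ne'
      · exact absurd h h3.ne'
    exact pow_eq_zero_iff two_ne_zero |>.1 h8
  have hXc := hX.mono hs.1 hs.2.le le_rfl
  have hXc' := hXc.congr_deriv' (g := fun _ => 0) fun t ht => by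
    simp [hW0 t (Ioo_subset_Icc_self ht)]
  have hX0 := hXc'.eqOn (HasAEDeriv.const hs.2.le (X s)) rfl
  have : X s = 0 := by rw [← hX0 b (right_mem_Icc.2 hs.2.le), hXb]
  exact fun t ht => ⟨by rw [hX0 t ht, this], hW0 t ht⟩

/-- Were $W<0$ at some time, $XW\ge0$ would make $X\le0$ there, so $X$ would have vanished at or
before that time; from a zero of $X$ on, the solution is trivial, a contradiction. Then $X$ is
nonincreasing and ends at $0$. -/
theorem energy_sign (hXa : 0 ≤ X a) (hab : a < b) :
    ∀ t ∈ Icc a b, 0 ≤ W t ∧ 0 ≤ X t := by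
  have hWlt : ∀ t ∈ Ico a b, 0 ≤ W t := by
    intro t ht
    by_contra! hneg
    have hnn := energy_nonneg hX hW hβ he hc hXb t ⟨ht.1, ht.2.le⟩
    have hXt : X t < 0 := by
      by_contra! hge
      have := (energy_eq_zero hX hW hβ he hc hXb ht
        (mul_nonpos_of_nonneg_of_nonpos hge hneg.le) t ⟨le_rfl, ht.2.le⟩).2
      linarith
    obtain ⟨s, hs, hs0⟩ : ∃ s ∈ Icc a t, X s = 0 :=
      intermediate_value_Icc' ht.1 (hX.continuousOn.mono (Icc_subset_Icc_right ht.2.le))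
        ⟨hXt.le, hXa⟩
    have := (energy_eq_zero hX hW hβ he hc hXb ⟨hs.1, hs.2.trans_lt ht.2⟩
      (by rw [hs0, zero_mul]) t ⟨hs.2, ht.2.le⟩).2
    linarith
  have hWall : ∀ t ∈ Icc a b, 0 ≤ W t := by
    intro t ht
    rcases ht.2.lt_or_eq with h | rfl
    · exact hWlt t ⟨ht.1, h⟩
    · have hlim : Tendsto W (𝓝[Ico a t] t) (𝓝 (W t)) :=
        ((hW.continuousOn t ht).mono Ico_subset_Icc_self)
      have : (𝓝[Ico a t] t).NeBot := by
        rw [← mem_closure_iff_nhdsWithin_neBot, closure_Ico hab.ne]; exact ht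
      exact ge_of_tendsto hlim (eventually_nhdsWithin_of_forall hWlt)
  have hanti := hX.antitoneOn (Eventually.of_forall fun t ht => by
    have := mul_nonneg (he t (Ioo_subset_Icc_self ht)).le (hWall t (Ioo_subset_Icc_self ht))
    linarith)
  exact fun t ht => ⟨hWall t ht, by
    have := hanti ht (right_mem_Icc.2 hX.le) ht.2
    rwa [hXb] at this⟩

end Energy

end Liquidation

/-! ### The homogeneous system, the Riccati equation and the function $h^\delta$. -/

namespace Liquidation

namespace Market

/-- The standing assumptions on the coefficients, for impact weight `δ`. -/
structure Regular (M : Market) (δ : ℝ) : Prop where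
  T_pos : 0 < M.T
  δ_nonneg : 0 ≤ δ
  lam_memLp : MemLp M.lam ⊤ M.vol
  lam_nonneg : ∀ᵐ t, t ∈ Icc 0 M.T → 0 ≤ M.lam t
  κ_contDiff : ContDiffOn ℝ 1 M.κ (Icc 0 M.T)
  κ_nonneg : ∀ t ∈ Icc 0 M.T, 0 ≤ M.κ t
  η_contDiff : ContDiffOn ℝ 1 M.η (Icc 0 M.T)
  η_pos : ∀ t ∈ Icc 0 M.T, 0 < M.η t
  lam_add_nonneg : ∀ᵐ t, t ∈ Icc 0 M.T → 0 ≤ M.lam t + δ * derivWithin M.κ (Icc 0 M.T) t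
  η_sub_pos : ∀ t ∈ Icc 0 M.T, 0 < M.η t - δ * M.κ t
  lam_sub_nonneg : ∀ᵐ t, t ∈ Icc 0 M.T → 0 ≤ M.lam t - δ * M.κ t

/-- `(p,q)` solves the homogeneous forward-backward system on `[0,b]`. -/
structure IsHomog (M : Market) (δ b : ℝ) (p q : ℝ → ℝ) : Prop where
  dX : HasAEDeriv p (fun t => -((q t - δ * M.κ t * p t) / M.η t)) 0 b
  dY : HasAEDeriv q (fun t => -(M.lam t * p t)) 0 b

/-- The integrating factor `exp(-∫₀ᵗ δκ/η)`. -/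
noncomputable def discount (M : Market) (δ t : ℝ) : ℝ := Real.exp (-∫ s in (0 : ℝ)..t, δ * M.κ s / M.η s)

theorem discount_pos (M : Market) (δ t : ℝ) : 0 < M.discount δ t := Real.exp_pos _

theorem discount_zero (M : Market) (δ : ℝ) : M.discount δ 0 = 1 := by simp [discount]

variable {M : Market} {δ : ℝ}

namespace Regular

variable (hM : M.Regular δ)
include hM

theorem κ_cont : ContinuousOn M.κ (Icc 0 M.T) := hM.κ_contDiff.continuousOn

theorem η_cont : ContinuousOn M.η (Icc 0 M.T) := hM.η_contDiff.continuousOn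

theorem η_inv_cont : ContinuousOn (fun t => (M.η t)⁻¹) (Icc 0 M.T) :=
  hM.η_cont.inv₀ fun t ht => (hM.η_pos t ht).ne'

theorem div_η_cont {f : ℝ → ℝ} {s : Set ℝ} (hs : s ⊆ Icc 0 M.T) (hf : ContinuousOn f s) :
    ContinuousOn (fun t => f t / M.η t) s :=
  hf.div (hM.η_cont.mono hs) fun t ht => (hM.η_pos t (hs ht)).ne'

theorem δκη_cont : ContinuousOn (fun t => δ * M.κ t / M.η t) (Icc 0 M.T) :=
  hM.div_η_cont Subset.rfl (continuousOn_const.mul hM.κ_cont)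

theorem intervalIntegrable_of_cont {f : ℝ → ℝ} (hf : ContinuousOn f (Icc 0 M.T)) :
    IntervalIntegrable f volume 0 M.T := by
  refine ContinuousOn.intervalIntegrable ?_
  rwa [uIcc_of_le hM.T_pos.le]

theorem lam_integrable : IntervalIntegrable M.lam volume 0 M.T := by
  rw [intervalIntegrable_iff_integrableOn_Icc_of_le hM.T_pos.le]
  have : IsFiniteMeasure M.vol := ⟨by simp [vol]⟩
  exact hM.lam_memLp.integrable le_top

theorem integrable_mul_cont {f g : ℝ → ℝ} (hf : IntervalIntegrable f volume 0 M.T)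
    (hg : ContinuousOn g (Icc 0 M.T)) :
    IntervalIntegrable (fun t => f t * g t) volume 0 M.T := by
  refine hf.mul_continuousOn ?_
  rwa [uIcc_of_le hM.T_pos.le]

theorem integrable_cont_mul {f g : ℝ → ℝ} (hf : IntervalIntegrable f volume 0 M.T)
    (hg : ContinuousOn g (Icc 0 M.T)) :
    IntervalIntegrable (fun t => g t * f t) volume 0 M.T := by
  refine hf.continuousOn_mul ?_
  rwa [uIcc_of_le hM.T_pos.le]

theorem integrable_mono {f : ℝ → ℝ} (hf : IntervalIntegrable f volume 0 M.T) {a b : ℝ}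
    (ha : a ∈ Icc 0 M.T) (hb : b ∈ Icc 0 M.T) : IntervalIntegrable f volume a b := by
  refine hf.mono_set ?_
  rw [uIcc_of_le hM.T_pos.le]
  exact uIcc_subset_Icc ha hb

theorem lam_bound : ∃ B : ℝ, ∀ᵐ t, t ∈ Icc 0 M.T → |M.lam t| ≤ B := by
  refine ⟨(eLpNorm M.lam ⊤ M.vol).toReal, ?_⟩
  have h := ae_le_eLpNormEssSup (f := M.lam) (μ := M.vol)
  rw [vol, ae_restrict_iff' measurableSet_Icc] at h
  filter_upwards [h] with t ht htm
  have h1 := ht htm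
  rw [← eLpNorm_exponent_top] at h1
  have h2 := ENNReal.toReal_mono hM.lam_memLp.2.ne h1
  simpa using h2

omit hM in
theorem exists_bound_cont {f : ℝ → ℝ} (hf : ContinuousOn f (Icc 0 M.T)) :
    ∃ B : ℝ, ∀ t ∈ Icc 0 M.T, |f t| ≤ B := by
  obtain ⟨B, hB⟩ := isCompact_Icc.exists_bound_of_continuousOn hf
  exact ⟨B, hB⟩

/-- A common bound for the coefficients of the forward-backward system. -/
theorem coeff_bound : ∃ B : ℝ, 0 ≤ B ∧ (∀ᵐ t, t ∈ Icc 0 M.T → |M.lam t| ≤ B) ∧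
    (∀ t ∈ Icc 0 M.T, |δ * M.κ t / M.η t| ≤ B) ∧ (∀ t ∈ Icc 0 M.T, |(M.η t)⁻¹| ≤ B) := by
  obtain ⟨B1, h1⟩ := hM.lam_bound
  obtain ⟨B2, h2⟩ := exists_bound_cont (M := M) hM.δκη_cont
  obtain ⟨B3, h3⟩ := exists_bound_cont (M := M) hM.η_inv_cont
  refine ⟨max (max |B1| B2) B3, ?_, ?_, fun t ht => ?_, fun t ht => ?_⟩
  · exact (abs_nonneg B1).trans ((le_max_left _ _).trans (le_max_left _ _))
  · filter_upwards [h1] with t ht htm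
    exact (ht htm).trans ((le_abs_self B1).trans ((le_max_left _ _).trans (le_max_left _ _)))
  · exact (h2 t ht).trans ((le_max_right _ _).trans (le_max_left _ _))
  · exact (h3 t ht).trans (le_max_right _ _)

theorem κ_deriv : HasAEDeriv M.κ (derivWithin M.κ (Icc 0 M.T)) 0 M.T :=
  HasAEDeriv.of_contDiffOn hM.T_pos hM.κ_contDiff

theorem κ'_cont : ContinuousOn (derivWithin M.κ (Icc 0 M.T)) (Icc 0 M.T) :=
  hM.κ_contDiff.continuousOn_derivWithin (uniqueDiffOn_Icc hM.T_pos) le_rfl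

theorem discount_deriv :
    HasAEDeriv (M.discount δ) (fun t => M.discount δ t * -(δ * M.κ t / M.η t)) 0 M.T := by
  have h := HasAEDeriv.of_eq_integral (F := fun t => ∫ s in (0 : ℝ)..t, δ * M.κ s / M.η s)
    hM.T_pos.le (hM.intervalIntegrable_of_cont hM.δκη_cont) (fun t _ => by simp)
  exact h.neg.exp

theorem exists_homog (x y : ℝ) : ∃ p q : ℝ → ℝ, p 0 = x ∧ q 0 = y ∧ M.IsHomog δ M.T p q := by
  obtain ⟨B, hB, h1, h2, h3⟩ := hM.coeff_bound
  obtain ⟨p, q, hp0, hq0, hp, hq⟩ := exists_linear_system (B := B)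
    (p := fun t => δ * M.κ t / M.η t) (q := fun t => -(M.η t)⁻¹) (r := fun t => -M.lam t)
    (s := fun _ => 0) (g := fun _ => 0) (k := fun _ => 0) hM.T_pos.le
    (Eventually.of_forall h2) (Eventually.of_forall fun t ht => by rw [abs_neg]; exact h3 t ht)
    (h1.mono fun t ht htm => by rw [abs_neg]; exact ht htm)
    (Eventually.of_forall fun t _ => by simpa using hB)
    (hM.intervalIntegrable_of_cont hM.δκη_cont)
    (hM.intervalIntegrable_of_cont hM.η_inv_cont).neg hM.lam_integrable.neg
    intervalIntegrable_const intervalIntegrable_const intervalIntegrable_const x y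
  exact ⟨p, q, hp0, hq0, hp.congr_deriv' fun t _ => by ring,
    hq.congr_deriv' fun t _ => by ring⟩

theorem homog_eq_zero {b : ℝ} (hb : b ≤ M.T) {p q : ℝ → ℝ} (h : M.IsHomog δ b p q)
    (hp : p 0 = 0) (hq : q 0 = 0) : ∀ t ∈ Icc 0 b, p t = 0 ∧ q t = 0 := by
  obtain ⟨B, hB, h1, h2, h3⟩ := hM.coeff_bound
  have hs : ∀ {t}, t ∈ Icc 0 b → t ∈ Icc 0 M.T := fun ht => ⟨ht.1, ht.2.trans hb⟩
  exact linear_system_eq_zero (B := B) (T := b)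
    (p := fun t => δ * M.κ t / M.η t) (q := fun t => -(M.η t)⁻¹) (r := fun t => -M.lam t)
    (s := fun _ => 0) h.dX.le
    (Eventually.of_forall fun t ht => h2 t (hs ht))
    (Eventually.of_forall fun t ht => by rw [abs_neg]; exact h3 t (hs ht))
    (h1.mono fun t ht htm => by rw [abs_neg]; exact ht (hs htm))
    (Eventually.of_forall fun t _ => by simpa using hB)
    (h.dX.congr_deriv' fun t _ => by ring) (h.dY.congr_deriv' fun t _ => by ring) hp hq

/-- The system has trace $\delta\kappa/\eta$, which the discount factor compensates. -/
theorem wronskian {b : ℝ} (hb : b ≤ M.T) {p q z y : ℝ → ℝ} (h : M.IsHomog δ b p q)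
    (h' : M.IsHomog δ b z y) :
    ∀ t ∈ Icc 0 b, (p t * y t - q t * z t) * M.discount δ t = p 0 * y 0 - q 0 * z 0 := by
  have hd := ((h.dX.mul h'.dY).sub (h.dY.mul h'.dX)).mul
    (hM.discount_deriv.mono le_rfl h.dX.le hb)
  have hc := (hd.congr_deriv' (g := fun _ => 0) fun t ht => by
    have := (hM.η_pos t ⟨ht.1.le, ht.2.le.trans hb⟩).ne'
    field_simp
    ring).eqOn (HasAEDeriv.const h.dX.le (p 0 * y 0 - q 0 * z 0))
      (by simp [discount_zero])
  exact hc

/-- The pair `(p, ηξ)`, with `ηξ = q - δκp`, solves a system of the form treated by the energy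
estimates. -/
theorem homog_rate {b : ℝ} (hb : b ≤ M.T) {p q : ℝ → ℝ} (h : M.IsHomog δ b p q) :
    HasAEDeriv p (fun t => -((M.η t)⁻¹ * (q t - δ * M.κ t * p t))) 0 b ∧
    HasAEDeriv (fun t => q t - δ * M.κ t * p t)
      (fun t => -((M.lam t + δ * derivWithin M.κ (Icc 0 M.T) t) * p t) -
        -(δ * M.κ t / M.η t) * (q t - δ * M.κ t * p t)) 0 b := by
  refine ⟨h.dX.congr_deriv' fun t _ => by ring, ?_⟩
  have := h.dY.sub (((hM.κ_deriv.mono le_rfl h.dX.le hb).const_mul δ).mul h.dX)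
  exact this.congr_deriv' fun t _ => by ring

theorem lam_add_nonneg' {a b : ℝ} (ha : 0 ≤ a) (hb : b ≤ M.T) :
    ∀ᵐ t, t ∈ Icc a b → 0 ≤ M.lam t + δ * derivWithin M.κ (Icc 0 M.T) t :=
  hM.lam_add_nonneg.mono fun _ ht htm => ht ⟨ha.trans htm.1, htm.2.trans hb⟩

theorem η_inv_pos {a b : ℝ} (ha : 0 ≤ a) (hb : b ≤ M.T) : ∀ t ∈ Icc a b, 0 < (M.η t)⁻¹ :=
  fun t ht => inv_pos.2 (hM.η_pos t ⟨ha.trans ht.1, ht.2.trans hb⟩)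

theorem neg_δκη_integrable {b : ℝ} (h0 : 0 ≤ b) (hb : b ≤ M.T) :
    IntervalIntegrable (fun t => -(δ * M.κ t / M.η t)) volume 0 b :=
  (hM.integrable_mono (hM.intervalIntegrable_of_cont hM.δκη_cont)
    (left_mem_Icc.2 hM.T_pos.le) ⟨h0, hb⟩).neg

/-- A homogeneous solution with vanishing positions at both ends is trivial. -/
theorem homog_bvp {b : ℝ} (h0 : 0 < b) (hb : b ≤ M.T) {p q : ℝ → ℝ} (h : M.IsHomog δ b p q)
    (hp0 : p 0 = 0) (hpb : p b = 0) : ∀ t ∈ Icc 0 b, p t = 0 ∧ q t = 0 := by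
  obtain ⟨hX, hW⟩ := hM.homog_rate hb h
  intro t ht
  obtain ⟨h1, h2⟩ := energy_eq_zero hX hW (hM.neg_δκη_integrable h0.le hb)
    (hM.η_inv_pos le_rfl hb) (hM.lam_add_nonneg' le_rfl hb) hpb ⟨le_rfl, h0⟩
    (by rw [hp0, zero_mul]) t ht
  rw [h1, mul_zero, sub_zero] at h2
  exact ⟨h1, h2⟩

/-- The fundamental solution with initial data `(0,-1)` does not vanish after time `0`. -/
theorem fund_ne_zero {z y : ℝ → ℝ} (h : M.IsHomog δ M.T z y) (hz : z 0 = 0) (hy : y 0 = -1) :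
    ∀ t ∈ Ioc 0 M.T, z t ≠ 0 := by
  intro t ht h0
  have := (hM.homog_bvp ht.1 ht.2 ⟨h.dX.mono le_rfl ht.1.le ht.2, h.dY.mono le_rfl ht.1.le ht.2⟩
    hz h0 0 (left_mem_Icc.2 ht.1.le)).2
  rw [hy] at this; norm_num at this

/-- The homogeneous solution with `p_0 = 1` and `p_T = 0`. -/
theorem exists_decaying : ∃ u v : ℝ → ℝ, M.IsHomog δ M.T u v ∧
    (∀ t ∈ Ico 0 M.T, 0 < u t) ∧ u M.T = 0 ∧ 0 < v M.T := by
  obtain ⟨z, y, hz, hy, h⟩ := hM.exists_homog 0 (-1)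
  obtain ⟨p, q, hp, hq, h'⟩ := hM.exists_homog 1 0
  have hzT := hM.fund_ne_zero h hz hy M.T ⟨hM.T_pos, le_rfl⟩
  have hT : M.T ∈ Icc 0 M.T := right_mem_Icc.2 hM.T_pos.le
  -- Adding a multiple of $z$ does not move the initial position, as $z_0=0$; this multiple makes
  -- the terminal position vanish.
  set k := -(p M.T / z M.T)
  have huv : M.IsHomog δ M.T (fun t => p t + k * z t) (fun t => q t + k * y t) :=
    ⟨(h'.dX.add (h.dX.const_mul k)).congr_deriv' fun t _ => by ring,
      (h'.dY.add (h.dY.const_mul k)).congr_deriv' fun t _ => by ring⟩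
  have huT : p M.T + k * z M.T = 0 := by simp only [k]; field_simp; ring
  obtain ⟨hX, hW⟩ := hM.homog_rate le_rfl huv
  have hβ := hM.neg_δκη_integrable hM.T_pos.le le_rfl
  have he := hM.η_inv_pos (a := 0) le_rfl le_rfl
  have hc := hM.lam_add_nonneg' (a := 0) le_rfl le_rfl
  have hsign := energy_sign hX hW hβ he hc huT (by simp [hp, hz]) hM.T_pos
  have hwr := hM.wronskian le_rfl huv h
  simp only [hp, hz, hq, hy] at hwr
  -- The discounted Wronskian with $(z,y)$ is identically $-1$, so both components cannot vanish at
  -- $T$. The same argument gives $u>0$ before $T$.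
  have hvT : q M.T + k * y M.T ≠ 0 := by
    intro h0
    have := hwr M.T hT
    rw [huT, h0] at this; norm_num at this
  refine ⟨_, _, huv, fun t ht => ?_, huT, ?_⟩
  · refine lt_of_le_of_ne (hsign t ⟨ht.1, ht.2.le⟩).2 fun h0 => ?_
    have hz0 := energy_eq_zero hX hW hβ he hc huT ht (by rw [← h0, zero_mul]) t ⟨le_rfl, ht.2.le⟩
    have h2 := hz0.2
    rw [← h0, mul_zero, sub_zero] at h2
    have := hwr t ⟨ht.1, ht.2.le⟩
    rw [← h0, h2] at this; norm_num at this
  · have := (hsign M.T hT).1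
    rw [huT, mul_zero, sub_zero] at this
    exact lt_of_le_of_ne this hvT.symm

/-- The quotient $A=v/u$ of adjoint and position along the decaying solution linearizes the Riccati
equation; it blows up at $T$ because $u_T=0$ from above and $v_T>0$. -/
theorem exists_riccati : ∃ A, M.IsRiccati δ A := by
  obtain ⟨u, v, huv, hu, huT, hvT⟩ := hM.exists_decaying
  have hT := hM.T_pos
  have hlim : ∀ {f : ℝ → ℝ}, ContinuousOn f (Icc 0 M.T) →
      Tendsto f (𝓝[<] M.T) (𝓝 (f M.T)) := fun {f} hf => by
    rw [← nhdsWithin_Ioo_eq_nhdsLT hT]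
    exact (hf M.T (right_mem_Icc.2 hT.le)).mono Ioo_subset_Icc_self
  refine ⟨fun t => (u t)⁻¹ * v t, ?_, fun t ht => ?_, ?_⟩
  · exact ((huv.dX.continuousOn.mono Ico_subset_Icc_self).inv₀ fun t ht => (hu t ht).ne').mul
      (huv.dY.continuousOn.mono Ico_subset_Icc_self)
  · have h1 := (huv.dX.mono le_rfl ht.1 ht.2.le).inv
      (fun s hs => hu s ⟨hs.1, hs.2.trans_lt ht.2⟩)
    have h2 := h1.mul (huv.dY.mono le_rfl ht.1 ht.2.le)
    refine (h2.congr_deriv' (g := fun s => ((u s)⁻¹ * v s) ^ 2 / M.η s -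
      δ * (M.κ s / M.η s) * ((u s)⁻¹ * v s) - M.lam s) fun s hs => ?_).eq ⟨ht.1, le_rfl⟩
    have hs' : s ∈ Ico 0 M.T := ⟨hs.1.le, hs.2.trans ht.2⟩
    have e1 := (hu s hs').ne'
    have e2 := (hM.η_pos s ⟨hs'.1, hs'.2.le⟩).ne'
    field_simp
    ring
  · have h1 : Tendsto u (𝓝[<] M.T) (𝓝[>] 0) := by
      refine tendsto_nhdsWithin_iff.2 ⟨by simpa [huT] using hlim huv.dX.continuousOn, ?_⟩
      rw [← nhdsWithin_Ioo_eq_nhdsLT hT]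
      exact eventually_nhdsWithin_of_forall fun t ht => hu t ⟨ht.1.le, ht.2⟩
    exact (tendsto_inv_nhdsGT_zero.comp h1).atTop_mul_pos hvT (hlim huv.dY.continuousOn)

theorem riccati_spec : M.IsRiccati δ (M.riccati δ) := by
  classical
  have h := hM.exists_riccati
  rw [riccati, dif_pos h]
  exact h.choose_spec

/-- The function `h^δ` is a multiple of the fundamental solution vanishing at time `0`. -/
theorem hFun_eq {z y : ℝ → ℝ} (h : M.IsHomog δ M.T z y) (hz : z 0 = 0) (hy : y 0 = -1)
    {t : ℝ} (ht : t ∈ Ico 0 M.T) : M.hFun δ t = z t * M.discount δ t := by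
  have hR := hM.riccati_spec
  set A := M.riccati δ with hA
  have hsub : Icc 0 t ⊆ Icc 0 M.T := Icc_subset_Icc_right ht.2.le
  have hAc : ContinuousOn A (Icc 0 t) := hR.cont.mono (Icc_subset_Ico_right ht.2)
  have hint : ∀ {f : ℝ → ℝ}, ContinuousOn f (Icc 0 t) → IntervalIntegrable f volume 0 t :=
    fun {f} hf => ContinuousOn.intervalIntegrable (by rwa [uIcc_of_le ht.1])
  have hprim : ∀ {f : ℝ → ℝ}, ContinuousOn f (Icc 0 t) →
      HasAEDeriv (fun t => ∫ s in (0 : ℝ)..t, f s) f 0 t := fun {f} hf =>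
    HasAEDeriv.of_eq_integral ht.1 (hint hf) (fun t _ => by simp)
  have hAη : ContinuousOn (fun r => A r / M.η r) (Icc 0 t) := hM.div_η_cont hsub hAc
  have hκη : ContinuousOn (fun r => δ * M.κ r / M.η r) (Icc 0 t) := hM.δκη_cont.mono hsub
  -- The inner exponential in $h^\delta$ is $\Psi^2$ times the discount, with $\Psi=\exp\int
  -- A/\eta$.
  have hcomb : ∀ s ∈ Icc 0 t, Real.exp (∫ r in (0 : ℝ)..s, (2 * A r - δ * M.κ r) / M.η r) =
      Real.exp (∫ r in (0 : ℝ)..s, A r / M.η r) ^ 2 * M.discount δ s := by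
    intro s hs
    have hss : uIcc 0 s ⊆ uIcc 0 t := by
      rw [uIcc_of_le hs.1, uIcc_of_le ht.1]; exact Icc_subset_Icc_right hs.2
    rw [discount, sq, ← Real.exp_add, ← Real.exp_add]
    congr 1
    have e1 : (fun r => (2 * A r - δ * M.κ r) / M.η r) =
        fun r => 2 * (A r / M.η r) - δ * M.κ r / M.η r := by funext r; ring
    rw [e1, intervalIntegral.integral_sub ((hint hAη).mono_set hss |>.const_mul 2)
      ((hint hκη).mono_set hss), intervalIntegral.integral_const_mul]
    ring
  have hAd : HasAEDeriv A
      (fun s => (A s) ^ 2 / M.η s - δ * (M.κ s / M.η s) * A s - M.lam s) 0 t := by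
    refine HasAEDeriv.of_eq_integral ht.1 ?_ fun s hs => hR.eq s ⟨hs.1, hs.2.trans_lt ht.2⟩
    refine (hint ?_).sub (hM.integrable_mono hM.lam_integrable
      (left_mem_Icc.2 hM.T_pos.le) ⟨ht.1, ht.2.le⟩)
    exact (hM.div_η_cont hsub (hAc.pow 2)).sub ((continuousOn_const.mul
      (hM.div_η_cont hsub (hM.κ_cont.mono hsub))).mul hAc)
  have hΦ := (hprim hAη).neg.exp
  have hΨ := (hprim hAη).exp
  have hK := (hprim hκη).exp
  have hg := hprim (f := fun s => (M.η s)⁻¹ *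
      Real.exp (∫ r in (0 : ℝ)..s, (2 * A r - δ * M.κ r) / M.η r))
    ((hM.η_inv_cont.mono hsub).mul (hprim (hM.div_η_cont hsub
      ((continuousOn_const.mul hAc).sub (continuousOn_const.mul (hM.κ_cont.mono hsub))))).exp.continuousOn)
  have hzt := (hΦ.mul hg).mul hK
  have hyt := (hAd.mul hzt).sub hΨ
  have hΦΨ : ∀ s, Real.exp (-∫ r in (0 : ℝ)..s, A r / M.η r) *
      Real.exp (∫ r in (0 : ℝ)..s, A r / M.η r) = 1 := fun s => by
    rw [← Real.exp_add]; simp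
  have hLK : ∀ s, M.discount δ s * Real.exp (∫ r in (0 : ℝ)..s, δ * M.κ r / M.η r) = 1 :=
    fun s => by rw [discount, ← Real.exp_add]; simp
  have hz' := hzt.congr_deriv' (g := fun s =>
      -((A s - δ * M.κ s) / M.η s) * (Real.exp (-∫ r in (0 : ℝ)..s, A r / M.η r) *
      (∫ s in (0 : ℝ)..s, (M.η s)⁻¹ *
        Real.exp (∫ r in (0 : ℝ)..s, (2 * A r - δ * M.κ r) / M.η r)) *
      Real.exp (∫ r in (0 : ℝ)..s, δ * M.κ r / M.η r))
      + Real.exp (∫ r in (0 : ℝ)..s, A r / M.η r) / M.η s) (fun s hs => by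
    rw [hcomb s (Ioo_subset_Icc_self hs)]
    have e1 := hΦΨ s
    have e2 := hLK s
    set a := Real.exp (-∫ r in (0 : ℝ)..s, A r / M.η r)
    set b := Real.exp (∫ r in (0 : ℝ)..s, A r / M.η r)
    set c := Real.exp (∫ r in (0 : ℝ)..s, δ * M.κ r / M.η r)
    set d := M.discount δ s
    have : a * ((M.η s)⁻¹ * (b ^ 2 * d)) * c = b / M.η s := by
      calc _ = (a * b) * (d * c) * (b / M.η s) := by ring
        _ = _ := by rw [e1, e2]; ring
    linear_combination -this)
  have hz0 := hz'.sub (h.dX.mono le_rfl ht.1 ht.2.le)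
  have hy0 := hyt.sub (h.dY.mono le_rfl ht.1 ht.2.le)
  -- The pair $\tilde z=h^\delta/\mathrm{discount}$, $\tilde y=A\tilde z-\Psi$ solves the
  -- homogeneous system and starts at $(0,-1)$, like $(z,y)$. Only the Riccati equation for $A$
  -- enters, so no uniqueness of $A$ is needed.
  have hdiff : M.IsHomog δ t
      (fun s => Real.exp (-∫ r in (0 : ℝ)..s, A r / M.η r) *
        (∫ s in (0 : ℝ)..s, (M.η s)⁻¹ *
          Real.exp (∫ r in (0 : ℝ)..s, (2 * A r - δ * M.κ r) / M.η r)) *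
        Real.exp (∫ r in (0 : ℝ)..s, δ * M.κ r / M.η r) - z s)
      (fun s => A s * (Real.exp (-∫ r in (0 : ℝ)..s, A r / M.η r) *
        (∫ s in (0 : ℝ)..s, (M.η s)⁻¹ *
          Real.exp (∫ r in (0 : ℝ)..s, (2 * A r - δ * M.κ r) / M.η r)) *
        Real.exp (∫ r in (0 : ℝ)..s, δ * M.κ r / M.η r)) -
          Real.exp (∫ r in (0 : ℝ)..s, A r / M.η r) - y s) := by
    refine ⟨hz0.congr_deriv' fun s hs => ?_, ?_⟩
    · have := (hM.η_pos s (hsub (Ioo_subset_Icc_self hs))).ne'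
      field_simp
      ring
    · have h3 := ((hAd.mul hz').sub hΨ).sub (h.dY.mono le_rfl ht.1 ht.2.le)
      refine h3.congr_deriv' fun s hs => ?_
      have := (hM.η_pos s (hsub (Ioo_subset_Icc_self hs))).ne'
      field_simp
      ring
  have hfin := (hM.homog_eq_zero ht.2.le hdiff (by simp [hz]) (by simp [hy]) t
    ⟨ht.1, le_rfl⟩).1
  rw [hFun, ← hA]
  have e2 := hLK t
  have e3 := sub_eq_zero.1 hfin
  rw [← e3, mul_assoc, mul_comm (Real.exp (∫ r in (0 : ℝ)..t, δ * M.κ r / M.η r)), e2, mul_one]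

theorem hFun_pos {t : ℝ} (ht : t ∈ Ioo 0 M.T) : 0 < M.hFun δ t := by
  have hR := hM.riccati_spec
  rw [hFun]
  refine mul_pos (Real.exp_pos _) ?_
  have hsub : Icc 0 t ⊆ Icc 0 M.T := Icc_subset_Icc_right ht.2.le
  have hAc : ContinuousOn (M.riccati δ) (Icc 0 t) := hR.cont.mono (Icc_subset_Ico_right ht.2)
  have hc : ContinuousOn (fun s => (2 * M.riccati δ s - δ * M.κ s) / M.η s) (Icc 0 t) :=
    hM.div_η_cont hsub ((continuousOn_const.mul hAc).sub
      (continuousOn_const.mul (hM.κ_cont.mono hsub)))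
  have hp : HasAEDeriv _ _ 0 t := HasAEDeriv.of_eq_integral
    (F := fun s => ∫ r in (0 : ℝ)..s, (2 * M.riccati δ r - δ * M.κ r) / M.η r) ht.1.le
    (ContinuousOn.intervalIntegrable (by rwa [uIcc_of_le ht.1.le])) (fun t _ => by simp)
  refine intervalIntegral.intervalIntegral_pos_of_pos_on ?_ (fun s hs => ?_) ht.1
  · refine ContinuousOn.intervalIntegrable ?_
    rw [uIcc_of_le ht.1.le]
    exact (hM.η_inv_cont.mono hsub).mul hp.exp.continuousOn
  · exact mul_pos (inv_pos.2 (hM.η_pos s (hsub (Ioo_subset_Icc_self hs)))) (Real.exp_pos _)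

/-- Positivity is read off the explicit formula for $h^\delta$ on the open interval; at $T$,
continuity gives $z\ge0$ and `fund_ne_zero` excludes $0$. -/
theorem fund_pos {z y : ℝ → ℝ} (h : M.IsHomog δ M.T z y) (hz : z 0 = 0) (hy : y 0 = -1) :
    ∀ t ∈ Ioc 0 M.T, 0 < z t := by
  have hT := hM.T_pos
  have h1 : ∀ t ∈ Ioo 0 M.T, 0 < z t := fun t ht => by
    have := hM.hFun_pos ht
    rw [hM.hFun_eq h hz hy ⟨ht.1.le, ht.2⟩] at this
    exact pos_of_mul_pos_left this (M.discount_pos δ t).le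
  intro t ht
  rcases ht.2.lt_or_eq with hlt | rfl
  · exact h1 t ⟨ht.1, hlt⟩
  · refine lt_of_le_of_ne ?_ (hM.fund_ne_zero h hz hy _ ht).symm
    have hlim : Tendsto z (𝓝[Ioo 0 M.T] M.T) (𝓝 (z M.T)) :=
      (h.dX.continuousOn _ (right_mem_Icc.2 hT.le)).mono Ioo_subset_Icc_self
    have : (𝓝[Ioo 0 M.T] M.T).NeBot := by
      rw [← mem_closure_iff_nhdsWithin_neBot, closure_Ioo hT.ne]; exact right_mem_Icc.2 hT.le
    exact ge_of_tendsto hlim (eventually_nhdsWithin_of_forall fun t ht => (h1 t ht).le)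

/-- Since $y'=-\lambda z\le0$, the adjoint stays below its initial value. -/
theorem fund_adjoint_le {z y : ℝ → ℝ} (h : M.IsHomog δ M.T z y) (hz : z 0 = 0)
    (hy : y 0 = -1) : ∀ t ∈ Icc 0 M.T, y t ≤ -1 := by
  intro t ht
  have hanti := h.dY.antitoneOn (by
    filter_upwards [hM.lam_nonneg] with s hs hsm
    have := mul_nonneg (hs (Ioo_subset_Icc_self hsm))
      (hM.fund_pos h hz hy s (Ioo_subset_Ioc_self hsm)).le
    linarith)
  rw [← hy]
  exact hanti (left_mem_Icc.2 hM.T_pos.le) ht ht.1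

end Regular

end Market

end Liquidation

/-! ### Stopped flows, the level function $f_\mu$ and the candidate liquidation time. -/

namespace Liquidation

theorem not_ae_false_Ioo {a b : ℝ} (hab : a < b) (h : ∀ᵐ t : ℝ, t ∈ Ioo a b → False) : False := by
  have h1 : volume (Ioo a b) = 0 := measure_eq_zero_iff_ae_notMem.2 h
  rw [Real.volume_Ioo, ENNReal.ofReal_eq_zero] at h1
  linarith

namespace Market

variable {M : Market} {δ : ℝ}

theorem ae_vol_iff {p : ℝ → Prop} :
    (∀ᵐ t ∂M.vol, p t) ↔ ∀ᵐ t, t ∈ Icc 0 M.T → p t := by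
  rw [vol, ae_restrict_iff' measurableSet_Icc]

theorem integrable_vol_iff (hT : 0 ≤ M.T) {f : ℝ → ℝ} :
    Integrable f M.vol ↔ IntervalIntegrable f volume 0 M.T := by
  rw [intervalIntegrable_iff_integrableOn_Icc_of_le hT]; rfl

/-- The fundamental solution with initial data `(0,-1)`. -/
structure IsFund (M : Market) (δ : ℝ) (z y : ℝ → ℝ) : Prop where
  homog : M.IsHomog δ M.T z y
  z_zero : z 0 = 0
  y_zero : y 0 = -1

/-- `(X,Y)` solves the forward-backward system driven by `μ` and stopped at `τ`. -/
structure IsFlow (M : Market) (δ τ x : ℝ) (μ X Y : ℝ → ℝ) : Prop where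
  zero : X 0 = x
  dX : HasAEDeriv X
    (fun t => -(Iic τ).indicator (fun s => (Y s - δ * M.κ s * X s) / M.η s) t) 0 M.T
  dY : HasAEDeriv Y
    (fun t => -(Iic τ).indicator (fun s => M.lam s * X s + M.κ s * μ s) t) 0 M.T
  terminal : X M.T = 0
  dropout : τ < M.T → Y τ = 0

theorem _root_.IntervalIntegrable.indicator_Iic {f : ℝ → ℝ} {a b : ℝ}
    (hf : IntervalIntegrable f volume a b) (τ : ℝ) :
    IntervalIntegrable ((Iic τ).indicator f) volume a b := by
  rw [intervalIntegrable_iff] at hf ⊢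
  exact hf.indicator measurableSet_Iic

namespace Regular

variable (hM : M.Regular δ)
include hM

theorem exists_fund : ∃ z y, M.IsFund δ z y := by
  obtain ⟨z, y, hz, hy, h⟩ := hM.exists_homog 0 (-1)
  exact ⟨z, y, h, hz, hy⟩

theorem rate_cont {X Y : ℝ → ℝ} (hX : ContinuousOn X (Icc 0 M.T))
    (hY : ContinuousOn Y (Icc 0 M.T)) :
    ContinuousOn (fun s => (Y s - δ * M.κ s * X s) / M.η s) (Icc 0 M.T) :=
  hM.div_η_cont Subset.rfl (hY.sub ((continuousOn_const.mul hM.κ_cont).mul hX))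

theorem source_integrable {μ X : ℝ → ℝ} (hμ : IntervalIntegrable μ volume 0 M.T)
    (hX : ContinuousOn X (Icc 0 M.T)) :
    IntervalIntegrable (fun s => M.lam s * X s + M.κ s * μ s) volume 0 M.T :=
  (hM.integrable_mul_cont hM.lam_integrable hX).add (hM.integrable_cont_mul hμ hM.κ_cont)

theorem isFBSolution_iff {x : ℝ} {μ X Y : ℝ → ℝ} (hμ : IntervalIntegrable μ volume 0 M.T) :
    M.IsFBSolution δ x μ X Y ↔ M.IsFlow δ (M.liqTime δ x μ) x μ X Y := by
  have h0 : (0 : ℝ) ∈ Icc 0 M.T := left_mem_Icc.2 hM.T_pos.le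
  constructor
  · intro h
    have hX0 : X 0 = x := by simpa using h.eqX 0 h0
    refine ⟨hX0, ?_, ?_, h.terminal, h.dropout⟩
    · refine HasAEDeriv.of_eq_integral hM.T_pos.le
        ((hM.intervalIntegrable_of_cont (hM.rate_cont h.contX h.contY)).indicator_Iic _).neg
        fun t ht => ?_
      rw [h.eqX t ht, hX0, intervalIntegral.integral_neg, sub_eq_add_neg]
    · refine HasAEDeriv.of_eq_integral hM.T_pos.le
        ((hM.source_integrable hμ h.contX).indicator_Iic _).neg fun t ht => ?_
      rw [h.eqY t ht, intervalIntegral.integral_neg, sub_eq_add_neg]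
  · intro h
    refine ⟨h.dX.continuousOn, h.dY.continuousOn, fun t ht => ?_, fun t ht => ?_, h.terminal,
      h.dropout⟩
    · rw [h.dX.eq ht, h.zero, intervalIntegral.integral_neg, sub_eq_add_neg]
    · rw [h.dY.eq ht, intervalIntegral.integral_neg, sub_eq_add_neg]

/-- Replacing $h^\delta$ by $z$ times the discount removes the singularity of the Riccati solution
at $T$: the new density is integrable up to $T$, and the value of $h^\delta$ at $T$ is irrelevant.
-/
theorem fFun_deriv {z y μ : ℝ → ℝ} (hz : M.IsFund δ z y)
    (hμ : IntervalIntegrable μ volume 0 M.T) :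
    HasAEDeriv (M.fFun δ μ) (fun t => M.κ t * μ t * (z t * M.discount δ t)) 0 M.T := by
  have hi : IntervalIntegrable (fun t => M.κ t * μ t * (z t * M.discount δ t)) volume 0 M.T :=
    hM.integrable_mul_cont (hM.integrable_cont_mul hμ hM.κ_cont)
      (hz.homog.dX.continuousOn.mul hM.discount_deriv.continuousOn)
  have hae : ∀ᵐ t, t ∈ Ioo 0 M.T → M.κ t * μ t * M.hFun δ t =
      M.κ t * μ t * (z t * M.discount δ t) := Eventually.of_forall fun t ht => by
    rw [hM.hFun_eq hz.homog hz.z_zero hz.y_zero (Ioo_subset_Ico_self ht)]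
  refine HasAEDeriv.of_eq_integral hM.T_pos.le hi fun t ht => ?_
  have h0 : M.fFun δ μ 0 = 0 := by simp [fFun]
  rw [h0, zero_add, fFun]
  refine intervalIntegral.integral_congr_ae ?_
  rw [uIoc_of_le ht.1]
  filter_upwards [HasAEDeriv.ae_Ioo_of_ae_Ioc hae] with s hs hsm
  exact hs ⟨hsm.1, hsm.2.trans ht.2⟩

omit hM in
theorem fFun_zero (μ : ℝ → ℝ) : M.fFun δ μ 0 = 0 := by simp [fFun]

theorem fFun_cont {μ : ℝ → ℝ} (hμ : IntervalIntegrable μ volume 0 M.T) :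
    ContinuousOn (M.fFun δ μ) (Icc 0 M.T) := by
  obtain ⟨z, y, hz⟩ := hM.exists_fund
  exact (hM.fFun_deriv hz hμ).continuousOn

theorem liqTime_mem (x : ℝ) (μ : ℝ → ℝ) : M.liqTime δ x μ ∈ Icc 0 M.T := by
  have hb : BddBelow ({t | t ∈ Icc (0 : ℝ) M.T ∧ M.fFun δ μ t = x} ∪ {M.T}) :=
    ⟨0, by rintro t (⟨ht, -⟩ | rfl); exacts [ht.1, hM.T_pos.le]⟩
  refine ⟨le_csInf ⟨M.T, Or.inr rfl⟩ ?_, csInf_le hb (Or.inr rfl)⟩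
  rintro t (⟨ht, -⟩ | rfl)
  exacts [ht.1, hM.T_pos.le]

theorem liqTime_le {x : ℝ} {μ : ℝ → ℝ} {t : ℝ} (ht : t ∈ Icc 0 M.T) (h : M.fFun δ μ t = x) :
    M.liqTime δ x μ ≤ t :=
  csInf_le ⟨0, by rintro t (⟨ht, -⟩ | rfl); exacts [ht.1, hM.T_pos.le]⟩ (Or.inl ⟨ht, h⟩)

/-- The infimum is attained because the level set of the continuous $f_\mu$ is closed. -/
theorem fFun_liqTime {x : ℝ} {μ : ℝ → ℝ} (hμ : IntervalIntegrable μ volume 0 M.T)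
    (h : M.liqTime δ x μ < M.T) : M.fFun δ μ (M.liqTime δ x μ) = x := by
  have hc : IsClosed ({t | t ∈ Icc (0 : ℝ) M.T ∧ M.fFun δ μ t = x} ∪ {M.T}) := by
    refine IsClosed.union ?_ isClosed_singleton
    exact (hM.fFun_cont hμ).preimage_isClosed_of_isClosed isClosed_Icc isClosed_singleton
  have := hc.csInf_mem ⟨M.T, Or.inr rfl⟩
    ⟨0, by rintro t (⟨ht, -⟩ | rfl); exacts [ht.1, hM.T_pos.le]⟩
  rcases this with h1 | h1
  · exact h1.2
  · exact absurd h1 h.ne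

theorem liqTime_zero (μ : ℝ → ℝ) : M.liqTime δ 0 μ = 0 :=
  le_antisymm (hM.liqTime_le (left_mem_Icc.2 hM.T_pos.le) (fFun_zero μ)) (hM.liqTime_mem 0 μ).1

theorem liqTime_pos {x : ℝ} {μ : ℝ → ℝ} (hμ : IntervalIntegrable μ volume 0 M.T) (hx : x ≠ 0) :
    0 < M.liqTime δ x μ := by
  refine lt_of_le_of_ne (hM.liqTime_mem x μ).1 fun h => hx ?_
  have := hM.fFun_liqTime (x := x) hμ (by rw [← h]; exact hM.T_pos)
  rw [← this, ← h, fFun_zero]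

omit hM in
theorem fFun_neg (μ : ℝ → ℝ) (t : ℝ) : M.fFun δ (fun s => -μ s) t = -M.fFun δ μ t := by
  rw [fFun, fFun, ← intervalIntegral.integral_neg]
  congr 1; funext s; ring

omit hM in
theorem liqTime_neg (x : ℝ) (μ : ℝ → ℝ) :
    M.liqTime δ (-x) (fun s => -μ s) = M.liqTime δ x μ := by
  simp only [liqTime, fFun_neg, neg_inj]

/-- Otherwise, as $f_\mu$ starts at $0<x$, the level $x$ would be reached before the first hitting
time. -/
theorem fFun_lt {x : ℝ} {μ : ℝ → ℝ} (hμ : IntervalIntegrable μ volume 0 M.T) (hx : 0 < x)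
    {t : ℝ} (ht : t ∈ Ico 0 (M.liqTime δ x μ)) : M.fFun δ μ t < x := by
  by_contra! h
  have htT : t ≤ M.T := ht.2.le.trans (hM.liqTime_mem x μ).2
  obtain ⟨s, hs, hsx⟩ : ∃ s ∈ Icc 0 t, M.fFun δ μ s = x :=
    intermediate_value_Icc ht.1 ((hM.fFun_cont hμ).mono (Icc_subset_Icc_right htT))
      ⟨by rw [fFun_zero]; exact hx.le, h⟩
  have := hM.liqTime_le ⟨hs.1, hs.2.trans htT⟩ hsx
  linarith [ht.2, hs.2]

omit hM in
theorem fFun_congr {μ μ' : ℝ → ℝ} (h : ∀ᵐ t, t ∈ Icc 0 M.T → μ t = μ' t) {t : ℝ}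
    (ht : t ∈ Icc 0 M.T) : M.fFun δ μ t = M.fFun δ μ' t := by
  refine intervalIntegral.integral_congr_ae ?_
  rw [uIoc_of_le ht.1]
  filter_upwards [h] with s hs hsm
  rw [hs ⟨hsm.1.le, hsm.2.trans ht.2⟩]

omit hM in
theorem liqTime_congr {μ μ' : ℝ → ℝ} (h : ∀ᵐ t, t ∈ Icc 0 M.T → μ t = μ' t) (x : ℝ) :
    M.liqTime δ x μ = M.liqTime δ x μ' := by
  have : {t | t ∈ Icc (0 : ℝ) M.T ∧ M.fFun δ μ t = x} =
      {t | t ∈ Icc (0 : ℝ) M.T ∧ M.fFun δ μ' t = x} := by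
    ext t
    exact and_congr_right fun ht => by rw [fFun_congr h ht]
  rw [liqTime, liqTime, this]

end Regular

namespace IsFlow

variable {τ x : ℝ} {μ X Y : ℝ → ℝ}

theorem neg (h : M.IsFlow δ τ x μ X Y) :
    M.IsFlow δ τ (-x) (fun t => -μ t) (fun t => -X t) (fun t => -Y t) := by
  refine ⟨by simp [h.zero], ?_, ?_, by simp [h.terminal], fun ht => by simp [h.dropout ht]⟩
  · refine h.dX.neg.congr_deriv' fun t _ => ?_
    by_cases ht : t ≤ τ
    · rw [indicator_of_mem (by exact ht), indicator_of_mem (by exact ht)]; ring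
    · rw [indicator_of_notMem (by exact ht), indicator_of_notMem (by exact ht)]; ring
  · refine h.dY.neg.congr_deriv' fun t _ => ?_
    by_cases ht : t ≤ τ
    · rw [indicator_of_mem (by exact ht), indicator_of_mem (by exact ht)]; ring
    · rw [indicator_of_notMem (by exact ht), indicator_of_notMem (by exact ht)]; ring

theorem congr_ae {μ' : ℝ → ℝ} (h : M.IsFlow δ τ x μ X Y)
    (hμ : ∀ᵐ t, t ∈ Icc 0 M.T → μ t = μ' t) : M.IsFlow δ τ x μ' X Y := by
  refine ⟨h.zero, h.dX, h.dY.congr_deriv ?_, h.terminal, h.dropout⟩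
  filter_upwards [hμ] with t ht htm
  simp only [indicator, ht (Ioo_subset_Icc_self htm)]

theorem deriv_before (h : M.IsFlow δ τ x μ X Y) (hτ : τ ∈ Icc 0 M.T) :
    HasAEDeriv X (fun t => -((Y t - δ * M.κ t * X t) / M.η t)) 0 τ ∧
      HasAEDeriv Y (fun t => -(M.lam t * X t + M.κ t * μ t)) 0 τ := by
  refine ⟨(h.dX.mono le_rfl hτ.1 hτ.2).congr_deriv' fun t ht => ?_,
    (h.dY.mono le_rfl hτ.1 hτ.2).congr_deriv' fun t ht => ?_⟩ <;>
  rw [indicator_of_mem (show t ∈ Iic τ from ht.2.le)]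

theorem const_after (h : M.IsFlow δ τ x μ X Y) (hτ : τ ∈ Icc 0 M.T) :
    ∀ t ∈ Icc τ M.T, X t = X τ ∧ Y t = Y τ := by
  have h1 := ((h.dX.mono hτ.1 hτ.2 le_rfl).congr_deriv' (g := fun _ => 0) fun t ht => by
    rw [indicator_of_notMem (show t ∉ Iic τ from not_le.2 ht.1), neg_zero]).eqOn
      (HasAEDeriv.const hτ.2 (X τ)) rfl
  have h2 := ((h.dY.mono hτ.1 hτ.2 le_rfl).congr_deriv' (g := fun _ => 0) fun t ht => by
    rw [indicator_of_notMem (show t ∉ Iic τ from not_le.2 ht.1), neg_zero]).eqOn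
      (HasAEDeriv.const hτ.2 (Y τ)) rfl
  exact fun t ht => ⟨h1 t ht, h2 t ht⟩

theorem X_after (h : M.IsFlow δ τ x μ X Y) (hτ : τ ∈ Icc 0 M.T) :
    ∀ t ∈ Icc τ M.T, X t = 0 := fun t ht => by
  rw [(h.const_after hτ t ht).1, ← (h.const_after hτ M.T ⟨hτ.2, le_rfl⟩).1, h.terminal]

theorem X_τ (h : M.IsFlow δ τ x μ X Y) (hτ : τ ∈ Icc 0 M.T) : X τ = 0 :=
  h.X_after hτ τ ⟨le_rfl, hτ.2⟩

theorem Y_after (h : M.IsFlow δ τ x μ X Y) (hτ : τ ∈ Icc 0 M.T) :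
    ∀ t ∈ Ioc τ M.T, Y t = 0 := fun t ht => by
  rw [(h.const_after hτ t ⟨ht.1.le, ht.2⟩).2, h.dropout (ht.1.trans_le ht.2)]

/-- For a dropped-out player the indicator may be removed from the rate. -/
theorem dX' (h : M.IsFlow δ τ x μ X Y) (hτ : τ ∈ Icc 0 M.T) :
    HasAEDeriv X (fun t => -((Y t - δ * M.κ t * X t) / M.η t)) 0 M.T := by
  refine h.dX.congr_deriv' fun t ht => ?_
  by_cases htτ : t ≤ τ
  · rw [indicator_of_mem (by exact htτ)]
  · rw [indicator_of_notMem (by exact htτ), h.X_after hτ t ⟨(not_le.1 htτ).le, ht.2.le⟩,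
      h.Y_after hτ t ⟨not_le.1 htτ, ht.2.le⟩]
    simp

theorem dY' (h : M.IsFlow δ τ x μ X Y) (hτ : τ ∈ Icc 0 M.T) :
    HasAEDeriv Y (fun t => -(M.lam t * X t + M.κ t * (Iic τ).indicator μ t)) 0 M.T := by
  refine h.dY.congr_deriv' fun t ht => ?_
  by_cases htτ : t ≤ τ
  · rw [indicator_of_mem (by exact htτ), indicator_of_mem (by exact htτ)]
  · rw [indicator_of_notMem (by exact htτ), indicator_of_notMem (by exact htτ),
      h.X_after hτ t ⟨(not_le.1 htτ).le, ht.2.le⟩]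
    simp

end IsFlow

namespace Regular

variable (hM : M.Regular δ)
include hM

variable {τ x : ℝ} {μ X Y : ℝ → ℝ}

/-- The level relation: along a flow the Wronskian with the fundamental solution is `f_μ - x`. -/
theorem flow_level {z y : ℝ → ℝ} (hz : M.IsFund δ z y) (hμ : IntervalIntegrable μ volume 0 M.T)
    (hτ : τ ∈ Icc 0 M.T)
    (hX : HasAEDeriv X (fun t => -((Y t - δ * M.κ t * X t) / M.η t)) 0 τ)
    (hY : HasAEDeriv Y (fun t => -(M.lam t * X t + M.κ t * μ t)) 0 τ) :
    ∀ t ∈ Icc 0 τ, (X t * y t - Y t * z t) * M.discount δ t = M.fFun δ μ t - X 0 := by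
  have hzX := hz.homog.dX.mono le_rfl hτ.1 hτ.2
  have hzY := hz.homog.dY.mono le_rfl hτ.1 hτ.2
  have hd := ((hX.mul hzY).sub (hY.mul hzX)).mul (hM.discount_deriv.mono le_rfl hτ.1 hτ.2)
  have hf := ((hM.fFun_deriv hz hμ).mono le_rfl hτ.1 hτ.2).sub (HasAEDeriv.const hτ.1 (X 0))
  refine (hd.congr_deriv' fun t ht => ?_).eqOn hf ?_
  · have := (hM.η_pos t ⟨ht.1.le, ht.2.le.trans hτ.2⟩).ne'
    field_simp
    ring
  · simp [hz.z_zero, hz.y_zero, discount_zero, fFun_zero]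

/-- The difference of two flows is a homogeneous solution with zero position at $0$ and $\tau$,
hence trivial. For $\tau=0$ there is no such interval and the dropout condition fixes $Y$. -/
theorem flow_unique {X' Y' : ℝ → ℝ} (hτ : τ ∈ Icc 0 M.T) (h : M.IsFlow δ τ x μ X Y)
    (h' : M.IsFlow δ τ x μ X' Y') : ∀ t ∈ Icc 0 M.T, X t = X' t ∧ Y t = Y' t := by
  have hbefore : ∀ t ∈ Icc 0 τ, X t = X' t ∧ Y t = Y' t := by
    rcases hτ.1.eq_or_lt with h0 | h0
    · intro t ht
      have ht0 : t = 0 := le_antisymm (h0 ▸ ht.2) ht.1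
      have hlt : τ < M.T := h0 ▸ hM.T_pos
      rw [ht0, h.zero, h'.zero]
      have h1 := h.dropout hlt
      have h2 := h'.dropout hlt
      rw [← h0] at h1 h2
      exact ⟨rfl, h1.trans h2.symm⟩
    · have hh : M.IsHomog δ τ (fun t => X t - X' t) (fun t => Y t - Y' t) :=
        ⟨((h.deriv_before hτ).1.sub (h'.deriv_before hτ).1).congr_deriv' fun t _ => by ring,
          ((h.deriv_before hτ).2.sub (h'.deriv_before hτ).2).congr_deriv' fun t _ => by ring⟩
      intro t ht
      have := hM.homog_bvp h0 hτ.2 hh (by simp [h.zero, h'.zero])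
        (by simp [h.X_τ hτ, h'.X_τ hτ]) t ht
      exact ⟨sub_eq_zero.1 this.1, sub_eq_zero.1 this.2⟩
  intro t ht
  rcases le_total t τ with htτ | htτ
  · exact hbefore t ⟨ht.1, htτ⟩
  · have h1 := h.const_after hτ t ⟨htτ, ht.2⟩
    have h2 := h'.const_after hτ t ⟨htτ, ht.2⟩
    have h3 := hbefore τ ⟨hτ.1, le_rfl⟩
    exact ⟨by rw [h1.1, h2.1, h3.1], by rw [h1.2, h2.2, h3.2]⟩

/-- Cutting off all coefficients after $\tau$ turns the stopped system into one linear initial value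
problem on $[0,T]$. -/
theorem exists_stopped (hμ : IntervalIntegrable μ volume 0 M.T) (τ x b : ℝ) :
    ∃ X Y : ℝ → ℝ, X 0 = x ∧ Y 0 = b ∧
      HasAEDeriv X
        (fun t => -(Iic τ).indicator (fun s => (Y s - δ * M.κ s * X s) / M.η s) t) 0 M.T ∧
      HasAEDeriv Y
        (fun t => -(Iic τ).indicator (fun s => M.lam s * X s + M.κ s * μ s) t) 0 M.T := by
  obtain ⟨B, hB, h1, h2, h3⟩ := hM.coeff_bound
  have hind : ∀ {f : ℝ → ℝ} {t : ℝ}, |f t| ≤ B → |(Iic τ).indicator f t| ≤ B := by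
    intro f t h
    by_cases ht : t ∈ Iic τ
    · rwa [indicator_of_mem ht]
    · rw [indicator_of_notMem ht]; simpa using hB
  obtain ⟨X, Y, hX0, hY0, hX, hY⟩ := exists_linear_system (B := B)
    (p := (Iic τ).indicator fun t => δ * M.κ t / M.η t)
    (q := (Iic τ).indicator fun t => -(M.η t)⁻¹) (r := (Iic τ).indicator fun t => -M.lam t)
    (s := fun _ => 0) (g := fun _ => 0) (k := (Iic τ).indicator fun t => -(M.κ t * μ t))
    hM.T_pos.le
    (Eventually.of_forall fun t ht => hind (h2 t ht))
    (Eventually.of_forall fun t ht => hind (by rw [abs_neg]; exact h3 t ht))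
    (h1.mono fun t ht htm => hind (by rw [abs_neg]; exact ht htm))
    (Eventually.of_forall fun t _ => by simpa using hB)
    ((hM.intervalIntegrable_of_cont hM.δκη_cont).indicator_Iic τ)
    ((hM.intervalIntegrable_of_cont hM.η_inv_cont).neg.indicator_Iic τ)
    (hM.lam_integrable.neg.indicator_Iic τ)
    intervalIntegrable_const intervalIntegrable_const
    ((hM.integrable_cont_mul hμ hM.κ_cont).neg.indicator_Iic τ) x b
  refine ⟨X, Y, hX0, hY0, hX.congr_deriv' fun t _ => ?_, hY.congr_deriv' fun t _ => ?_⟩ <;>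
  · by_cases ht : t ∈ Iic τ
    · simp only [indicator_of_mem ht]; ring
    · simp only [indicator_of_notMem ht]; ring

/-- Linear shooting: superposing the fundamental solution brings $X_\tau$ to $0$, and then the level
relation with $f_\mu(\tau)=x$ yields $Y_\tau=0$ without further freedom. -/
theorem exists_flow (hμ : IntervalIntegrable μ volume 0 M.T) (hτ : τ ∈ Icc 0 M.T)
    (hf : τ < M.T → M.fFun δ μ τ = x) : ∃ X Y, M.IsFlow δ τ x μ X Y := by
  obtain ⟨z, y, hz⟩ := hM.exists_fund
  rcases hτ.1.eq_or_lt with h0 | h0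
  · have hx : x = 0 := by rw [← hf (h0 ▸ hM.T_pos), ← h0, fFun_zero]
    obtain ⟨X, Y, hX0, hY0, hX, hY⟩ := hM.exists_stopped hμ τ x 0
    have hc := ((hX.congr_deriv' (g := fun _ => 0) fun t ht => by
      rw [indicator_of_notMem (show t ∉ Iic τ from not_le.2 (h0 ▸ ht.1)), neg_zero]).eqOn
      (HasAEDeriv.const hM.T_pos.le (X 0)) rfl) M.T (right_mem_Icc.2 hM.T_pos.le)
    exact ⟨X, Y, hX0, hX, hY, by rw [hc, hX0, hx], fun _ => by rw [← h0, hY0]⟩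
  · have hzτ := hM.fund_pos hz.homog hz.z_zero hz.y_zero τ ⟨h0, hτ.2⟩
    obtain ⟨P, Q, hP0, hQ0, hP, hQ⟩ := hM.exists_stopped hμ τ x 0
    -- Raising $Y_0$ by $k$ changes $X$ by $-kz$ on $[0,\tau]$, since $y_0=-1$; this $k$ gives
    -- $X_\tau=P_\tau-kz_\tau=0$.
    set k := P τ / z τ with hk
    obtain ⟨X, Y, hX0, hY0, hX, hY⟩ := hM.exists_stopped hμ τ x k
    have hbef : ∀ {X Y : ℝ → ℝ}, HasAEDeriv X
          (fun t => -(Iic τ).indicator (fun s => (Y s - δ * M.κ s * X s) / M.η s) t) 0 M.T →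
        HasAEDeriv Y
          (fun t => -(Iic τ).indicator (fun s => M.lam s * X s + M.κ s * μ s) t) 0 M.T →
        HasAEDeriv X (fun t => -((Y t - δ * M.κ t * X t) / M.η t)) 0 τ ∧
        HasAEDeriv Y (fun t => -(M.lam t * X t + M.κ t * μ t)) 0 τ := by
      intro X Y hX hY
      refine ⟨(hX.mono le_rfl hτ.1 hτ.2).congr_deriv' fun t ht => ?_,
        (hY.mono le_rfl hτ.1 hτ.2).congr_deriv' fun t ht => ?_⟩ <;>
      rw [indicator_of_mem (show t ∈ Iic τ from ht.2.le)]
    have b1 := hbef hX hY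
    have b2 := hbef hP hQ
    have hh : M.IsHomog δ τ (fun t => X t - P t + k * z t) (fun t => Y t - Q t + k * y t) :=
      ⟨((b1.1.sub b2.1).add ((hz.homog.dX.mono le_rfl hτ.1 hτ.2).const_mul k)).congr_deriv'
          fun t _ => by ring,
        ((b1.2.sub b2.2).add ((hz.homog.dY.mono le_rfl hτ.1 hτ.2).const_mul k)).congr_deriv'
          fun t _ => by ring⟩
    have hXτ : X τ = 0 := by
      have := (hM.homog_eq_zero hτ.2 hh (by simp [hX0, hP0, hz.z_zero])
        (by simp [hY0, hQ0, hz.y_zero]) τ ⟨hτ.1, le_rfl⟩).1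
      have e : k * z τ = P τ := by rw [hk]; field_simp
      simp only [e] at this
      linarith
    refine ⟨X, Y, hX0, hX, hY, ?_, fun hlt => ?_⟩
    · rw [← hXτ]
      exact ((hX.mono hτ.1 hτ.2 le_rfl).congr_deriv' (g := fun _ => 0) fun t ht => by
        rw [indicator_of_notMem (show t ∉ Iic τ from not_le.2 ht.1), neg_zero]).eqOn
        (HasAEDeriv.const hτ.2 (X τ)) rfl M.T ⟨hτ.2, le_rfl⟩
    -- With $X_\tau=0$ and $f_\mu(\tau)=x$ the level relation reads $Y_\tau z_\tau=0$, and
    -- $z_\tau>0$.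
    · have := hM.flow_level hz hμ hτ b1.1 b1.2 τ ⟨hτ.1, le_rfl⟩
      rw [hf hlt, hX0, hXτ, sub_self, zero_mul, zero_sub] at this
      have h1 := (mul_eq_zero.1 this).resolve_right (M.discount_pos δ τ).ne'
      exact (mul_eq_zero.1 (neg_eq_zero.1 h1)).resolve_right hzτ.ne'

/-- By the level relation, $(X/z)'$ is a negative multiple of $x-f_\mu>0$. So $X/z$ decreases
strictly to its value $0$ at $\tau$. -/
theorem flow_pos (hμ : IntervalIntegrable μ volume 0 M.T) (hτ : τ ∈ Icc 0 M.T)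
    (h : M.IsFlow δ τ x μ X Y) (hx : 0 < x) (hf : ∀ t ∈ Ico 0 τ, M.fFun δ μ t < x) :
    ∀ t ∈ Ico 0 τ, 0 < X t := by
  obtain ⟨z, y, hz⟩ := hM.exists_fund
  intro s hs
  rcases hs.1.eq_or_lt with h0 | h0
  · rwa [← h0, h.zero]
  obtain ⟨hX, hY⟩ := h.deriv_before hτ
  have hlev := hM.flow_level hz hμ hτ hX hY
  have hzpos : ∀ t ∈ Icc s τ, 0 < z t := fun t ht =>
    hM.fund_pos hz.homog hz.z_zero hz.y_zero t ⟨h0.trans_le ht.1, ht.2.trans hτ.2⟩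
  have hd := (hX.mono hs.1 hs.2.le le_rfl).mul
    ((hz.homog.dX.mono hs.1 hs.2.le hτ.2).inv hzpos)
  have hd' : HasAEDeriv (fun t => X t * (z t)⁻¹)
      (fun t => -((x - M.fFun δ μ t) / (M.discount δ t * M.η t * z t ^ 2))) s τ := by
    refine hd.congr_deriv' fun t ht => ?_
    have e1 := hlev t ⟨hs.1.trans ht.1.le, ht.2.le⟩
    rw [h.zero] at e1
    have e2 := (hM.η_pos t ⟨hs.1.trans ht.1.le, ht.2.le.trans hτ.2⟩).ne'
    have e3 := (hzpos t (Ioo_subset_Icc_self ht)).ne'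
    have e4 := (M.discount_pos δ t).ne'
    have e5 : x - M.fFun δ μ t = -((X t * y t - Y t * z t) * M.discount δ t) := by
      rw [e1]; ring
    rw [e5]
    field_simp
    ring
  have hneg : ∀ t ∈ Ioo s τ, 0 < (x - M.fFun δ μ t) / (M.discount δ t * M.η t * z t ^ 2) := by
    intro t ht
    have e2 := hM.η_pos t ⟨hs.1.trans ht.1.le, ht.2.le.trans hτ.2⟩
    have e3 := hzpos t (Ioo_subset_Icc_self ht)
    have e4 := M.discount_pos δ t
    have e5 := sub_pos.2 (hf t ⟨hs.1.trans ht.1.le, ht.2⟩)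
    positivity
  by_contra! hle
  have hzz := hd'.neg.ae_eq_zero
    (Eventually.of_forall fun t ht => by rw [neg_neg]; exact (hneg t ht).le) (by
      rw [h.X_τ hτ, zero_mul, neg_zero]
      have := mul_nonpos_of_nonpos_of_nonneg hle
        (inv_pos.2 (hzpos s ⟨le_rfl, hs.2.le⟩)).le
      linarith)
  refine not_ae_false_Ioo hs.2 ?_
  filter_upwards [hzz] with t ht htm
  have h1 := ht htm
  rw [neg_neg] at h1
  exact (hneg t htm).ne' h1

/-- A flow that stays positive until it is stopped is stopped at the candidate liquidation time,
if the driving rate has constant sign. -/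
theorem eq_liqTime_of_pos (hμ : IntervalIntegrable μ volume 0 M.T) (hτ : τ ∈ Icc 0 M.T)
    (h : M.IsFlow δ τ x μ X Y) (hx : 0 < x) (hpos : ∀ t ∈ Ico 0 τ, 0 < X t)
    (hsign : (∀ᵐ t, t ∈ Icc 0 M.T → μ t ≤ 0) ∨ ∀ᵐ t, t ∈ Icc 0 M.T → 0 ≤ μ t) :
    τ = M.liqTime δ x μ := by
  obtain ⟨z, y, hz⟩ := hM.exists_fund
  obtain ⟨hX, hY⟩ := h.deriv_before hτ
  have hlev := hM.flow_level hz hμ hτ hX hY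
  set σ := M.liqTime δ x μ
  have hσ := hM.liqTime_mem x μ
  -- If $\tau<T$, then $X_\tau=Y_\tau=0$ and the level relation gives $f_\mu(\tau)=x$.
  have hle : σ ≤ τ := by
    rcases hτ.2.lt_or_eq with hlt | heq
    · refine hM.liqTime_le hτ ?_
      have := hlev τ ⟨hτ.1, le_rfl⟩
      rw [h.X_τ hτ, h.dropout hlt, h.zero] at this
      linarith
    · rw [heq]; exact hσ.2
  refine le_antisymm ?_ hle
  by_contra! hlt
  have hfσ : M.fFun δ μ σ = x := hM.fFun_liqTime hμ (hlt.trans_le hτ.2)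
  have hσ0 : 0 < σ := hM.liqTime_pos hμ hx.ne'
  -- If $\mu\le0$, then $f_\mu\le0<x$ and the level is never reached. If $\mu\ge0$, at $\sigma<\tau$
  -- the level relation reads $Xy=Yz$ with $X>0$, $y\le-1$, $z>0$, so $Y_\sigma<0$. As $Y$ is
  -- nonincreasing it stays negative, $X$ is nondecreasing on $[\sigma,\tau]$, and it cannot reach
  -- $0$.
  rcases hsign with hs | hs
  · have hanti := ((hM.fFun_deriv hz hμ)).antitoneOn (by
      filter_upwards [hs] with t ht htm
      have h1 := ht (Ioo_subset_Icc_self htm)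
      have h2 := hM.κ_nonneg t (Ioo_subset_Icc_self htm)
      have h3 := hM.fund_pos hz.homog hz.z_zero hz.y_zero t (Ioo_subset_Ioc_self htm)
      have h4 := M.discount_pos δ t
      exact mul_nonpos_of_nonpos_of_nonneg (mul_nonpos_of_nonneg_of_nonpos h2 h1) (by positivity))
    have := hanti (left_mem_Icc.2 hM.T_pos.le) hσ hσ.1
    rw [fFun_zero, hfσ] at this
    linarith
  · have e1 := hlev σ ⟨hσ.1, hle⟩
    rw [hfσ, h.zero, sub_self] at e1
    have e2 := (mul_eq_zero.1 e1).resolve_right (M.discount_pos δ σ).ne'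
    have hXσ := hpos σ ⟨hσ.1, hlt⟩
    have hzσ := hM.fund_pos hz.homog hz.z_zero hz.y_zero σ ⟨hσ0, hσ.2⟩
    have hyσ := hM.fund_adjoint_le hz.homog hz.z_zero hz.y_zero σ hσ
    have hYσ : Y σ < 0 := by
      by_contra! hge
      have := mul_nonneg hge hzσ.le
      nlinarith
    have hYanti := (hY.mono hσ.1 hle le_rfl).antitoneOn (by
      filter_upwards [hs, hM.lam_nonneg] with t ht hl htm
      have htI : t ∈ Icc 0 M.T := ⟨hσ.1.trans htm.1.le, htm.2.le.trans hτ.2⟩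
      have h1 := mul_nonneg (hl htI) (hpos t ⟨htI.1, htm.2⟩).le
      have h2 := mul_nonneg (hM.κ_nonneg t htI) (ht htI)
      linarith)
    have hXmono := (hX.mono hσ.1 hle le_rfl).monotoneOn (Eventually.of_forall fun t htm => by
      have htI : t ∈ Icc 0 M.T := ⟨hσ.1.trans htm.1.le, htm.2.le.trans hτ.2⟩
      have h1 := hYanti ⟨le_rfl, hle⟩ (Ioo_subset_Icc_self htm) htm.1.le
      have h2 := mul_nonneg (mul_nonneg hM.δ_nonneg (hM.κ_nonneg t htI)) (hpos t ⟨htI.1, htm.2⟩).le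
      rw [neg_nonneg]
      exact div_nonpos_of_nonpos_of_nonneg (by linarith) (hM.η_pos t htI).le)
    have := hXmono ⟨le_rfl, hle⟩ ⟨hle, le_rfl⟩ hle
    rw [h.X_τ hτ] at this
    linarith

end Regular

end Market

end Liquidation

/-! ### An abstract shooting problem with Lipschitz feedback. -/

namespace Liquidation

theorem HasAEDeriv.trans {F f : ℝ → ℝ} {a b c : ℝ} (h1 : HasAEDeriv F f a c)
    (h2 : HasAEDeriv F f c b) : HasAEDeriv F f a b := by
  refine HasAEDeriv.of_eq_integral (h1.le.trans h2.le)
    (h1.intervalIntegrable.trans h2.intervalIntegrable) fun t ht => ?_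
  rcases le_total t c with htc | htc
  · exact h1.eq ⟨ht.1, htc⟩
  · have h3 := h2.mono le_rfl htc ht.2
    rw [← intervalIntegral.integral_add_adjacent_intervals h1.intervalIntegrable
      h3.intervalIntegrable, h1.integral_eq, h3.integral_eq]
    ring

/-- Freezing a function before time $c$; it is used to cut off the factor $r$, which is singular at
$0$. -/
theorem HasAEDeriv.comp_max {F f : ℝ → ℝ} {a b c : ℝ} (h : HasAEDeriv F f a b)
    (hc : c ∈ Icc a b) : HasAEDeriv (fun t => F (max t c)) ((Ioi c).indicator f) a b := by
  refine HasAEDeriv.trans (c := c) ?_ ?_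
  · refine ((HasAEDeriv.const hc.1 (F c)).congr fun t ht => ?_).congr_deriv' fun t ht => ?_
    · rw [max_eq_right ht.2]
    · exact indicator_of_notMem (not_lt.2 ht.2.le) _
  · refine ((h.mono hc.1 hc.2 le_rfl).congr fun t ht => ?_).congr_deriv' fun t ht => ?_
    · rw [max_eq_left ht.1]
    · exact indicator_of_mem ht.1 _

/-- The positive part `(F - x)⁺` when `F` crosses the level `x` upwards at time `c`. -/
theorem HasAEDeriv.pos_part {F f : ℝ → ℝ} {a b c x : ℝ} (h : HasAEDeriv F f a b)
    (hc : c ∈ Icc a b) (h1 : ∀ t ∈ Icc a c, F t ≤ x) (h2 : c < b → ∀ t ∈ Icc c b, x ≤ F t) :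
    HasAEDeriv (fun t => max (F t - x) 0) ((Ioi c).indicator f) a b := by
  have hleft : HasAEDeriv (fun t => max (F t - x) 0) ((Ioi c).indicator f) a c := by
    refine ((HasAEDeriv.const hc.1 0).congr fun t ht => ?_).congr_deriv' fun t ht => ?_
    · exact max_eq_right (sub_nonpos.2 (h1 t ht))
    · exact indicator_of_notMem (not_lt.2 ht.2.le) _
  rcases hc.2.eq_or_lt with rfl | hcb
  · exact hleft
  · refine hleft.trans ((((h.mono hc.1 hc.2 le_rfl).sub (HasAEDeriv.const hc.2 x)).congr
      fun t ht => ?_).congr_deriv' fun t ht => ?_)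
    · exact max_eq_left (sub_nonneg.2 (h2 hcb t ht))
    · rw [indicator_of_mem (by exact ht.1), sub_zero]

/-- Continuation device: to show that $W$ stays positive, one works up to the first zero, where all
monotonicity available on the positive side can be used. -/
theorem exists_first_zero {W : ℝ → ℝ} {T : ℝ} (hW : ContinuousOn W (Icc 0 T))
    (h0 : 0 < W 0) (hneg : ∃ t ∈ Icc 0 T, W t ≤ 0) :
    ∃ s ∈ Ioc 0 T, W s = 0 ∧ ∀ t ∈ Ico 0 s, 0 < W t := by
  have hcl : IsClosed {t | t ∈ Icc (0 : ℝ) T ∧ W t ≤ 0} :=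
    hW.preimage_isClosed_of_isClosed isClosed_Icc isClosed_Iic
  have hbd : BddBelow {t | t ∈ Icc (0 : ℝ) T ∧ W t ≤ 0} := ⟨0, fun t ht => ht.1.1⟩
  have hmem := hcl.csInf_mem hneg hbd
  set s := sInf {t | t ∈ Icc (0 : ℝ) T ∧ W t ≤ 0}
  have hbefore : ∀ t ∈ Ico 0 s, 0 < W t := by
    intro t ht
    by_contra! hle
    exact absurd (csInf_le hbd ⟨⟨ht.1, ht.2.le.trans hmem.1.2⟩, hle⟩) (not_le.2 ht.2)
  have hs0 : 0 < s := by
    refine lt_of_le_of_ne hmem.1.1 fun h => ?_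
    rw [← h] at hmem; linarith [hmem.2]
  refine ⟨s, ⟨hs0, hmem.1.2⟩, le_antisymm hmem.2 ?_, hbefore⟩
  by_contra! hlt
  obtain ⟨r, hr, hr0⟩ : ∃ r ∈ Icc 0 s, W r = 0 :=
    intermediate_value_Icc' hs0.le (hW.mono (Icc_subset_Icc_right hmem.1.2)) ⟨hlt.le, h0.le⟩
  rcases hr.2.lt_or_eq with h | h
  · have := hbefore r ⟨hr.1, h⟩; linarith
  · rw [h] at hr0; linarith

theorem intervalIntegral_triple {F G H : ℝ → ℝ} {t : ℝ} (ht : 0 ≤ t)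
    (hF : IntervalIntegrable F volume 0 t) (hG : IntervalIntegrable G volume 0 t)
    (hH : IntervalIntegrable H volume 0 t) :
    ∫ s in (0 : ℝ)..t, ((F s, G s, H s) : ℝ × ℝ × ℝ) =
      (∫ s in (0 : ℝ)..t, F s, ∫ s in (0 : ℝ)..t, G s, ∫ s in (0 : ℝ)..t, H s) := by
  simp only [intervalIntegral.integral_of_le ht]
  rw [integral_pair hF.1 (hG.1.prodMk hH.1), integral_pair hG.1 hH.1]

/-- Coefficients of the shooting problem on `[0,T]`. -/
structure ShootingData (T B e₀ : ℝ) (e c k γ r ρ P : ℝ → ℝ) : Prop where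
  T_pos : 0 < T
  B_nonneg : 0 ≤ B
  e₀_pos : 0 < e₀
  e_le : ∀ t ∈ Icc 0 T, |e t| ≤ B
  c_le : ∀ᵐ t, t ∈ Icc 0 T → |c t| ≤ B
  k_le : ∀ t ∈ Icc 0 T, |k t| ≤ B
  γ_le : ∀ t ∈ Icc 0 T, |γ t| ≤ B
  r_le : ∀ t ∈ Icc 0 T, |r t| ≤ B
  ρ_le : ∀ t ∈ Icc 0 T, |ρ t| ≤ B
  e_int : IntervalIntegrable e volume 0 T
  c_int : IntervalIntegrable c volume 0 T
  k_int : IntervalIntegrable k volume 0 T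
  γ_int : IntervalIntegrable γ volume 0 T
  r_deriv : HasAEDeriv r ρ 0 T
  e_ge : ∀ t ∈ Icc 0 T, e₀ ≤ e t
  c_nonneg : ∀ᵐ t, t ∈ Icc 0 T → 0 ≤ c t
  γ_nonneg : ∀ t ∈ Icc 0 T, 0 ≤ γ t
  P_lip : ∀ x y, |P x - P y| ≤ |x - y|
  P_zero : P 0 = 0
  -- A chain rule that avoids differentiating $P$ at its kinks: only nondecreasing paths from $0$
  -- occur, and $\theta$ plays the role of the slope of $P$.
  P_deriv : ∀ f g : ℝ → ℝ, HasAEDeriv f g 0 T → (∀ᵐ t, t ∈ Ioo 0 T → 0 ≤ g t) → f 0 = 0 →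
    ∃ θ : ℝ → ℝ, (∀ t, 0 ≤ θ t ∧ θ t ≤ 1) ∧ HasAEDeriv (fun t => P (f t)) (fun t => θ t * g t) 0 T

/-- The vector field of the shooting problem. -/
def shootField (e c k γ r ρ P : ℝ → ℝ) (t : ℝ) (x : ℝ × ℝ × ℝ) : ℝ × ℝ × ℝ :=
  (-(e t * (x.2.1 + r t * P x.2.2)),
    -(c t * x.1) - k t * (x.2.1 + r t * P x.2.2) - ρ t * P x.2.2,
    γ t * max (x.2.1 + r t * P x.2.2) 0)

/-- Solutions of the shooting problem; the rate is `W = V + r P(f)`. -/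
structure IsShot (T : ℝ) (e c k γ r ρ P X V f : ℝ → ℝ) : Prop where
  dX : HasAEDeriv X (fun t => -(e t * (V t + r t * P (f t)))) 0 T
  dV : HasAEDeriv V (fun t => -(c t * X t) - k t * (V t + r t * P (f t)) - ρ t * P (f t)) 0 T
  df : HasAEDeriv f (fun t => γ t * max (V t + r t * P (f t)) 0) 0 T

namespace ShootingData

variable {T B e₀ : ℝ} {e c k γ r ρ P : ℝ → ℝ} (D : ShootingData T B e₀ e c k γ r ρ P)
include D

theorem P_cont : Continuous P := by
  have : LipschitzWith 1 P := LipschitzWith.of_dist_le_mul fun x y => by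
    simpa [Real.dist_eq] using D.P_lip x y
  exact this.continuous

/-- The rate $V+rP(f)$ is $(1+B)$-Lipschitz in the state. The middle component is the worst one,
with $B+B(1+B)+B$. -/
theorem lip : ∀ᵐ t, t ∈ Icc 0 T → ∀ x y : ℝ × ℝ × ℝ,
    ‖shootField e c k γ r ρ P t x - shootField e c k γ r ρ P t y‖ ≤
      (2 * B + B * (1 + B)) * ‖x - y‖ := by
  have hB := D.B_nonneg
  filter_upwards [D.c_le] with t hc ht x y
  have hc := hc ht
  have d1 : |x.1 - y.1| ≤ ‖x - y‖ := norm_fst_le (x - y)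
  have d2 : |x.2.1 - y.2.1| ≤ ‖x - y‖ := (norm_fst_le (x - y).2).trans (norm_snd_le (x - y))
  have d3 : |x.2.2 - y.2.2| ≤ ‖x - y‖ := (norm_snd_le (x - y).2).trans (norm_snd_le (x - y))
  have dP : |P x.2.2 - P y.2.2| ≤ ‖x - y‖ := (D.P_lip _ _).trans d3
  set n := ‖x - y‖
  have hn : 0 ≤ n := norm_nonneg _
  set w := x.2.1 + r t * P x.2.2 with hw
  set w' := y.2.1 + r t * P y.2.2 with hw'
  have dw : |w - w'| ≤ (1 + B) * n := by
    have : w - w' = (x.2.1 - y.2.1) + r t * (P x.2.2 - P y.2.2) := by rw [hw, hw']; ring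
    rw [this]
    calc _ ≤ |x.2.1 - y.2.1| + |r t| * |P x.2.2 - P y.2.2| := by
          rw [← abs_mul]; exact abs_add_le _ _
      _ ≤ n + B * n := by
          have := D.r_le t ht
          gcongr
      _ = _ := by ring
  have hext : 0 ≤ 2 * B * n := by positivity
  refine max_le ?_ (max_le ?_ ?_)
  · change |-(e t * w) - -(e t * w')| ≤ _
    have : -(e t * w) - -(e t * w') = -(e t * (w - w')) := by ring
    rw [this, abs_neg, abs_mul]
    have := mul_le_mul (D.e_le t ht) dw (abs_nonneg _) hB
    nlinarith
  · change |(-(c t * x.1) - k t * w - ρ t * P x.2.2) - (-(c t * y.1) - k t * w' - ρ t * P y.2.2)| ≤ _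
    have : (-(c t * x.1) - k t * w - ρ t * P x.2.2) - (-(c t * y.1) - k t * w' - ρ t * P y.2.2)
        = -(c t * (x.1 - y.1)) - k t * (w - w') - ρ t * (P x.2.2 - P y.2.2) := by ring
    rw [this]
    have a1 := mul_le_mul hc d1 (abs_nonneg _) hB
    have a2 := mul_le_mul (D.k_le t ht) dw (abs_nonneg _) hB
    have a3 := mul_le_mul (D.ρ_le t ht) dP (abs_nonneg _) hB
    calc _ ≤ |c t| * |x.1 - y.1| + |k t| * |w - w'| + |ρ t| * |P x.2.2 - P y.2.2| := by
          rw [← abs_mul, ← abs_mul, ← abs_mul, ← abs_neg (c t * _)]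
          exact (abs_sub _ _).trans (add_le_add (abs_sub _ _) le_rfl)
      _ ≤ _ := by nlinarith
  · change |γ t * max w 0 - γ t * max w' 0| ≤ _
    rw [← mul_sub, abs_mul]
    have a1 := mul_le_mul (D.γ_le t ht) ((abs_max_sub_max_le_abs w w' 0).trans dw)
      (abs_nonneg _) hB
    nlinarith

theorem rate_cont {V f : ℝ → ℝ} (hV : ContinuousOn V (Icc 0 T)) (hf : ContinuousOn f (Icc 0 T)) :
    ContinuousOn (fun t => V t + r t * P (f t)) (Icc 0 T) :=
  hV.add (D.r_deriv.continuousOn.mul (D.P_cont.comp_continuousOn hf))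

theorem comp_int {X V f : ℝ → ℝ} (hX : ContinuousOn X (Icc 0 T)) (hV : ContinuousOn V (Icc 0 T))
    (hf : ContinuousOn f (Icc 0 T)) :
    IntervalIntegrable (fun t => -(e t * (V t + r t * P (f t)))) volume 0 T ∧
    IntervalIntegrable
      (fun t => -(c t * X t) - k t * (V t + r t * P (f t)) - ρ t * P (f t)) volume 0 T ∧
    IntervalIntegrable (fun t => γ t * max (V t + r t * P (f t)) 0) volume 0 T := by
  have hW := D.rate_cont hV hf
  have hPf := D.P_cont.comp_continuousOn hf
  have hW0 : ContinuousOn (fun t => max (V t + r t * P (f t)) 0) (Icc 0 T) :=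
    hW.sup continuousOn_const
  rw [← uIcc_of_le D.T_pos.le] at hW hPf hW0 hX
  exact ⟨(D.e_int.mul_continuousOn hW).neg, ((D.c_int.mul_continuousOn hX).neg.sub
    (D.k_int.mul_continuousOn hW)).sub (D.r_deriv.intervalIntegrable.mul_continuousOn hPf),
    D.γ_int.mul_continuousOn hW0⟩

theorem vec_int (φ : ℝ → ℝ × ℝ × ℝ) (hφ : ContinuousOn φ (Icc 0 T)) :
    IntervalIntegrable (fun t => shootField e c k γ r ρ P t (φ t)) volume 0 T := by
  obtain ⟨h1, h2, h3⟩ := D.comp_int hφ.fst hφ.snd.fst hφ.snd.snd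
  rw [intervalIntegrable_iff] at h1 h2 h3 ⊢
  exact h1.prodMk (h2.prodMk h3)

theorem exists_shot (x a : ℝ) : ∃ X V f, X 0 = x ∧ V 0 = a ∧ f 0 = 0 ∧
    IsShot T e c k γ r ρ P X V f := by
  have hT := D.T_pos.le
  have hB := D.B_nonneg
  obtain ⟨φ, hφ, he⟩ := exists_volterra hT (K := 2 * B + B * (1 + B)) (by positivity)
    D.lip D.vec_int (b := fun _ => ((x, a, 0) : ℝ × ℝ × ℝ)) continuousOn_const
  have h0 : φ 0 = (x, a, 0) := by simpa using he 0 (left_mem_Icc.2 hT)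
  obtain ⟨h1, h2, h3⟩ := D.comp_int hφ.continuousOn.fst hφ.continuousOn.snd.fst
    hφ.continuousOn.snd.snd
  have hsub : ∀ t ∈ Icc 0 T, uIcc 0 t ⊆ uIcc 0 T := fun t ht => by
    rw [uIcc_of_le hT, uIcc_of_le ht.1]; exact Icc_subset_Icc_right ht.2
  have hint : ∀ t ∈ Icc 0 T, ∫ s in (0 : ℝ)..t, shootField e c k γ r ρ P s (φ s) = _ :=
    fun t ht => intervalIntegral_triple ht.1 (h1.mono_set (hsub t ht)) (h2.mono_set (hsub t ht))
      (h3.mono_set (hsub t ht))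
  refine ⟨fun t => (φ t).1, fun t => (φ t).2.1, fun t => (φ t).2.2, by simp [h0], by simp [h0],
    by simp [h0], HasAEDeriv.of_eq_integral hT h1 fun t ht => ?_,
    HasAEDeriv.of_eq_integral hT h2 fun t ht => ?_, HasAEDeriv.of_eq_integral hT h3 fun t ht => ?_⟩
  · have := he t ht
    rw [hint t ht] at this
    rw [h0, this]; rfl
  · have := he t ht
    rw [hint t ht] at this
    rw [h0, this]; rfl
  · have := he t ht
    rw [hint t ht] at this
    rw [h0, this]; rfl

omit D in
theorem shot_eq {X V f : ℝ → ℝ} (h : IsShot T e c k γ r ρ P X V f) {t : ℝ} (ht : t ∈ Icc 0 T) :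
    ((X t, V t, f t) : ℝ × ℝ × ℝ) =
      (X 0, V 0, f 0) + ∫ s in (0 : ℝ)..t, shootField e c k γ r ρ P s (X s, V s, f s) := by
  have := intervalIntegral_triple ht.1 (h.dX.mono le_rfl ht.1 ht.2).intervalIntegrable
    (h.dV.mono le_rfl ht.1 ht.2).intervalIntegrable
    (h.df.mono le_rfl ht.1 ht.2).intervalIntegrable
  simp only [shootField]
  rw [this, h.dX.eq ht, h.dV.eq ht, h.df.eq ht]
  rfl

theorem shot_dist_le {X V f X' V' f' : ℝ → ℝ} (h : IsShot T e c k γ r ρ P X V f)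
    (h' : IsShot T e c k γ r ρ P X' V' f') (hX : X 0 = X' 0) (hf : f 0 = f' 0) :
    ∀ t ∈ Icc 0 T, |X t - X' t| ≤ |V 0 - V' 0| * Real.exp ((2 * B + B * (1 + B)) * t) ∧
      |V t - V' t| ≤ |V 0 - V' 0| * Real.exp ((2 * B + B * (1 + B)) * t) ∧
      |f t - f' t| ≤ |V 0 - V' 0| * Real.exp ((2 * B + B * (1 + B)) * t) := by
  have hT := D.T_pos.le
  have hB := D.B_nonneg
  have hd := volterra_dist_le (d := |V 0 - V' 0|) hT (K := 2 * B + B * (1 + B)) (by positivity)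
    D.lip D.vec_int
    (φ := fun t => (X t, V t, f t)) (ψ := fun t => (X' t, V' t, f' t))
    (b := fun _ => (X 0, V 0, f 0)) (c := fun _ => (X' 0, V' 0, f' 0))
    (h.dX.continuousOn.prodMk (h.dV.continuousOn.prodMk h.df.continuousOn))
    (h'.dX.continuousOn.prodMk (h'.dV.continuousOn.prodMk h'.df.continuousOn))
    (fun t ht => shot_eq h ht) (fun t ht => shot_eq h' ht) (fun t _ => by
      refine max_le ?_ (max_le ?_ ?_)
      · change |X 0 - X' 0| ≤ _
        rw [hX, sub_self, abs_zero]; exact abs_nonneg _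
      · exact le_rfl
      · change |f 0 - f' 0| ≤ _
        rw [hf, sub_self, abs_zero]; exact abs_nonneg _)
  intro t ht
  have := hd t ht
  exact ⟨(norm_fst_le _).trans this, ((norm_fst_le _).trans (norm_snd_le _)).trans this,
    ((norm_snd_le _).trans (norm_snd_le _)).trans this⟩

theorem shot_unique {X V f X' V' f' : ℝ → ℝ} (h : IsShot T e c k γ r ρ P X V f)
    (h' : IsShot T e c k γ r ρ P X' V' f') (hX : X 0 = X' 0) (hV : V 0 = V' 0)
    (hf : f 0 = f' 0) : ∀ t ∈ Icc 0 T, X t = X' t ∧ V t = V' t ∧ f t = f' t := by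
  intro t ht
  have := D.shot_dist_le h h' hX hf t ht
  simp only [hV, sub_self, abs_zero, zero_mul] at this
  exact ⟨sub_eq_zero.1 (abs_nonpos_iff.1 this.1), sub_eq_zero.1 (abs_nonpos_iff.1 this.2.1),
    sub_eq_zero.1 (abs_nonpos_iff.1 this.2.2)⟩

/-- The rate `W = V + r P(f)` of a shot solves a linear equation with bounded coefficient. -/
theorem shot_rate {X V f : ℝ → ℝ} (h : IsShot T e c k γ r ρ P X V f) (hf : f 0 = 0) :
    ∃ θ β : ℝ → ℝ, HasAEDeriv (fun t => P (f t))
        (fun t => θ t * (γ t * max (V t + r t * P (f t)) 0)) 0 T ∧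
      HasAEDeriv (fun t => V t + r t * P (f t)) (fun t => -(c t * X t) -
        k t * (V t + r t * P (f t)) + r t * (θ t * (γ t * max (V t + r t * P (f t)) 0))) 0 T ∧
      HasAEDeriv (fun t => V t + r t * P (f t)) (fun t => -(c t * X t) -
        β t * (V t + r t * P (f t))) 0 T ∧ IntervalIntegrable β volume 0 T ∧
      ∀ t ∈ Icc 0 T, |β t| ≤ B + B * B := by
  have hT := D.T_pos.le
  have hB := D.B_nonneg
  obtain ⟨θ, hθ, hP⟩ := D.P_deriv f _ h.df (Eventually.of_forall fun t ht =>
    mul_nonneg (D.γ_nonneg t (Ioo_subset_Icc_self ht)) (le_max_right _ _)) hf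
  set W := fun t => V t + r t * P (f t) with hWdef
  have hWc : ContinuousOn W (Icc 0 T) := D.rate_cont h.dV.continuousOn h.df.continuousOn
  -- Since $|g|\le B^2|W|$, the feedback term can be absorbed as $g=(g/W)\,W$. At zeros of $W$ also
  -- $g=0$, so the convention for division by zero is harmless. The resulting linear equation for
  -- $W$ is of the form required by the energy estimates.
  set g := fun t => r t * (θ t * (γ t * max (W t) 0)) with hg
  have hgW : ∀ t, g t = g t / W t * W t := by
    intro t
    by_cases h0 : W t = 0
    · simp [hg, h0]
    · field_simp
  have hgb : ∀ t ∈ Icc 0 T, |g t / W t| ≤ B * B := by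
    intro t ht
    rw [abs_div]
    by_cases h0 : W t = 0
    · rw [h0]; simp; positivity
    · rw [div_le_iff₀ (abs_pos.2 h0), hg]
      simp only [abs_mul]
      have a1 := D.r_le t ht
      have a2 := D.γ_le t ht
      have a3 : |θ t| ≤ 1 := abs_le.2 ⟨by linarith [(hθ t).1], (hθ t).2⟩
      have a4 : |max (W t) 0| ≤ |W t| := by
        have := abs_max_sub_max_le_abs (W t) 0 0
        simpa using this
      calc |r t| * (|θ t| * (|γ t| * |max (W t) 0|)) ≤ B * (1 * (B * |W t|)) := by gcongr
        _ = _ := by ring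
  have hgi : IntervalIntegrable g volume 0 T := by
    refine hP.intervalIntegrable.continuousOn_mul ?_
    rw [uIcc_of_le hT]; exact D.r_deriv.continuousOn
  have hβi : IntervalIntegrable (fun t => g t / W t) volume 0 T := by
    rw [intervalIntegrable_iff_integrableOn_Icc_of_le hT] at hgi ⊢
    refine Integrable.mono' (integrable_const (B * B) : Integrable _ (volume.restrict (Icc 0 T)))
      ?_ ?_
    · exact (hgi.aestronglyMeasurable.aemeasurable.div
        (hWc.aestronglyMeasurable measurableSet_Icc).aemeasurable).aestronglyMeasurable
    · rw [ae_restrict_iff' measurableSet_Icc]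
      exact Eventually.of_forall hgb
  have hW := (h.dV.add (D.r_deriv.mul hP)).congr_deriv' (g := fun t => -(c t * X t) -
        k t * W t + g t) fun t _ => by simp only [hg, hWdef]; ring
  refine ⟨θ, fun t => k t - g t / W t, hP, hW, hW.congr_deriv' fun t _ => ?_,
    D.k_int.sub hβi, fun t ht => ?_⟩
  · have := hgW t
    change -(c t * X t) - (k t - g t / W t) * W t = _
    linear_combination -this
  · exact (abs_sub _ _).trans (add_le_add (D.k_le t ht) (hgb t ht))

/-- With zero initial rate the terminal position stays positive. -/
theorem shot_zero_terminal {X V f : ℝ → ℝ} (h : IsShot T e c k γ r ρ P X V f) (hf : f 0 = 0)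
    (hV : V 0 = 0) (hX : 0 < X 0) : 0 < X T := by
  have hT := D.T_pos.le
  obtain ⟨θ, β, -, -, hW, hβ, -⟩ := D.shot_rate h hf
  obtain ⟨E, hE, hd⟩ := exists_weight_antitone h.dX hW hβ
  have hanti := hd.antitoneOn (by
    filter_upwards [D.c_nonneg] with t ht htm
    have h1 := ht (Ioo_subset_Icc_self htm)
    have h2 := D.e₀_pos.le.trans (D.e_ge t (Ioo_subset_Icc_self htm))
    have h3 := hE t
    have : 0 ≤ e t * (V t + r t * P (f t)) ^ 2 * E t + c t * X t ^ 2 * E t := by positivity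
    linarith)
  -- The weighted product $XWE$ starts at $0$ and is nonincreasing, hence $XW\le0$ and
  -- $(X^2)'=-2eXW\ge0$: the position can never reach $0$.
  have hle : ∀ t ∈ Icc 0 T, X t * (V t + r t * P (f t)) ≤ 0 := fun t ht => by
    have := hanti (left_mem_Icc.2 hT) ht ht.1
    simp only [hf, hV, D.P_zero, mul_zero, add_zero, zero_mul] at this
    exact nonpos_of_mul_nonpos_left this (hE t)
  have hmono := (h.dX.mul h.dX).monotoneOn (Eventually.of_forall fun t ht => by
    have h1 := hle t (Ioo_subset_Icc_self ht)
    have h2 := D.e₀_pos.le.trans (D.e_ge t (Ioo_subset_Icc_self ht))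
    nlinarith)
  by_contra! hneg
  obtain ⟨s, hs, hs0⟩ : ∃ s ∈ Icc 0 T, X s = 0 :=
    intermediate_value_Icc' hT h.dX.continuousOn ⟨hneg, hX.le⟩
  have := hmono (left_mem_Icc.2 hT) hs hs.1
  simp only [hs0, mul_zero] at this
  nlinarith

/-- With a large initial rate the terminal position is negative. -/
theorem shot_large_terminal {X V f : ℝ → ℝ} (h : IsShot T e c k γ r ρ P X V f) (hf : f 0 = 0)
    (hX : 0 ≤ X 0)
    (hV : B * X 0 * Real.exp ((B + B * B) * T) * T +
      (X 0 / (e₀ * T) + 1) * Real.exp ((B + B * B) * T) ≤ V 0) : X T ≤ 0 := by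
  have hTp := D.T_pos
  have hT := D.T_pos.le
  have hB := D.B_nonneg
  have he₀ := D.e₀_pos
  obtain ⟨θ, β, -, -, hW, hβ, hβb⟩ := D.shot_rate h hf
  set W := fun t => V t + r t * P (f t) with hWdef
  have hW0 : W 0 = V 0 := by simp [hWdef, hf, D.P_zero]
  set Q := Real.exp ((B + B * B) * T) with hQ
  have hQ1 : 0 < Q := Real.exp_pos _
  set E := fun t => Real.exp (∫ s in (0 : ℝ)..t, β s) with hEdef
  have hE : HasAEDeriv E (fun t => E t * β t) 0 T :=
    (HasAEDeriv.of_eq_integral hT hβ (fun t _ => by simp)).exp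
  have hEpos : ∀ t, 0 < E t := fun t => Real.exp_pos _
  have hEle : ∀ t ∈ Icc 0 T, E t ≤ Q := by
    intro t ht
    refine Real.exp_le_exp.2 ((le_abs_self _).trans ?_)
    have := intervalIntegral.norm_integral_le_of_norm_le_const (a := (0 : ℝ)) (b := t)
      (C := B + B * B) (f := β) (fun s hs => by
        rw [uIoc_of_le ht.1] at hs
        exact hβb s ⟨hs.1.le, hs.2.trans ht.2⟩)
    rw [sub_zero, abs_of_nonneg ht.1] at this
    exact this.trans (mul_le_mul_of_nonneg_left ht.2 (by positivity))
  set G := (X 0 / (e₀ * T) + 1) * Q with hG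
  have hG0 : 0 < G := by positivity
  have hWE : HasAEDeriv (fun t => W t * E t + B * X 0 * Q * t)
      (fun t => -(c t * X t) * E t + B * X 0 * Q * 1) 0 T :=
    ((hW.mul hE).add ((HasAEDeriv.of_hasDerivAt (F := fun t => t) (f := fun _ => 1) hT
      continuousOn_id (fun t _ => hasDerivAt_id t) intervalIntegrable_const).const_mul
        (B * X 0 * Q))).congr_deriv' fun t _ => by ring
  have hstep : ∀ s ∈ Icc 0 T, (∀ t ∈ Ico 0 s, 0 < W t) → G ≤ W s * E s := by
    intro s hs hpos
    have hanti := (h.dX.mono le_rfl hs.1 hs.2).antitoneOn (Eventually.of_forall fun t ht => by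
      have h1 := hpos t (Ioo_subset_Ico_self ht)
      have h2 := he₀.le.trans (D.e_ge t ⟨ht.1.le, ht.2.le.trans hs.2⟩)
      have := mul_nonneg h2 h1.le
      linarith)
    have hmono := (hWE.mono le_rfl hs.1 hs.2).monotoneOn (by
      filter_upwards [D.c_le, D.c_nonneg] with t h1 h2 ht
      have htI : t ∈ Icc 0 T := ⟨ht.1.le, ht.2.le.trans hs.2⟩
      have h3 := hanti (left_mem_Icc.2 hs.1) (Ioo_subset_Icc_self ht) ht.1.le
      have h4 := (le_abs_self _).trans (h1 htI)
      have h5 := h2 htI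
      have h6 := hEle t htI
      have h7 := (hEpos t).le
      have h8 : c t * X t * E t ≤ B * X 0 * Q := by
        calc c t * X t * E t ≤ c t * X 0 * E t := by gcongr
          _ ≤ B * X 0 * Q := by gcongr
      linarith)
    have := hmono (left_mem_Icc.2 hs.1) (right_mem_Icc.2 hs.1) hs.1
    simp only [hW0, hEdef, intervalIntegral.integral_same, Real.exp_zero, mul_one, mul_zero,
      add_zero] at this
    have h9 : B * X 0 * Q * s ≤ B * X 0 * Q * T := mul_le_mul_of_nonneg_left hs.2 (by positivity)
    simp only [hEdef]
    linarith
  have hWpos : ∀ t ∈ Icc 0 T, 0 < W t := by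
    by_contra! hneg
    have hc : ContinuousOn W (Icc 0 T) := hW.continuousOn
    obtain ⟨s, hs, hs0, hpos⟩ := exists_first_zero hc (by
      rw [hW0]
      have : 0 ≤ B * X 0 * Q * T := by positivity
      linarith) hneg
    have := hstep s ⟨hs.1.le, hs.2⟩ hpos
    rw [hs0, zero_mul] at this
    linarith
  -- A rate of at least $X_0/(e_0T)$ throughout liquidates all of $X_0$ by time $T$.
  have hWge : ∀ t ∈ Icc 0 T, X 0 / (e₀ * T) ≤ W t := by
    intro t ht
    have h1 := hstep t ht fun s hs => hWpos s ⟨hs.1, hs.2.le.trans ht.2⟩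
    have h2 := mul_le_mul_of_nonneg_left (hEle t ht) (hWpos t ht).le
    have h3 : (X 0 / (e₀ * T) + 1) * Q ≤ W t * Q := h1.trans h2
    have := le_of_mul_le_mul_right h3 hQ1
    linarith
  have hfin := (h.dX.add ((HasAEDeriv.of_hasDerivAt (F := fun t => t) (f := fun _ => 1) hT
      continuousOn_id (fun t _ => hasDerivAt_id t) intervalIntegrable_const).const_mul
        (X 0 / T))).antitoneOn (Eventually.of_forall fun t ht => by
    have htI := Ioo_subset_Icc_self ht
    have h1 := hWge t htI
    have h2 := D.e_ge t htI
    have h3 : 0 ≤ X 0 / (e₀ * T) := by positivity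
    have h4 : e₀ * (X 0 / (e₀ * T)) ≤ e t * W t := mul_le_mul h2 h1 h3 (he₀.le.trans h2)
    have h5 : e₀ * (X 0 / (e₀ * T)) = X 0 / T := by field_simp
    change -(e t * W t) + X 0 / T * 1 ≤ 0
    linarith)
  have := hfin (left_mem_Icc.2 hT) (right_mem_Icc.2 hT) hT
  simp only [mul_zero, add_zero] at this
  have h5 : X 0 / T * T = X 0 := by field_simp
  linarith

/-- The shooting problem is solvable. -/
theorem exists_shot_terminal {x : ℝ} (hx : 0 ≤ x) : ∃ X V f, X 0 = x ∧ f 0 = 0 ∧ X T = 0 ∧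
    IsShot T e c k γ r ρ P X V f := by
  have hT := D.T_pos.le
  have hB := D.B_nonneg
  -- For $x=0$ the zero solution works; the strict lower bound on the terminal position needs $x>0$.
  rcases hx.eq_or_lt with h0 | hx
  · have hz := HasAEDeriv.const hT 0
    exact ⟨fun _ => 0, fun _ => 0, fun _ => 0, h0, rfl, rfl,
      hz.congr_deriv' fun t _ => by simp [D.P_zero], hz.congr_deriv' fun t _ => by simp [D.P_zero],
      hz.congr_deriv' fun t _ => by simp [D.P_zero]⟩
  choose X V f hX hV hf hs using D.exists_shot x
  have hcont : Continuous fun a => X a T := by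
    have : LipschitzWith (Real.toNNReal (Real.exp ((2 * B + B * (1 + B)) * T)))
        fun a => X a T := LipschitzWith.of_dist_le_mul fun a b => by
      have := (D.shot_dist_le (hs a) (hs b) (by rw [hX, hX]) (by rw [hf, hf]) T
        (right_mem_Icc.2 hT)).1
      rw [hV, hV] at this
      rw [Real.coe_toNNReal _ (Real.exp_pos _).le, Real.dist_eq, Real.dist_eq]
      linarith
    exact this.continuous
  set a₁ := B * x * Real.exp ((B + B * B) * T) * T +
      (x / (e₀ * T) + 1) * Real.exp ((B + B * B) * T) with ha₁
  have ha₁0 : 0 ≤ a₁ := by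
    have := D.e₀_pos
    have := D.T_pos
    positivity
  -- Intermediate value theorem for the terminal position, which depends continuously on $V_0$ and
  -- changes sign between $0$ and $a_1$.
  obtain ⟨a, -, ha⟩ : ∃ a ∈ Icc 0 a₁, X a T = 0 :=
    intermediate_value_Icc' ha₁0 hcont.continuousOn
      ⟨D.shot_large_terminal (hs a₁) (hf a₁) (by rw [hX]; exact hx.le) (by rw [hX, hV]),
        (D.shot_zero_terminal (hs 0) (hf 0) (hV 0) (by rw [hX]; exact hx)).le⟩
  exact ⟨X a, V a, f a, hX a, hf a, ha, hs a⟩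

end ShootingData

end Liquidation

/-! ### Existence and uniqueness for the aggregate equation. -/

namespace Liquidation

namespace Market

variable {M : Market} {δ : ℝ} {N : ℕ}

/-- The number of players with liquidation times `τ` still active at time `t`. -/
noncomputable def activeCount (τ : Fin N → ℝ) (t : ℝ) : ℝ :=
  ∑ j, (Iic (τ j)).indicator (fun _ => (1 : ℝ)) t

/-- The weighted total overshoot of the level `f` over the positive initial positions. -/
noncomputable def overshoot (δ : ℝ) (x : Fin N → ℝ) (f : ℝ) : ℝ :=
  δ * ∑ j with 0 < x j, max (f - x j) 0

/-- The number of players with nonzero initial position. -/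
noncomputable def startCount (x : Fin N → ℝ) : ℝ := ∑ j, if x j = 0 then (0 : ℝ) else 1

/-- Aggregate position `X` and impact-weighted aggregate rate `W = ηX'` of an equilibrium. -/
structure IsAggregate (M : Market) (δ : ℝ) (x : Fin N → ℝ) (X W : ℝ → ℝ) : Prop where
  zero : X 0 = δ * ∑ j, x j
  dX : HasAEDeriv X (fun t => -((M.η t)⁻¹ * W t)) 0 M.T
  dW : HasAEDeriv W (fun t => -((M.lam t + δ * derivWithin M.κ (Icc 0 M.T) t) * X t) -
    M.κ t / M.η t * (δ * (activeCount (fun j => M.liqTime δ (x j) fun s => W s / M.η s) t - 1)) *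
      W t) 0 M.T
  terminal : X M.T = 0

namespace Regular

variable (hM : M.Regular δ)
include hM

theorem activeCount_integrable (τ : Fin N → ℝ) :
    IntervalIntegrable (fun t => M.κ t / M.η t * (δ * (activeCount τ t - 1))) volume 0 M.T := by
  have h1 : IntervalIntegrable (activeCount τ) volume 0 M.T := by
    have := IntervalIntegrable.sum Finset.univ (μ := volume) (a := 0) (b := M.T)
      (f := fun j => (Iic (τ j)).indicator (fun _ => (1 : ℝ)))
      (fun j _ => intervalIntegrable_const.indicator_Iic _)
    convert! this using 1
    funext t
    simp [activeCount]
  exact hM.integrable_cont_mul ((h1.sub intervalIntegrable_const).const_mul δ)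
    (hM.div_η_cont Subset.rfl hM.κ_cont)

theorem aggregate_sign {x : Fin N → ℝ} {X W : ℝ → ℝ} (h : M.IsAggregate δ x X W)
    (hx : 0 ≤ δ * ∑ j, x j) : ∀ t ∈ Icc 0 M.T, 0 ≤ W t ∧ 0 ≤ X t :=
  energy_sign h.dX h.dW (hM.activeCount_integrable _) (hM.η_inv_pos le_rfl le_rfl)
    (hM.lam_add_nonneg' le_rfl le_rfl) h.terminal (by rw [h.zero]; exact hx) hM.T_pos

theorem fFun_le {x : ℝ} {μ : ℝ → ℝ} (hμ : IntervalIntegrable μ volume 0 M.T) (hx : 0 ≤ x)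
    {t : ℝ} (ht : t ∈ Icc 0 (M.liqTime δ x μ)) : M.fFun δ μ t ≤ x := by
  by_contra! h
  have htT : t ≤ M.T := ht.2.trans (hM.liqTime_mem x μ).2
  obtain ⟨s, hs, hsx⟩ : ∃ s ∈ Icc 0 t, M.fFun δ μ s = x :=
    intermediate_value_Icc ht.1 ((hM.fFun_cont hμ).mono (Icc_subset_Icc_right htT))
      ⟨by rw [fFun_zero]; exact hx, h.le⟩
  have h1 := hM.liqTime_le ⟨hs.1, hs.2.trans htT⟩ hsx
  have h2 : s = t := le_antisymm hs.2 (ht.2.trans h1)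
  rw [h2] at hsx
  linarith

theorem fFun_mono {μ : ℝ → ℝ} (hμ : IntervalIntegrable μ volume 0 M.T)
    (h0 : ∀ᵐ t, t ∈ Icc 0 M.T → 0 ≤ μ t) : MonotoneOn (M.fFun δ μ) (Icc 0 M.T) := by
  obtain ⟨z, y, hz⟩ := hM.exists_fund
  refine (hM.fFun_deriv hz hμ).monotoneOn ?_
  filter_upwards [h0] with t ht htm
  have h1 := ht (Ioo_subset_Icc_self htm)
  have h2 := hM.κ_nonneg t (Ioo_subset_Icc_self htm)
  have h3 := hM.fund_pos hz.homog hz.z_zero hz.y_zero t (Ioo_subset_Ioc_self htm)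
  have h4 := M.discount_pos δ t
  positivity

/-- A nondecreasing $f_\mu$ starting at $0$ never reaches a negative level. -/
theorem liqTime_eq_T {x : ℝ} {μ : ℝ → ℝ} (hμ : IntervalIntegrable μ volume 0 M.T)
    (h0 : ∀ᵐ t, t ∈ Icc 0 M.T → 0 ≤ μ t) (hx : x < 0) : M.liqTime δ x μ = M.T := by
  have hmem := hM.liqTime_mem x μ
  refine le_antisymm hmem.2 ?_
  by_contra! hlt
  have h1 := hM.fFun_liqTime hμ hlt
  have h2 := hM.fFun_mono hμ h0 (left_mem_Icc.2 hM.T_pos.le) hmem hmem.1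
  rw [fFun_zero, h1] at h2
  linarith

/-- Players with positive position stay active for a uniform positive time. -/
theorem exists_time_bound (x : Fin N → ℝ) {m : ℝ} (hm : 0 ≤ m) : ∃ t₀ ∈ Ioc 0 M.T,
    ∀ μ : ℝ → ℝ, IntervalIntegrable μ volume 0 M.T → (∀ᵐ t, t ∈ Icc 0 M.T → 0 ≤ μ t) →
      ∫ t in (0 : ℝ)..M.T, μ t ≤ m → ∀ j, 0 < x j → t₀ ≤ M.liqTime δ (x j) μ := by
  obtain ⟨z, y, hz⟩ := hM.exists_fund
  obtain ⟨ρ, hρ, hρx⟩ : ∃ ρ > 0, ∀ j, 0 < x j → ρ ≤ x j := by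
    rcases (Finset.univ.filter fun j => 0 < x j).eq_empty_or_nonempty with h | h
    · refine ⟨1, one_pos, fun j hj => ?_⟩
      have : j ∈ Finset.univ.filter fun j => 0 < x j := by simp [hj]
      rw [h] at this; simp at this
    · obtain ⟨i, hi, hmin⟩ := Finset.exists_min_image _ x h
      exact ⟨x i, (Finset.mem_filter.1 hi).2, fun j hj => hmin j (by simp [hj])⟩
  have hT := hM.T_pos
  set q := fun t => M.κ t * (z t * M.discount δ t)
  have hqc : ContinuousOn q (Icc 0 M.T) :=
    hM.κ_cont.mul (hz.homog.dX.continuousOn.mul hM.discount_deriv.continuousOn)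
  have hq0 : q 0 = 0 := by simp [q, hz.z_zero]
  -- The density of $f_\mu$ is $\mu q$ with $q$ small near $0$. If $q\le\rho/(m+1)$ up to $t_0$,
  -- then $f_\mu\le\rho m/(m+1)<\rho$ there, below every positive initial position.
  have hε : 0 < ρ / (m + 1) := by positivity
  have hev : ∀ᶠ t in 𝓝[Icc 0 M.T] 0, q t < ρ / (m + 1) := by
    have := hqc 0 (left_mem_Icc.2 hT.le)
    exact this.eventually (gt_mem_nhds (by rw [hq0]; exact hε))
  obtain ⟨d, hd, hdq⟩ := Metric.mem_nhdsWithin_iff.1 hev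
  refine ⟨min (d / 2) M.T, ⟨by positivity, min_le_right _ _⟩, fun μ hμ h0 hmm j hj => ?_⟩
  set t₀ := min (d / 2) M.T with ht₀
  have hq : ∀ t ∈ Icc 0 t₀, q t ≤ ρ / (m + 1) := fun t ht => by
    have h1 : t ≤ d / 2 := ht.2.trans (min_le_left _ _)
    refine (hdq ⟨?_, ht.1, ht.2.trans (min_le_right _ _)⟩ : q t < _).le
    rw [Metric.mem_ball, Real.dist_eq, sub_zero, abs_of_nonneg ht.1]
    linarith
  by_contra! hlt
  set σ := M.liqTime δ (x j) μ
  have hσ := hM.liqTime_mem (x j) μ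
  have hfσ : M.fFun δ μ σ = x j := hM.fFun_liqTime hμ (hlt.trans_le (min_le_right _ _))
  have hI : HasAEDeriv (fun t => ∫ s in (0 : ℝ)..t, μ s) μ 0 M.T :=
    HasAEDeriv.of_eq_integral hT.le hμ (fun t _ => by simp)
  have hanti := (((hM.fFun_deriv hz hμ).sub (hI.const_mul (ρ / (m + 1)))).mono le_rfl hσ.1
    hσ.2).antitoneOn (by
      filter_upwards [h0] with t ht htm
      have h1 := ht ⟨htm.1.le, htm.2.le.trans hσ.2⟩
      have h2 := hq t ⟨htm.1.le, (htm.2.trans hlt).le⟩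
      have : M.κ t * μ t * (z t * M.discount δ t) = μ t * q t := by simp only [q]; ring
      rw [this]
      nlinarith [mul_le_mul_of_nonneg_left h2 h1])
  have h1 := hanti (left_mem_Icc.2 hσ.1) (right_mem_Icc.2 hσ.1) hσ.1
  have hImono := hI.monotoneOn (h0.mono fun t ht htm => ht (Ioo_subset_Icc_self htm))
    hσ (right_mem_Icc.2 hT.le) hσ.2
  simp only [fFun_zero, intervalIntegral.integral_same, mul_zero, sub_zero] at h1 hImono
  rw [hfσ] at h1
  have h2 : ρ / (m + 1) * ∫ s in (0 : ℝ)..σ, μ s ≤ ρ / (m + 1) * m :=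
    mul_le_mul_of_nonneg_left (hImono.trans hmm) hε.le
  have h3 : ρ / (m + 1) * m < ρ := by
    rw [div_mul_eq_mul_div, div_lt_iff₀ (by positivity)]; nlinarith
  linarith [hρx j hj]

omit hM in
theorem overshoot_lip {δ : ℝ} (hδ : 0 ≤ δ) (hδN : δ * N ≤ 1) (x : Fin N → ℝ) (a b : ℝ) :
    |overshoot δ x a - overshoot δ x b| ≤ |a - b| := by
  rw [overshoot, overshoot, ← mul_sub, ← Finset.sum_sub_distrib, abs_mul, abs_of_nonneg hδ]
  calc δ * |∑ j with 0 < x j, (max (a - x j) 0 - max (b - x j) 0)|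
      ≤ δ * ∑ j with 0 < x j, |a - b| := by
        gcongr
        refine (Finset.abs_sum_le_sum_abs _ _).trans (Finset.sum_le_sum fun j _ => ?_)
        refine (abs_max_sub_max_le_abs _ _ _).trans (le_of_eq ?_)
        congr 1; ring
    _ ≤ δ * ∑ _j : Fin N, |a - b| := by
        gcongr
        exact Finset.subset_univ _
    _ = δ * N * |a - b| := by simp; ring
    _ ≤ 1 * |a - b| := by gcongr
    _ = _ := one_mul _

omit hM in
theorem overshoot_zero {δ : ℝ} (x : Fin N → ℝ) : overshoot δ x 0 = 0 := by
  rw [overshoot, Finset.sum_eq_zero, mul_zero]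
  intro j hj
  exact max_eq_right (by linarith [(Finset.mem_filter.1 hj).2])

omit hM in
theorem overshoot_deriv {δ : ℝ} {x : Fin N → ℝ} {f g : ℝ → ℝ} {b : ℝ} (σ : Fin N → ℝ)
    (hf : HasAEDeriv f g 0 b) (hσ : ∀ j, 0 < x j → σ j ∈ Icc 0 b)
    (h1 : ∀ j, 0 < x j → ∀ t ∈ Icc 0 (σ j), f t ≤ x j)
    (h2 : ∀ j, 0 < x j → σ j < b → ∀ t ∈ Icc (σ j) b, x j ≤ f t) :
    HasAEDeriv (fun t => overshoot δ x (f t))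
      (fun t => δ * ∑ j with 0 < x j, (Ioi (σ j)).indicator g t) 0 b :=
  (HasAEDeriv.sum _ hf.le fun j hj => hf.pos_part (hσ j (Finset.mem_filter.1 hj).2)
    (h1 j (Finset.mem_filter.1 hj).2) (h2 j (Finset.mem_filter.1 hj).2)).const_mul δ

omit hM in
-- A nondecreasing path crosses each kink $x_j$ once, at a time $\sigma_j$. The slope $\theta$ is
-- $\delta$ times the number of levels already crossed, hence at most $\delta N\le1$.
theorem overshoot_deriv' {δ : ℝ} (hδ : 0 ≤ δ) (hδN : δ * N ≤ 1) (x : Fin N → ℝ) {b : ℝ}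
    (f g : ℝ → ℝ) (hf : HasAEDeriv f g 0 b) (hg : ∀ᵐ t, t ∈ Ioo 0 b → 0 ≤ g t)
    (h0 : f 0 = 0) : ∃ θ : ℝ → ℝ, (∀ t, 0 ≤ θ t ∧ θ t ≤ 1) ∧
      HasAEDeriv (fun t => overshoot δ x (f t)) (fun t => θ t * g t) 0 b := by
  have hmono := hf.monotoneOn hg
  have hex : ∀ j, ∃ σ, 0 < x j → σ ∈ Icc 0 b ∧ (∀ t ∈ Icc 0 σ, f t ≤ x j) ∧
      (σ < b → ∀ t ∈ Icc σ b, x j ≤ f t) := by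
    intro j
    by_cases hj : 0 < x j
    · by_cases hh : ∃ t ∈ Icc 0 b, f t = x j
      · obtain ⟨s, hs, hsx⟩ := hh
        refine ⟨s, fun _ => ⟨hs, fun t ht => ?_, fun _ t ht => ?_⟩⟩ <;> rw [← hsx]
        · exact hmono ⟨ht.1, ht.2.trans hs.2⟩ hs ht.2
        · exact hmono hs ⟨hs.1.trans ht.1, ht.2⟩ ht.1
      · refine ⟨b, fun _ => ⟨right_mem_Icc.2 hf.le, fun t ht => ?_, fun h => absurd h (lt_irrefl _)⟩⟩
        by_contra! hlt
        obtain ⟨s, hs, hsx⟩ : ∃ s ∈ Icc 0 t, f s = x j :=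
          intermediate_value_Icc ht.1 (hf.continuousOn.mono (Icc_subset_Icc_right ht.2))
            ⟨by rw [h0]; exact hj.le, hlt.le⟩
        exact hh ⟨s, ⟨hs.1, hs.2.trans ht.2⟩, hsx⟩
    · exact ⟨0, fun h => absurd h hj⟩
  choose σ hσ using hex
  refine ⟨fun t => δ * ∑ j with 0 < x j, (Ioi (σ j)).indicator (fun _ => (1 : ℝ)) t,
    fun t => ?_, ?_⟩
  · have hb : ∀ j, 0 ≤ (Ioi (σ j)).indicator (fun _ => (1 : ℝ)) t ∧
        (Ioi (σ j)).indicator (fun _ => (1 : ℝ)) t ≤ 1 := fun j => by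
      by_cases h : t ∈ Ioi (σ j)
      · rw [indicator_of_mem h]; norm_num
      · rw [indicator_of_notMem h]; norm_num
    refine ⟨mul_nonneg hδ (Finset.sum_nonneg fun j _ => (hb j).1), ?_⟩
    calc _ ≤ δ * ∑ j with 0 < x j, (1 : ℝ) := by
          exact mul_le_mul_of_nonneg_left (Finset.sum_le_sum fun j _ => (hb j).2) hδ
      _ ≤ δ * ∑ _j : Fin N, (1 : ℝ) := by
          gcongr
          exact Finset.subset_univ _
      _ = δ * N := by simp
      _ ≤ 1 := hδN
  · refine (overshoot_deriv σ hf (fun j hj => (hσ j hj).1) (fun j hj => (hσ j hj).2.1)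
      fun j hj => (hσ j hj).2.2).congr_deriv' fun t _ => ?_
    rw [mul_assoc, Finset.sum_mul]
    congr 1
    refine Finset.sum_congr rfl fun j _ => ?_
    by_cases h : t ∈ Ioi (σ j)
    · rw [indicator_of_mem h, indicator_of_mem h, one_mul]
    · rw [indicator_of_notMem h, indicator_of_notMem h, zero_mul]

/-- The data of the shooting problem attached to the aggregate equation. -/
theorem exists_shootingData {z y : ℝ → ℝ} (hz : M.IsFund δ z y) (hδN : δ * N ≤ 1)
    (x : Fin N → ℝ) {t₀ : ℝ} (ht₀ : t₀ ∈ Ioc 0 M.T) :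
    ∃ (B e₀ : ℝ) (r ρ : ℝ → ℝ),
      ShootingData M.T B e₀ (fun t => (M.η t)⁻¹)
        (fun t => M.lam t + δ * derivWithin M.κ (Icc 0 M.T) t)
        (fun t => M.κ t / M.η t * (δ * (startCount x - 1)))
        (fun t => M.κ t / M.η t * (z t * M.discount δ t)) r ρ (overshoot δ x) ∧
      ∀ t ∈ Icc t₀ M.T, r t * (z t * M.discount δ t) = 1 := by
  have hT := hM.T_pos
  have hHd := hz.homog.dX.mul hM.discount_deriv
  set H := fun t => z t * M.discount δ t with hH
  set H' := fun t => -((y t - δ * M.κ t * z t) / M.η t) * M.discount δ t +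
    z t * (M.discount δ t * -(δ * M.κ t / M.η t)) with hH'
  have hzc := hz.homog.dX.continuousOn
  have hLc := hM.discount_deriv.continuousOn
  have hHc : ContinuousOn H (Icc 0 M.T) := hHd.continuousOn
  have hH'c : ContinuousOn H' (Icc 0 M.T) :=
    ((hM.rate_cont hzc hz.homog.dY.continuousOn).neg.mul hLc).add
      (hzc.mul (hLc.mul hM.δκη_cont.neg))
  have hHpos : ∀ t ∈ Ioc 0 M.T, 0 < H t := fun t ht =>
    mul_pos (hM.fund_pos hz.homog hz.z_zero hz.y_zero t ht) (M.discount_pos δ t)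
  -- The factor $r=1/(z\cdot\mathrm{discount})$ is singular at $0$, where $z$ vanishes. It is frozen
  -- before $t_0$, when no positive player has left and the overshoot is zero.
  have hmax := hHd.comp_max (c := t₀) ⟨ht₀.1.le, ht₀.2⟩
  have hmpos : ∀ t ∈ Icc 0 M.T, 0 < H (max t t₀) := fun t ht =>
    hHpos _ ⟨ht₀.1.trans_le (le_max_right _ _), max_le ht.2 ht₀.2⟩
  have hr := hmax.inv hmpos
  have hκη : ContinuousOn (fun t => M.κ t / M.η t) (Icc 0 M.T) :=
    hM.div_η_cont Subset.rfl hM.κ_cont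
  have hkc : ContinuousOn (fun t => M.κ t / M.η t * (δ * (startCount x - 1))) (Icc 0 M.T) :=
    hκη.mul continuousOn_const
  have hγc : ContinuousOn (fun t => M.κ t / M.η t * H t) (Icc 0 M.T) := hκη.mul hHc
  have hm2 : ContinuousOn (fun t => -((H (max t t₀)) ^ 2)⁻¹) (Icc 0 M.T) :=
    ((hmax.continuousOn.pow 2).inv₀ fun t ht => (pow_pos (hmpos t ht) 2).ne').neg
  obtain ⟨B1, hB1⟩ := exists_bound_cont hM.η_inv_cont
  obtain ⟨B2, hB2⟩ := hM.lam_bound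
  obtain ⟨B3, hB3⟩ := exists_bound_cont (M := M) (continuousOn_const (c := δ) |>.mul hM.κ'_cont)
  obtain ⟨B4, hB4⟩ := exists_bound_cont hkc
  obtain ⟨B5, hB5⟩ := exists_bound_cont hγc
  obtain ⟨B6, hB6⟩ := exists_bound_cont hr.continuousOn
  obtain ⟨B7, hB7⟩ := exists_bound_cont (M := M) (hm2.mul hH'c)
  obtain ⟨s, hs, hmin⟩ := isCompact_Icc.exists_isMinOn (nonempty_Icc.2 hT.le) hM.η_inv_cont
  have hB3' : ∀ t ∈ Icc 0 M.T, |δ * derivWithin M.κ (Icc 0 M.T) t| ≤ B3 := hB3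
  have hB7' : ∀ t ∈ Icc 0 M.T, |-((H (max t t₀)) ^ 2)⁻¹ * H' t| ≤ B7 := hB7
  set B := |B1| + (|B2| + |B3|) + |B4| + |B5| + |B6| + |B7| with hB
  have n1 := abs_nonneg B1
  have n2 := abs_nonneg B2
  have n3 := abs_nonneg B3
  have n4 := abs_nonneg B4
  have n5 := abs_nonneg B5
  have n6 := abs_nonneg B6
  have n7 := abs_nonneg B7
  refine ⟨B, (M.η s)⁻¹, _, _, ⟨hT, by positivity, inv_pos.2 (hM.η_pos s hs), ?_, ?_, ?_, ?_, ?_, ?_,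
    hM.intervalIntegrable_of_cont hM.η_inv_cont,
    hM.lam_integrable.add (hM.intervalIntegrable_of_cont (continuousOn_const.mul hM.κ'_cont)),
    hM.intervalIntegrable_of_cont hkc, hM.intervalIntegrable_of_cont hγc, hr,
    fun t ht => hmin ht, hM.lam_add_nonneg, ?_, overshoot_lip hM.δ_nonneg hδN x,
    overshoot_zero x, overshoot_deriv' hM.δ_nonneg hδN x⟩, fun t ht => ?_⟩
  · intro t ht
    linarith [hB1 t ht, le_abs_self B1]
  · filter_upwards [hB2] with t h2 ht
    have := abs_add_le (M.lam t) (δ * derivWithin M.κ (Icc 0 M.T) t)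
    linarith [h2 ht, hB3' t ht, le_abs_self B2, le_abs_self B3]
  · intro t ht
    linarith [hB4 t ht, le_abs_self B4]
  · intro t ht
    linarith [hB5 t ht, le_abs_self B5]
  · intro t ht
    linarith [hB6 t ht, le_abs_self B6]
  · intro t ht
    have : |-((H (max t t₀)) ^ 2)⁻¹ * (Ioi t₀).indicator H' t| ≤
        |-((H (max t t₀)) ^ 2)⁻¹ * H' t| := by
      rw [abs_mul, abs_mul]
      refine mul_le_mul_of_nonneg_left ?_ (abs_nonneg _)
      by_cases h : t ∈ Ioi t₀
      · rw [indicator_of_mem h]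
      · rw [indicator_of_notMem h, abs_zero]; exact abs_nonneg _
    linarith [hB7' t ht, le_abs_self B7]
  · intro t ht
    rcases ht.1.eq_or_lt with h | h
    · rw [← h, hz.z_zero]; simp
    · exact mul_nonneg (div_nonneg (hM.κ_nonneg t ht) (hM.η_pos t ht).le) (hHpos t ⟨h, ht.2⟩).le
  · change (H (max t t₀))⁻¹ * H t = 1
    rw [max_eq_left ht.1]
    exact inv_mul_cancel₀ (hHpos t ⟨ht₀.1.trans_le ht.1, ht.2⟩).ne'

/-- For $\mu\ge0$ players short at the start never leave early, and flat players are inactive from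
the outset. Only players with positive initial position can be subtracted. -/
theorem activeCount_eq {x : Fin N → ℝ} {μ : ℝ → ℝ} (hμ : IntervalIntegrable μ volume 0 M.T)
    (h0 : ∀ᵐ t, t ∈ Icc 0 M.T → 0 ≤ μ t) {t : ℝ} (ht : t ∈ Ioo 0 M.T) :
    activeCount (fun j => M.liqTime δ (x j) μ) t = startCount x -
      ∑ j with 0 < x j, (Ioi (M.liqTime δ (x j) μ)).indicator (fun _ => (1 : ℝ)) t := by
  rw [activeCount, startCount, Finset.sum_filter, ← Finset.sum_sub_distrib]
  refine Finset.sum_congr rfl fun j _ => ?_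
  rcases lt_trichotomy (x j) 0 with hx | hx | hx
  · rw [hM.liqTime_eq_T hμ h0 hx, indicator_of_mem (show t ∈ Iic M.T from ht.2.le),
      if_neg hx.ne, if_neg (not_lt.2 hx.le), sub_zero]
  · rw [hx, hM.liqTime_zero, indicator_of_notMem (show t ∉ Iic 0 from not_le.2 ht.1),
      if_pos rfl, if_neg (lt_irrefl _), sub_zero]
  · rw [if_neg hx.ne', if_pos hx]
    by_cases h : t ≤ M.liqTime δ (x j) μ
    · rw [indicator_of_mem (by exact h), indicator_of_notMem (by exact not_lt.2 h), sub_zero]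
    · rw [indicator_of_notMem (by exact h), indicator_of_mem (by exact not_le.1 h), sub_self]

theorem overshoot_liqTime_deriv {x : Fin N → ℝ} {μ g : ℝ → ℝ}
    (hμ : IntervalIntegrable μ volume 0 M.T) (h0 : ∀ᵐ t, t ∈ Icc 0 M.T → 0 ≤ μ t)
    (hf : HasAEDeriv (M.fFun δ μ) g 0 M.T) :
    HasAEDeriv (fun t => overshoot δ x (M.fFun δ μ t))
      (fun t => δ * ∑ j with 0 < x j, (Ioi (M.liqTime δ (x j) μ)).indicator g t) 0 M.T := by
  refine overshoot_deriv _ hf (fun j _ => hM.liqTime_mem _ _)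
    (fun j hj t ht => hM.fFun_le hμ hj.le ht) fun j hj hlt t ht => ?_
  have h1 := hM.fFun_liqTime hμ hlt
  have hm := hM.liqTime_mem (δ := δ) (x j) μ
  have h2 := hM.fFun_mono hμ h0 hm ⟨hm.1.trans ht.1, ht.2⟩ ht.1
  linarith

theorem aggregate_rate_integrable {W : ℝ → ℝ} (hW : ContinuousOn W (Icc 0 M.T)) :
    IntervalIntegrable (fun t => W t / M.η t) volume 0 M.T :=
  hM.intervalIntegrable_of_cont (hM.div_η_cont Subset.rfl hW)

theorem aggregate_rate_nonneg {W : ℝ → ℝ} (hW : ∀ t ∈ Icc 0 M.T, 0 ≤ W t) :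
    ∀ᵐ t, t ∈ Icc 0 M.T → 0 ≤ W t / M.η t :=
  Eventually.of_forall fun t ht => div_nonneg (hW t ht) (hM.η_pos t ht).le

omit hM in
theorem aggregate_rate_integral {X W : ℝ → ℝ}
    (hX : HasAEDeriv X (fun t => -((M.η t)⁻¹ * W t)) 0 M.T) (hXT : X M.T = 0) :
    ∫ t in (0 : ℝ)..M.T, W t / M.η t = X 0 := by
  have := hX.neg.integral_eq
  rw [hXT] at this
  rw [show (fun t => W t / M.η t) = fun t => - -((M.η t)⁻¹ * W t) by funext t; ring, this]
  ring

/-- The jump terms caused by departed players equal $r$ times the derivative of the overshoot: the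
density of $f_\mu$ carries the factor $z\cdot\mathrm{discount}$, which $r$ cancels after $t_0$. This
makes the change of variable $V=W-rP(f)$ remove the discontinuity. -/
theorem drop_identity {x : Fin N → ℝ} {z r W : ℝ → ℝ} {t₀ : ℝ}
    (hr : ∀ t ∈ Icc t₀ M.T, r t * (z t * M.discount δ t) = 1)
    (hW : ContinuousOn W (Icc 0 M.T)) (hW0 : ∀ t ∈ Icc 0 M.T, 0 ≤ W t)
    (ht₀ : ∀ j, 0 < x j → t₀ ≤ M.liqTime δ (x j) fun s => W s / M.η s)
    {t : ℝ} (ht : t ∈ Ioo 0 M.T) :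
    r t * (δ * ∑ j with 0 < x j, (Ioi (M.liqTime δ (x j) fun s => W s / M.η s)).indicator
      (fun t => M.κ t * (W t / M.η t) * (z t * M.discount δ t)) t) =
    M.κ t / M.η t * (δ * (startCount x -
      activeCount (fun j => M.liqTime δ (x j) fun s => W s / M.η s) t)) * W t := by
  rw [hM.activeCount_eq (hM.aggregate_rate_integrable hW) (hM.aggregate_rate_nonneg hW0) ht,
    sub_sub_cancel, mul_left_comm, Finset.mul_sum, Finset.mul_sum, Finset.mul_sum,
    Finset.mul_sum, Finset.sum_mul]
  refine Finset.sum_congr rfl fun j hj => ?_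
  by_cases h : t ∈ Ioi (M.liqTime δ (x j) fun s => W s / M.η s)
  · rw [indicator_of_mem h, indicator_of_mem h]
    have := hr t ⟨(ht₀ j (Finset.mem_filter.1 hj).2).trans (le_of_lt h), ht.2.le⟩
    calc _ = δ * (M.κ t * (W t / M.η t)) * (r t * (z t * M.discount δ t)) := by ring
      _ = _ := by rw [this]; ring
  · rw [indicator_of_notMem h, indicator_of_notMem h]; simp

theorem aggregate_isShot {x : Fin N → ℝ} {z y r ρ X W : ℝ → ℝ} {t₀ : ℝ} (hz : M.IsFund δ z y)
    (hrd : HasAEDeriv r ρ 0 M.T)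
    (hr : ∀ t ∈ Icc t₀ M.T, r t * (z t * M.discount δ t) = 1)
    (h : M.IsAggregate δ x X W) (hx : 0 ≤ δ * ∑ j, x j)
    (ht₀ : ∀ j, 0 < x j → t₀ ≤ M.liqTime δ (x j) fun s => W s / M.η s) :
    IsShot M.T (fun t => (M.η t)⁻¹)
        (fun t => M.lam t + δ * derivWithin M.κ (Icc 0 M.T) t)
        (fun t => M.κ t / M.η t * (δ * (startCount x - 1)))
        (fun t => M.κ t / M.η t * (z t * M.discount δ t)) r ρ (overshoot δ x) X
        (fun t => W t - r t * overshoot δ x (M.fFun δ (fun s => W s / M.η s) t))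
        (M.fFun δ fun s => W s / M.η s) := by
  have hW0 : ∀ t ∈ Icc 0 M.T, 0 ≤ W t := fun t ht => (hM.aggregate_sign h hx t ht).1
  have hWc := h.dW.continuousOn
  have hμ := hM.aggregate_rate_integrable hWc
  have hμ0 := hM.aggregate_rate_nonneg hW0
  have hf := hM.fFun_deriv hz hμ
  have hP := hM.overshoot_liqTime_deriv (x := x) hμ hμ0 hf
  refine ⟨h.dX.congr_deriv' fun t _ => by ring, ?_, hf.congr_deriv' fun t ht => ?_⟩
  · refine (h.dW.sub (hrd.mul hP)).congr_deriv' fun t ht => ?_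
    have := hM.drop_identity (x := x) hr hWc hW0 ht₀ ht
    rw [this]
    ring
  · rw [sub_add_cancel, max_eq_left (hW0 t (Ioo_subset_Icc_self ht))]
    ring

/-- The energy estimate gives $W\ge0$, so the truncation $\max(W,0)$ in the shooting field is
inactive and $f$ is $f_\mu$ for $\mu=W/\eta$. Moreover $\int\mu=X_0$, which makes the uniform bound
$t_0$ applicable. -/
theorem shot_isAggregate {x : Fin N → ℝ} {z y r ρ X V f : ℝ → ℝ} {B e₀ t₀ : ℝ}
    (hz : M.IsFund δ z y)
    (D : ShootingData M.T B e₀ (fun t => (M.η t)⁻¹)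
        (fun t => M.lam t + δ * derivWithin M.κ (Icc 0 M.T) t)
        (fun t => M.κ t / M.η t * (δ * (startCount x - 1)))
        (fun t => M.κ t / M.η t * (z t * M.discount δ t)) r ρ (overshoot δ x))
    (hr : ∀ t ∈ Icc t₀ M.T, r t * (z t * M.discount δ t) = 1)
    (h : IsShot M.T (fun t => (M.η t)⁻¹)
        (fun t => M.lam t + δ * derivWithin M.κ (Icc 0 M.T) t)
        (fun t => M.κ t / M.η t * (δ * (startCount x - 1)))
        (fun t => M.κ t / M.η t * (z t * M.discount δ t)) r ρ (overshoot δ x) X V f)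
    (hX0 : X 0 = δ * ∑ j, x j) (hx : 0 ≤ δ * ∑ j, x j) (hf0 : f 0 = 0) (hXT : X M.T = 0)
    (ht₀ : ∀ μ : ℝ → ℝ, IntervalIntegrable μ volume 0 M.T → (∀ᵐ t, t ∈ Icc 0 M.T → 0 ≤ μ t) →
      ∫ t in (0 : ℝ)..M.T, μ t ≤ δ * ∑ j, x j → ∀ j, 0 < x j → t₀ ≤ M.liqTime δ (x j) μ) :
    M.IsAggregate δ x X fun t => V t + r t * overshoot δ x (f t) := by
  obtain ⟨θ, β, hP, hW, hWβ, hβ, -⟩ := D.shot_rate h hf0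
  set W := fun t => V t + r t * overshoot δ x (f t) with hWdef
  have hW0 : ∀ t ∈ Icc 0 M.T, 0 ≤ W t := fun t ht =>
    (energy_sign h.dX hWβ hβ (hM.η_inv_pos le_rfl le_rfl) D.c_nonneg hXT
      (by rw [hX0]; exact hx) hM.T_pos t ht).1
  have hWc := hW.continuousOn
  have hμ := hM.aggregate_rate_integrable hWc
  have hμ0 := hM.aggregate_rate_nonneg hW0
  have hfd := hM.fFun_deriv hz hμ
  have hff : ∀ t ∈ Icc 0 M.T, f t = M.fFun δ (fun s => W s / M.η s) t := by
    refine (h.df.congr_deriv' fun t ht => ?_).eqOn hfd (by rw [hf0, fFun_zero])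
    have : max (V t + r t * overshoot δ x (f t)) 0 = W t :=
      max_eq_left (hW0 t (Ioo_subset_Icc_self ht))
    rw [this]
    ring
  have hP' := (hM.overshoot_liqTime_deriv (x := x) hμ hμ0 hfd).congr
    (G := fun t => overshoot δ x (f t)) fun t ht => by rw [hff t ht]
  have hτ := ht₀ _ hμ hμ0 (by rw [aggregate_rate_integral h.dX hXT, hX0])
  refine ⟨hX0, h.dX, hW.congr_deriv ?_, hXT⟩
  -- Two descriptions of the derivative of $P(f)$, by the slope $\theta$ and by the departed
  -- players, agree a.e.; the second restores the active count.
  filter_upwards [hP.deriv, hP'.deriv] with t h1 h2 ht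
  have h3 := (h1 ht).unique (h2 ht)
  have h4 := hM.drop_identity (x := x) hr hWc hW0 hτ ht
  rw [h3, h4]
  ring

theorem exists_aggregate (hδN : δ * N ≤ 1) (x : Fin N → ℝ) (hx : 0 ≤ δ * ∑ j, x j) :
    ∃ X W, M.IsAggregate δ x X W := by
  obtain ⟨z, y, hz⟩ := hM.exists_fund
  obtain ⟨t₀, ht₀, hb⟩ := hM.exists_time_bound x hx
  obtain ⟨B, e₀, r, ρ, D, hr⟩ := hM.exists_shootingData hz hδN x ht₀
  obtain ⟨X, V, f, hX0, hf0, hXT, h⟩ := D.exists_shot_terminal hx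
  exact ⟨X, _, hM.shot_isAggregate hz D hr h hX0 hx hf0 hXT hb⟩

/-- Comparison: a strictly larger initial rate stays strictly larger. While it does, the position is
smaller, the level $f$ higher and fewer players are active, and each of these pushes the gap of the
rates up. The terminal positions could then not both be zero. -/
theorem aggregate_initial_le {x : Fin N → ℝ} {X W X' W' : ℝ → ℝ} (h : M.IsAggregate δ x X W)
    (h' : M.IsAggregate δ x X' W') (hx : 0 ≤ δ * ∑ j, x j) : W' 0 ≤ W 0 := by
  obtain ⟨z, y, hz⟩ := hM.exists_fund
  have hT := hM.T_pos
  by_contra! hlt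
  have hW0 : ∀ t ∈ Icc 0 M.T, 0 ≤ W t := fun t ht => (hM.aggregate_sign h hx t ht).1
  have hW0' : ∀ t ∈ Icc 0 M.T, 0 ≤ W' t := fun t ht => (hM.aggregate_sign h' hx t ht).1
  have hμ := hM.aggregate_rate_integrable h.dW.continuousOn
  have hμ0 := hM.aggregate_rate_nonneg hW0
  have hμ' := hM.aggregate_rate_integrable h'.dW.continuousOn
  have hμ0' := hM.aggregate_rate_nonneg hW0'
  set n := activeCount (fun j => M.liqTime δ (x j) fun s => W s / M.η s) with hn
  set n' := activeCount (fun j => M.liqTime δ (x j) fun s => W' s / M.η s) with hn'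
  have hb := hM.activeCount_integrable (fun j => M.liqTime δ (x j) fun s => W' s / M.η s)
  set E := fun t => Real.exp (∫ s in (0 : ℝ)..t, M.κ s / M.η s * (δ * (n' s - 1))) with hEdef
  have hE : HasAEDeriv E (fun t => E t * (M.κ t / M.η t * (δ * (n' t - 1)))) 0 M.T :=
    (HasAEDeriv.of_eq_integral hT.le hb (fun t _ => by simp; rw [hn'])).exp
  have hD := h'.dW.sub h.dW
  have hΔ := h'.dX.sub h.dX
  have hpos : ∀ t ∈ Icc 0 M.T, 0 < W' t - W t := by
    by_contra! hneg
    obtain ⟨s, hs, hs0, hbef⟩ := exists_first_zero hD.continuousOn (by linarith) hneg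
    have hΔs := (hΔ.mono le_rfl hs.1.le hs.2).antitoneOn (Eventually.of_forall fun t ht => by
      have h1 := hbef t (Ioo_subset_Ico_self ht)
      have h2 := inv_pos.2 (hM.η_pos t ⟨ht.1.le, ht.2.le.trans hs.2⟩)
      nlinarith [mul_pos h2 h1])
    have hfs := (((hM.fFun_deriv hz hμ').sub (hM.fFun_deriv hz hμ)).mono le_rfl hs.1.le
      hs.2).monotoneOn (Eventually.of_forall fun t ht => by
        have htI : t ∈ Icc 0 M.T := ⟨ht.1.le, ht.2.le.trans hs.2⟩
        have h1 := hbef t (Ioo_subset_Ico_self ht)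
        have h2 := hM.η_pos t htI
        have h3 := hM.κ_nonneg t htI
        have h4 := hM.fund_pos hz.homog hz.z_zero hz.y_zero t ⟨ht.1, htI.2⟩
        have h5 := M.discount_pos δ t
        have : M.κ t * (W' t / M.η t) * (z t * M.discount δ t) -
          M.κ t * (W t / M.η t) * (z t * M.discount δ t) =
            M.κ t * ((W' t - W t) / M.η t) * (z t * M.discount δ t) := by ring
        rw [this]
        positivity)
    -- The higher level function reaches each positive $x_j$ no later, so departures happen no
    -- later.
    have hcount : ∀ t ∈ Ioo 0 s, n' t ≤ n t := by
      intro t ht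
      refine Finset.sum_le_sum fun j _ => ?_
      by_cases h1 : t ∈ Iic (M.liqTime δ (x j) fun s => W' s / M.η s)
      swap
      · rw [indicator_of_notMem h1]
        exact indicator_nonneg (fun _ _ => zero_le_one) _
      have h2 : t ∈ Iic (M.liqTime δ (x j) fun s => W s / M.η s) := by
        rcases lt_trichotomy (x j) 0 with hxj | hxj | hxj
        · rw [hM.liqTime_eq_T hμ hμ0 hxj]; exact ht.2.le.trans hs.2
        · rw [hxj, hM.liqTime_zero] at h1
          exact absurd h1 (not_le.2 ht.1)
        · by_contra! h2
          rw [mem_Iic, not_le] at h2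
          have hm := hM.liqTime_mem (δ := δ) (x j) fun s => W s / M.η s
          have h3 := hM.fFun_liqTime hμ (h2.trans (ht.2.trans_le hs.2))
          have h4 := hM.fFun_lt hμ' hxj ⟨hm.1, h2.trans_le h1⟩
          have h5 := hfs (left_mem_Icc.2 hs.1.le) ⟨hm.1, (h2.trans ht.2).le⟩ hm.1
          simp only [fFun_zero, sub_zero] at h5
          linarith
      rw [indicator_of_mem h1, indicator_of_mem h2]
    -- After removing the linear damping by $E$, what remains is
    -- $(\lambda+\delta\dot\kappa)(X-X')+\frac{\kappa}{\eta}\delta(n-n')W\ge0$. The gap is thus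
    -- bounded below by a positive multiple of its initial value, so it has no first zero.
    have hDE := ((hD.mul hE).mono le_rfl hs.1.le hs.2).monotoneOn (by
      filter_upwards [hM.lam_add_nonneg] with t hc ht
      have htI : t ∈ Icc 0 M.T := ⟨ht.1.le, ht.2.le.trans hs.2⟩
      have h1 := hΔs (left_mem_Icc.2 hs.1.le) (Ioo_subset_Icc_self ht) ht.1.le
      simp only [h.zero, h'.zero, sub_self] at h1
      have h2 := hcount t ht
      have h3 := hW0 t htI
      have h4 := div_nonneg (hM.κ_nonneg t htI) (hM.η_pos t htI).le
      have h5 : 0 < E t := Real.exp_pos _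
      have h6 := hc htI
      have h7 := mul_nonneg (mul_nonneg h4 (mul_nonneg hM.δ_nonneg (sub_nonneg.2 h2))) h3
      have h8 := mul_nonneg h6 (neg_nonneg.2 h1)
      have h9 := mul_nonneg (add_nonneg h7 h8) h5.le
      refine h9.trans (le_of_eq ?_)
      ring)
    have := hDE (left_mem_Icc.2 hs.1.le) (right_mem_Icc.2 hs.1.le) hs.1.le
    simp only [hs0, zero_mul, hEdef, intervalIntegral.integral_same, Real.exp_zero, mul_one] at this
    linarith
  have hz0 := hΔ.neg.ae_eq_zero (Eventually.of_forall fun t ht => by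
      have h1 := hpos t (Ioo_subset_Icc_self ht)
      have h2 := inv_pos.2 (hM.η_pos t (Ioo_subset_Icc_self ht))
      nlinarith [mul_pos h2 h1]) (by
    simp [h.zero, h'.zero, h.terminal, h'.terminal])
  refine not_ae_false_Ioo hT ?_
  filter_upwards [hz0] with t h0 ht
  have h1 := hpos t (Ioo_subset_Icc_self ht)
  have h2 := inv_pos.2 (hM.η_pos t (Ioo_subset_Icc_self ht))
  nlinarith [mul_pos h2 h1, h0 ht]

/-- Once the initial rates agree, both solutions are shots of the same Lipschitz system with the
same initial data: the time $t_0$, and with it $r$, depends only on the initial positions. -/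
theorem aggregate_unique (hδN : δ * N ≤ 1) {x : Fin N → ℝ} {X W X' W' : ℝ → ℝ}
    (h : M.IsAggregate δ x X W) (h' : M.IsAggregate δ x X' W') (hx : 0 ≤ δ * ∑ j, x j) :
    ∀ t ∈ Icc 0 M.T, W t = W' t := by
  have h0 : W 0 = W' 0 :=
    le_antisymm (hM.aggregate_initial_le h' h hx) (hM.aggregate_initial_le h h' hx)
  obtain ⟨z, y, hz⟩ := hM.exists_fund
  obtain ⟨t₀, ht₀, hb⟩ := hM.exists_time_bound x hx
  obtain ⟨B, e₀, r, ρ, D, hr⟩ := hM.exists_shootingData hz hδN x ht₀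
  have key : ∀ {X W : ℝ → ℝ}, M.IsAggregate δ x X W → ∀ j, 0 < x j →
      t₀ ≤ M.liqTime δ (x j) fun s => W s / M.η s := fun {X W} h =>
    hb _ (hM.aggregate_rate_integrable h.dW.continuousOn)
      (hM.aggregate_rate_nonneg fun t ht => (hM.aggregate_sign h hx t ht).1)
      (by rw [aggregate_rate_integral h.dX h.terminal, h.zero])
  have h1 := hM.aggregate_isShot hz D.r_deriv hr h hx (key h)
  have h2 := hM.aggregate_isShot hz D.r_deriv hr h' hx (key h')
  intro t ht
  obtain ⟨-, hV, hf⟩ := D.shot_unique h1 h2 (by rw [h.zero, h'.zero])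
    (by simp only [fFun_zero, overshoot_zero, h0]) (by simp only [fFun_zero]) t ht
  rw [hf] at hV
  exact sub_left_injective hV

end Regular

end Market

end Liquidation

/-! ### Equilibrium flows and the fixed-point equation. -/

namespace Liquidation

namespace Market

variable {M : Market} {δ : ℝ} {N : ℕ}

/-- Individual flows, stopped at the times `τ`, whose weighted total rate is the driver `μ`. -/
structure IsEquilibriumFlow (M : Market) (δ : ℝ) (x τ : Fin N → ℝ) (μ : ℝ → ℝ)
    (X Y : Fin N → ℝ → ℝ) : Prop where
  τ_mem : ∀ j, τ j ∈ Icc 0 M.T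
  flow : ∀ j, M.IsFlow δ (τ j) (x j) μ (X j) (Y j)
  integrable : IntervalIntegrable μ volume 0 M.T
  avg : ∀ᵐ t, t ∈ Icc 0 M.T → μ t = δ * ∑ j, (Y j t - δ * M.κ t * X j t) / M.η t

theorem IsEquilibriumFlow.neg {x τ : Fin N → ℝ} {μ : ℝ → ℝ} {X Y : Fin N → ℝ → ℝ}
    (h : M.IsEquilibriumFlow δ x τ μ X Y) :
    M.IsEquilibriumFlow δ (fun j => -x j) τ (fun t => -μ t) (fun j t => -X j t)
      (fun j t => -Y j t) := by
  refine ⟨h.τ_mem, fun j => (h.flow j).neg, h.integrable.neg, ?_⟩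
  filter_upwards [h.avg] with t ht htm
  rw [ht htm, ← mul_neg, ← Finset.sum_neg_distrib]
  congr 1
  exact Finset.sum_congr rfl fun j _ => by ring

namespace Regular

variable (hM : M.Regular δ)
include hM

theorem flow_weighted_rate_deriv {τ x : ℝ} {μ X Y : ℝ → ℝ} (hτ : τ ∈ Icc 0 M.T)
    (h : M.IsFlow δ τ x μ X Y) :
    HasAEDeriv (fun t => Y t - δ * M.κ t * X t)
      (fun t => -((M.lam t + δ * derivWithin M.κ (Icc 0 M.T) t) * X t) -
        M.κ t * (Iic τ).indicator (fun _ => (1 : ℝ)) t * μ t +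
          δ * M.κ t / M.η t * (Y t - δ * M.κ t * X t)) 0 M.T := by
  refine ((h.dY' hτ).sub ((hM.κ_deriv.const_mul δ).mul (h.dX' hτ))).congr_deriv' fun t _ => ?_
  by_cases ht : t ∈ Iic τ
  · rw [indicator_of_mem ht, indicator_of_mem ht]; ring
  · rw [indicator_of_notMem ht, indicator_of_notMem ht]; ring

theorem total_deriv {x τ : Fin N → ℝ} {μ : ℝ → ℝ} {X Y : Fin N → ℝ → ℝ}
    (hτ : ∀ j, τ j ∈ Icc 0 M.T) (h : ∀ j, M.IsFlow δ (τ j) (x j) μ (X j) (Y j)) :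
    HasAEDeriv (fun t => δ * ∑ j, X j t)
      (fun t => -((M.η t)⁻¹ * (δ * ∑ j, (Y j t - δ * M.κ t * X j t)))) 0 M.T ∧
    HasAEDeriv (fun t => δ * ∑ j, (Y j t - δ * M.κ t * X j t))
      (fun t => -((M.lam t + δ * derivWithin M.κ (Icc 0 M.T) t) * (δ * ∑ j, X j t)) -
        M.κ t * (δ * activeCount τ t) * μ t +
          δ * M.κ t / M.η t * (δ * ∑ j, (Y j t - δ * M.κ t * X j t))) 0 M.T := by
  constructor
  · refine ((HasAEDeriv.sum Finset.univ hM.T_pos.le fun j _ => (h j).dX' (hτ j)).const_mul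
      δ).congr_deriv' fun t _ => ?_
    rw [Finset.sum_neg_distrib, ← Finset.sum_div]
    ring
  · refine ((HasAEDeriv.sum Finset.univ hM.T_pos.le fun j _ =>
      hM.flow_weighted_rate_deriv (hτ j) (h j)).const_mul δ).congr_deriv' fun t _ => ?_
    simp only [activeCount, Finset.mul_sum, Finset.sum_mul, ← Finset.sum_neg_distrib,
      ← Finset.sum_sub_distrib, ← Finset.sum_add_distrib]
    exact Finset.sum_congr rfl fun j _ => by ring

omit hM in
theorem total_rate_eq {t : ℝ} (X Y : Fin N → ℝ → ℝ) :
    δ * ∑ j, (Y j t - δ * M.κ t * X j t) / M.η t =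
      (δ * ∑ j, (Y j t - δ * M.κ t * X j t)) / M.η t := by
  rw [← Finset.sum_div, mul_div_assoc]

variable {x τ : Fin N → ℝ} {μ μ' : ℝ → ℝ} {X Y X' Y' : Fin N → ℝ → ℝ}

/-- Inserting $\mu=W/\eta$ closes the aggregate equation; the $-1$ next to the active count comes
from the own-impact term $\delta\kappa X^j$ in each rate. -/
theorem equilibrium_deriv (h : M.IsEquilibriumFlow δ x τ μ X Y) :
    HasAEDeriv (fun t => δ * ∑ j, (Y j t - δ * M.κ t * X j t))
      (fun t => -((M.lam t + δ * derivWithin M.κ (Icc 0 M.T) t) * (δ * ∑ j, X j t)) -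
        M.κ t / M.η t * (δ * (activeCount τ t - 1)) *
          (δ * ∑ j, (Y j t - δ * M.κ t * X j t))) 0 M.T := by
  refine (hM.total_deriv h.τ_mem h.flow).2.congr_deriv ?_
  filter_upwards [h.avg] with t ht htm
  rw [ht (Ioo_subset_Icc_self htm), total_rate_eq]
  ring

omit hM in
theorem total_terminal (h : ∀ j, M.IsFlow δ (τ j) (x j) μ (X j) (Y j)) :
    δ * ∑ j, X j M.T = 0 := by
  simp [(h _).terminal]

/-- The stopping times are arbitrary here: the energy estimate needs no information on the damping
coefficient beyond integrability. The sign is thus available before the times are identified. -/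
theorem equilibrium_rate_nonneg (h : M.IsEquilibriumFlow δ x τ μ X Y)
    (hx : 0 ≤ δ * ∑ j, x j) : ∀ᵐ t, t ∈ Icc 0 M.T → 0 ≤ μ t := by
  have hs := energy_sign (hM.total_deriv h.τ_mem h.flow).1 (hM.equilibrium_deriv h)
    (hM.activeCount_integrable _) (hM.η_inv_pos le_rfl le_rfl)
    (hM.lam_add_nonneg' le_rfl le_rfl) (total_terminal h.flow)
    (by simpa only [(h.flow _).zero] using hx) hM.T_pos
  filter_upwards [h.avg] with t ht htm
  rw [ht htm, total_rate_eq]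
  exact div_nonneg (hs t htm).1 (hM.η_pos t htm).le

theorem equilibrium_rate_sign (h : M.IsEquilibriumFlow δ x τ μ X Y) :
    (∀ᵐ t, t ∈ Icc 0 M.T → μ t ≤ 0) ∨ ∀ᵐ t, t ∈ Icc 0 M.T → 0 ≤ μ t := by
  rcases le_total 0 (δ * ∑ j, x j) with hx | hx
  · exact Or.inr (hM.equilibrium_rate_nonneg h hx)
  · refine Or.inl (Eventually.mono (hM.equilibrium_rate_nonneg h.neg ?_) fun t ht htm => ?_)
    · rw [Finset.sum_neg_distrib]; linarith
    · linarith [ht htm]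

theorem equilibrium_isAggregate
    (h : M.IsEquilibriumFlow δ x (fun j => M.liqTime δ (x j) μ) μ X Y) :
    M.IsAggregate δ x (fun t => δ * ∑ j, X j t)
      (fun t => δ * ∑ j, (Y j t - δ * M.κ t * X j t)) := by
  refine ⟨by simp only [(h.flow _).zero], (hM.total_deriv h.τ_mem h.flow).1, ?_,
    total_terminal h.flow⟩
  -- The aggregate equation uses the times of $W/\eta$, which equals $\mu$ only a.e.; candidate
  -- times see only the a.e. class.
  convert hM.equilibrium_deriv h using 9 with t j
  refine (liqTime_congr ?_ _).symm
  filter_upwards [h.avg] with t ht htm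
  rw [ht htm, total_rate_eq]

theorem equilibrium_unique (hδN : δ * N ≤ 1)
    (h : M.IsEquilibriumFlow δ x (fun j => M.liqTime δ (x j) μ) μ X Y)
    (h' : M.IsEquilibriumFlow δ x (fun j => M.liqTime δ (x j) μ') μ' X' Y') :
    ∀ᵐ t, t ∈ Icc 0 M.T → μ t = μ' t := by
  -- Reflection of all positions and rates preserves the liquidation times.
  wlog hx : 0 ≤ δ * ∑ j, x j generalizing x μ μ' X Y X' Y'
  · have e : ∀ ν : ℝ → ℝ, (fun j => M.liqTime δ (x j) ν) =
        fun j => M.liqTime δ (-x j) fun t => -ν t := fun ν => by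
      funext j; exact (liqTime_neg _ _).symm
    have hn := h.neg
    have hn' := h'.neg
    rw [e] at hn hn'
    refine (this hn hn' ?_).mono fun t ht htm => neg_inj.1 (ht htm)
    rw [Finset.sum_neg_distrib]; linarith
  · have hu := hM.aggregate_unique hδN (hM.equilibrium_isAggregate h)
      (hM.equilibrium_isAggregate h') hx
    filter_upwards [h.avg, h'.avg] with t h1 h2 htm
    rw [h1 htm, h2 htm, total_rate_eq, total_rate_eq, hu t htm]

/-- An aggregate solution supplies the driver $\mu=W/\eta$, for which the individual flows are
solved separately. It remains to see that their total rate reproduces $\mu$. -/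
theorem exists_equilibriumFlow (hδN : δ * N ≤ 1) (x : Fin N → ℝ) :
    ∃ μ X Y, M.IsEquilibriumFlow δ x (fun j => M.liqTime δ (x j) μ) μ X Y := by
  wlog hx : 0 ≤ δ * ∑ j, x j generalizing x
  · obtain ⟨μ, X, Y, h⟩ := this (fun j => -x j) (by rw [Finset.sum_neg_distrib]; linarith)
    refine ⟨fun t => -μ t, fun j t => -X j t, fun j t => -Y j t, ?_⟩
    have hn := h.neg
    simp only [neg_neg] at hn
    convert hn using 2 with j
    rw [← liqTime_neg]
    simp only [neg_neg]
  obtain ⟨P, W, h⟩ := hM.exists_aggregate hδN x hx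
  set μ := fun t => W t / M.η t with hμdef
  have hμ : IntervalIntegrable μ volume 0 M.T := hM.aggregate_rate_integrable h.dW.continuousOn
  choose X Y hXY using fun j => hM.exists_flow hμ (hM.liqTime_mem (δ := δ) (x j) μ)
    (hM.fFun_liqTime hμ)
  refine ⟨μ, X, Y, fun j => hM.liqTime_mem _ _, hXY, hμ, Eventually.of_forall fun t ht => ?_⟩
  obtain ⟨hX, hW⟩ := hM.total_deriv (fun j => hM.liqTime_mem (x j) μ) hXY
  -- With the same driver and the same stopping times, the active-count terms cancel in the
  -- difference of the two aggregates. A homogeneous problem with zero position at both ends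
  -- remains, and it is trivial by the energy argument.
  have hX' := (hX.sub h.dX).congr_deriv' (g := fun t => -((M.η t)⁻¹ *
    (δ * ∑ j, (Y j t - δ * M.κ t * X j t) - W t))) fun t _ => by ring
  have hW' := (hW.sub h.dW).congr_deriv' (g := fun t =>
    -((M.lam t + δ * derivWithin M.κ (Icc 0 M.T) t) * (δ * ∑ j, X j t - P t)) -
      -(δ * M.κ t / M.η t) * (δ * ∑ j, (Y j t - δ * M.κ t * X j t) - W t)) fun t _ => by
    simp only [hμdef]; ring
  have h0 := energy_eq_zero hX' hW' (hM.neg_δκη_integrable hM.T_pos.le le_rfl)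
    (hM.η_inv_pos le_rfl le_rfl) (hM.lam_add_nonneg' le_rfl le_rfl)
    (by rw [total_terminal hXY, h.terminal, sub_zero]) ⟨le_rfl, hM.T_pos⟩
    (by simp only [(hXY _).zero, h.zero, sub_self, zero_mul, le_refl]) t ht
  rw [total_rate_eq, sub_eq_zero.1 h0.2]

theorem fbSolution_spec (hμ : IntervalIntegrable μ volume 0 M.T) (x : ℝ) :
    M.IsFlow δ (M.liqTime δ x μ) x μ (M.fbSolution δ x μ).1 (M.fbSolution δ x μ).2 := by
  obtain ⟨X, Y, h⟩ := hM.exists_flow hμ (hM.liqTime_mem (δ := δ) x μ) (hM.fFun_liqTime hμ)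
  have hex : ∃ p : (ℝ → ℝ) × (ℝ → ℝ), M.IsFBSolution δ x μ p.1 p.2 :=
    ⟨(X, Y), (hM.isFBSolution_iff hμ).2 h⟩
  rw [fbSolution, dif_pos hex]
  exact (hM.isFBSolution_iff hμ).1 hex.choose_spec

theorem candidate_eq (hμ : IntervalIntegrable μ volume 0 M.T) {x : ℝ} {X Y : ℝ → ℝ}
    (h : M.IsFlow δ (M.liqTime δ x μ) x μ X Y) {t : ℝ} (ht : t ∈ Icc 0 M.T) :
    M.candidate δ x μ t = (Y t - δ * M.κ t * X t) / M.η t := by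
  obtain ⟨h1, h2⟩ := hM.flow_unique (hM.liqTime_mem x μ) (hM.fbSolution_spec hμ x) h t ht
  rw [candidate, h1, h2]

omit hM in
theorem fixMap_empirical (δ : ℝ) (x : Fin N → ℝ) (μ : ℝ → ℝ) (t : ℝ) :
    M.fixMap δ (empirical x) μ t = (N : ℝ)⁻¹ * ∑ j, M.candidate δ (x j) μ t := by
  rw [fixMap, empirical, integral_smul_measure, integral_finsetSum_measure]
  · simp
  · exact fun j _ => integrable_dirac (by simp)

theorem isFixedPoint_iff (hδ : δ = (N : ℝ)⁻¹) :
    M.IsFixedPoint δ (empirical x) μ ↔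
      ∃ X Y, M.IsEquilibriumFlow δ x (fun j => M.liqTime δ (x j) μ) μ X Y := by
  constructor
  · rintro ⟨hi, hfix⟩
    have hμ := (integrable_vol_iff hM.T_pos.le).1 hi
    refine ⟨_, _, fun j => hM.liqTime_mem _ _, fun j => hM.fbSolution_spec hμ (x j), hμ, ?_⟩
    filter_upwards [ae_vol_iff.1 hfix] with t ht htm
    rw [ht htm, fixMap_empirical, ← hδ]
    rfl
  · rintro ⟨X, Y, h⟩
    refine ⟨(integrable_vol_iff hM.T_pos.le).2 h.integrable, ae_vol_iff.2 ?_⟩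
    filter_upwards [h.avg] with t ht htm
    rw [ht htm, fixMap_empirical, ← hδ]
    simp only [hM.candidate_eq h.integrable (h.flow _) htm]

end Regular

end Market

end Liquidation

/-! ### Expansion of the cost and its variations. -/

namespace Liquidation

namespace Market

variable {M : Market} {δ : ℝ} {N : ℕ}

instance (M : Market) : IsFiniteMeasure M.vol := ⟨by simp [vol]⟩

/-- First variation of the cost at the strategy `ξ`, given the average rate `μ`, in direction
`d`. -/
noncomputable def firstVariation (M : Market) (δ x : ℝ) (μ ξ d : ℝ → ℝ) : ℝ :=
  ∫ t in (0 : ℝ)..M.T, ((M.η t * ξ t + δ * M.κ t * position x ξ t) * d t +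
    (M.lam t * position x ξ t + M.κ t * μ t) * position 0 d t)

/-- Second variation of the cost in direction `d`. -/
noncomputable def secondVariation (M : Market) (δ : ℝ) (d : ℝ → ℝ) : ℝ :=
  ∫ t in (0 : ℝ)..M.T, ((1 / 2) * M.η t * d t ^ 2 + δ * M.κ t * d t * position 0 d t +
    (1 / 2) * M.lam t * position 0 d t ^ 2)

/-- The gradient of the cost with respect to the rate, up to an additive constant. -/
noncomputable def costate (M : Market) (δ x : ℝ) (μ ξ : ℝ → ℝ) (t : ℝ) : ℝ :=
  M.η t * ξ t + (δ * M.κ t * position x ξ t +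
    ∫ s in (0 : ℝ)..t, (M.lam s * position x ξ s + M.κ s * μ s))

theorem position_start (x : ℝ) (ξ : ℝ → ℝ) : position x ξ 0 = x := by simp [position]

theorem position_mul (s : ℝ) (d : ℝ → ℝ) (t : ℝ) :
    position 0 (fun r => s * d r) t = s * position 0 d t := by
  simp [position, intervalIntegral.integral_const_mul]

theorem position_neg (x : ℝ) (ξ : ℝ → ℝ) (t : ℝ) :
    position (-x) (fun s => -ξ s) t = -position x ξ t := by
  rw [position, position, intervalIntegral.integral_neg]; ring

theorem firstVariation_mul (x s : ℝ) (μ ξ d : ℝ → ℝ) :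
    M.firstVariation δ x μ ξ (fun t => s * d t) = s * M.firstVariation δ x μ ξ d := by
  rw [firstVariation, firstVariation, ← intervalIntegral.integral_const_mul]
  congr 1; funext t; rw [position_mul]; ring

theorem secondVariation_mul (s : ℝ) (d : ℝ → ℝ) :
    M.secondVariation δ (fun t => s * d t) = s ^ 2 * M.secondVariation δ d := by
  rw [secondVariation, secondVariation, ← intervalIntegral.integral_const_mul]
  congr 1; funext t; rw [position_mul]; ring

theorem avgRate_update (ξ : Fin N → ℝ → ℝ) (i : Fin N) (d : ℝ → ℝ) (t : ℝ) :
    avgRate (Function.update ξ i fun t => ξ i t + d t) t = avgRate ξ t + (N : ℝ)⁻¹ * d t := by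
  have : ∀ j, Function.update ξ i (fun t => ξ i t + d t) j t =
      ξ j t + if j = i then d t else 0 := fun j => by
    by_cases h : j = i
    · subst h; simp
    · simp [h]
  simp only [avgRate, this, Finset.sum_add_distrib, Finset.sum_ite_eq', Finset.mem_univ, if_true,
    mul_add]

theorem avgRate_neg (ξ : Fin N → ℝ → ℝ) (t : ℝ) :
    avgRate (fun j t => -ξ j t) t = -avgRate ξ t := by
  simp [avgRate]

theorem cost_neg (x : ℝ) (i : Fin N) (ξ : Fin N → ℝ → ℝ) :
    M.cost (-x) i (fun j t => -ξ j t) = M.cost x i ξ := by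
  rw [cost, cost]
  congr 1; funext t; rw [position_neg, avgRate_neg]; ring

theorem Admissible.neg {x : ℝ} {ξ : ℝ → ℝ} (h : M.Admissible x ξ) :
    M.Admissible (-x) fun t => -ξ t := by
  obtain ⟨h2, τ, hτ, h3, h4⟩ := h
  refine ⟨h2.neg, τ, hτ, fun t ht => ?_, fun t ht => ?_⟩
  · rw [position_neg, abs_neg]; exact h3 t ht
  · rw [position_neg, h4 t ht, neg_zero]

theorem IsNash.neg {x : Fin N → ℝ} {ξ : Fin N → ℝ → ℝ} (h : M.IsNash x ξ) :
    M.IsNash (fun j => -x j) fun j t => -ξ j t := by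
  refine ⟨fun i => (h.1 i).neg, fun i ζ hζ => ?_⟩
  have hζ' := hζ.neg
  rw [neg_neg] at hζ'
  have := h.2 i _ hζ'
  rw [← cost_neg, ← cost_neg (x i) i (Function.update _ _ _)] at this
  refine this.trans (le_of_eq ?_)
  congr 1; funext j t
  by_cases hj : j = i
  · subst hj; simp
  · simp [hj]

namespace Regular

variable (hM : M.Regular δ)
include hM

theorem memLp_integrable {f : ℝ → ℝ} (hf : MemLp f 2 M.vol) :
    IntervalIntegrable f volume 0 M.T :=
  (integrable_vol_iff hM.T_pos.le).1 (hf.integrable (by norm_num))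

theorem memLp_mul_integrable {f g : ℝ → ℝ} (hf : MemLp f 2 M.vol) (hg : MemLp g 2 M.vol) :
    IntervalIntegrable (fun t => f t * g t) volume 0 M.T :=
  (integrable_vol_iff hM.T_pos.le).1 (hf.integrable_mul hg)

omit hM in
theorem memLp_cont_mul {f g : ℝ → ℝ} (hg : ContinuousOn g (Icc 0 M.T)) (hf : MemLp f 2 M.vol) :
    MemLp (fun t => g t * f t) 2 M.vol := by
  obtain ⟨B, hB⟩ := exists_bound_cont (M := M) hg
  refine hf.of_le_mul (c := B) ((hg.aestronglyMeasurable measurableSet_Icc).mul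
    hf.aestronglyMeasurable) (ae_vol_iff.2 (Eventually.of_forall fun t ht => ?_))
  rw [norm_mul]
  exact mul_le_mul_of_nonneg_right (hB t ht) (norm_nonneg _)

omit hM in
theorem memLp_of_cont {g : ℝ → ℝ} (hg : ContinuousOn g (Icc 0 M.T)) : MemLp g 2 M.vol := by
  simpa using memLp_cont_mul hg (memLp_const (1 : ℝ))

theorem position_deriv {ξ : ℝ → ℝ} (hξ : IntervalIntegrable ξ volume 0 M.T) (x : ℝ) :
    HasAEDeriv (position x ξ) (fun t => -ξ t) 0 M.T := by
  refine HasAEDeriv.of_eq_integral hM.T_pos.le hξ.neg fun t _ => ?_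
  rw [position_start, intervalIntegral.integral_neg, position, sub_eq_add_neg]

theorem position_add {ξ d : ℝ → ℝ} (hξ : IntervalIntegrable ξ volume 0 M.T)
    (hd : IntervalIntegrable d volume 0 M.T) (x : ℝ) {t : ℝ} (ht : t ∈ Icc 0 M.T) :
    position x (fun s => ξ s + d s) t = position x ξ t + position 0 d t := by
  have h0 : (0 : ℝ) ∈ Icc 0 M.T := left_mem_Icc.2 hM.T_pos.le
  rw [position, position, position, intervalIntegral.integral_add (hM.integrable_mono hξ h0 ht)
    (hM.integrable_mono hd h0 ht)]
  ring

omit hM in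
theorem avgRate_memLp {ξ : Fin N → ℝ → ℝ} (hξ : ∀ j, MemLp (ξ j) 2 M.vol) :
    MemLp (avgRate ξ) 2 M.vol := by
  refine MemLp.const_mul ?_ _
  exact memLp_finsetSum _ fun j _ => hξ j

theorem cost_integrable {ξ μ : ℝ → ℝ} (hξ : MemLp ξ 2 M.vol) (hμ : MemLp μ 2 M.vol) (x : ℝ) :
    IntervalIntegrable (fun t => (1 / 2) * M.η t * ξ t ^ 2 + M.κ t * μ t * position x ξ t +
      (1 / 2) * M.lam t * position x ξ t ^ 2) volume 0 M.T := by
  have hX := (hM.position_deriv (hM.memLp_integrable hξ) x).continuousOn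
  have h1 := hM.integrable_cont_mul (hM.memLp_mul_integrable hξ hξ)
    (continuousOn_const (c := (1 / 2 : ℝ)).mul hM.η_cont)
  have h2 := hM.integrable_mul_cont (hM.integrable_cont_mul (hM.memLp_integrable hμ) hM.κ_cont) hX
  have h3 := hM.integrable_mul_cont (hM.lam_integrable.const_mul (1 / 2)) (hX.pow 2)
  convert! (h1.add h2).add h3 using 1
  funext t
  simp only [Pi.mul_apply, Pi.pow_apply]
  ring

theorem firstVariation_integrable {ξ μ d : ℝ → ℝ} (hξ : MemLp ξ 2 M.vol)
    (hμ : IntervalIntegrable μ volume 0 M.T) (hd : MemLp d 2 M.vol) (x : ℝ) :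
    IntervalIntegrable (fun t => (M.η t * ξ t + δ * M.κ t * position x ξ t) * d t +
      (M.lam t * position x ξ t + M.κ t * μ t) * position 0 d t) volume 0 M.T := by
  have hX := (hM.position_deriv (hM.memLp_integrable hξ) x).continuousOn
  have hD := (hM.position_deriv (hM.memLp_integrable hd) 0).continuousOn
  have hY := (memLp_cont_mul hM.η_cont hξ).add
    (memLp_of_cont ((continuousOn_const (c := δ).mul hM.κ_cont).mul hX))
  exact (hM.memLp_mul_integrable hY hd).add (hM.integrable_mul_cont (hM.source_integrable hμ hX) hD)

theorem secondVariation_integrable {d : ℝ → ℝ} (hd : MemLp d 2 M.vol) :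
    IntervalIntegrable (fun t => (1 / 2) * M.η t * d t ^ 2 + δ * M.κ t * d t * position 0 d t +
      (1 / 2) * M.lam t * position 0 d t ^ 2) volume 0 M.T := by
  convert! hM.cost_integrable hd (hd.const_mul δ) 0 using 1
  funext t
  ring

/-- The expansion is exact. A deviation also moves the average rate by $d/N$, which produces the
own-impact terms with $\delta$ in both variations. -/
theorem cost_update (hδ : δ = (N : ℝ)⁻¹) {ξ : Fin N → ℝ → ℝ} (hξ : ∀ j, MemLp (ξ j) 2 M.vol)
    (x : ℝ) (i : Fin N) {d : ℝ → ℝ} (hd : MemLp d 2 M.vol) :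
    M.cost x i (Function.update ξ i fun t => ξ i t + d t) =
      M.cost x i ξ + M.firstVariation δ x (avgRate ξ) (ξ i) d + M.secondVariation δ d := by
  have hμ := avgRate_memLp hξ
  have h1 := hM.cost_integrable (hξ i) hμ x
  have h2 := hM.firstVariation_integrable (hξ i) (hM.memLp_integrable hμ) hd x
  rw [cost, cost, firstVariation, secondVariation, ← intervalIntegral.integral_add h1 h2,
    ← intervalIntegral.integral_add (h1.add h2) (hM.secondVariation_integrable hd)]
  refine intervalIntegral.integral_congr fun t ht => ?_
  rw [uIcc_of_le hM.T_pos.le] at ht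
  simp only [Function.update_self, avgRate_update]
  rw [hM.position_add (hM.memLp_integrable (hξ i)) (hM.memLp_integrable hd) x ht, ← hδ]
  ring

theorem secondVariation_nonneg (d : ℝ → ℝ) : 0 ≤ M.secondVariation δ d := by
  refine intervalIntegral.integral_nonneg_of_ae_restrict hM.T_pos.le ?_
  rw [EventuallyLE, ae_restrict_iff' measurableSet_Icc]
  filter_upwards [hM.lam_sub_nonneg] with t h1 ht
  have h2 := hM.η_sub_pos t ht
  have h3 := mul_nonneg hM.δ_nonneg (hM.κ_nonneg t ht)
  have h4 := mul_nonneg h2.le (sq_nonneg (d t))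
  have h5 := mul_nonneg (h1 ht) (sq_nonneg (position 0 d t))
  have h6 := mul_nonneg h3 (sq_nonneg (d t + position 0 d t))
  simp only [Pi.zero_apply]
  -- With $D$ the position of $d$, twice the integrand is
  -- $(\eta-\delta\kappa)d^2+(\lambda-\delta\kappa)D^2+\delta\kappa(d+D)^2$.
  nlinarith

theorem source_primitive_deriv {ξ μ : ℝ → ℝ} (hξ : MemLp ξ 2 M.vol)
    (hμ : IntervalIntegrable μ volume 0 M.T) (x : ℝ) :
    HasAEDeriv (fun t => ∫ s in (0 : ℝ)..t, (M.lam s * position x ξ s + M.κ s * μ s))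
      (fun t => M.lam t * position x ξ t + M.κ t * μ t) 0 M.T :=
  HasAEDeriv.of_eq_integral hM.T_pos.le (hM.source_integrable hμ
    (hM.position_deriv (hM.memLp_integrable hξ) x).continuousOn) fun t _ => by simp

theorem costate_memLp {ξ μ : ℝ → ℝ} (hξ : MemLp ξ 2 M.vol)
    (hμ : IntervalIntegrable μ volume 0 M.T) (x : ℝ) : MemLp (M.costate δ x μ ξ) 2 M.vol :=
  (memLp_cont_mul hM.η_cont hξ).add (memLp_of_cont (((continuousOn_const.mul hM.κ_cont).mul
    (hM.position_deriv (hM.memLp_integrable hξ) x).continuousOn).add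
      (hM.source_primitive_deriv hξ hμ x).continuousOn))

/-- Integration by parts moves the source term onto $d=-D'$; the boundary terms vanish as $D$ is
zero at both ends. -/
theorem firstVariation_eq {ξ μ d : ℝ → ℝ} (hξ : MemLp ξ 2 M.vol)
    (hμ : IntervalIntegrable μ volume 0 M.T) (hd : MemLp d 2 M.vol) (x : ℝ)
    (hD : position 0 d M.T = 0) :
    M.firstVariation δ x μ ξ d = ∫ t in (0 : ℝ)..M.T, M.costate δ x μ ξ t * d t := by
  have h := (hM.source_primitive_deriv hξ hμ x).mul (hM.position_deriv (hM.memLp_integrable hd) 0)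
  have h0 := h.integral_eq
  rw [hD, position_start, mul_zero, mul_zero, sub_zero] at h0
  have h1 := intervalIntegral.integral_add
    (hM.memLp_mul_integrable (hM.costate_memLp hξ hμ x) hd) h.intervalIntegrable
  rw [h0, add_zero] at h1
  rw [← h1, firstVariation]
  congr 1; funext t; rw [costate]; ring

/-- In an equilibrium the first variation is nonnegative in admissible directions. -/
theorem nash_firstVariation_nonneg (hδ : δ = (N : ℝ)⁻¹) {x : Fin N → ℝ} {ξ : Fin N → ℝ → ℝ}
    (h : M.IsNash x ξ) (i : Fin N) {d : ℝ → ℝ} (hd : MemLp d 2 M.vol) {s₀ : ℝ} (hs₀ : 0 < s₀)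
    (hadm : ∀ s ∈ Ioc 0 s₀, M.Admissible (x i) fun t => ξ i t + s * d t) :
    0 ≤ M.firstVariation δ (x i) (avgRate ξ) (ξ i) d := by
  set L := M.firstVariation δ (x i) (avgRate ξ) (ξ i) d with hL
  set Q := M.secondVariation δ d with hQ
  have hQ0 : 0 ≤ Q := hM.secondVariation_nonneg d
  by_contra! hneg
  -- For this step size $sQ\le-L/2$ in the cost increment $s(L+sQ)$, so a negative $L$ would give a
  -- profitable deviation.
  set s := min s₀ (-L / (2 * (Q + 1)))
  have hs : 0 < s := lt_min hs₀ (div_pos (by linarith) (by linarith))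
  have h1 := h.2 i _ (hadm s ⟨hs, min_le_left _ _⟩)
  rw [hM.cost_update hδ (fun j => (h.1 j).1) (x i) i (hd.const_mul s), firstVariation_mul,
    secondVariation_mul, ← hL, ← hQ] at h1
  have h2 : s * (2 * (Q + 1)) ≤ -L := by
    rw [← le_div_iff₀ (by linarith)]; exact min_le_right _ _
  nlinarith [mul_nonneg hs.le hQ0]

end Regular

end Market

end Liquidation

/-! ### Necessary conditions: equilibrium strategies are stopped flows. -/

namespace Liquidation

namespace Market

variable {M : Market} {δ : ℝ} {N : ℕ}

namespace Regular

variable (hM : M.Regular δ)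
include hM

theorem rate_ae_zero {ξ : ℝ → ℝ} {x a b : ℝ} (hξ : IntervalIntegrable ξ volume 0 M.T)
    (ha : 0 ≤ a) (hab : a ≤ b) (hb : b ≤ M.T) (h : ∀ t ∈ Icc a b, position x ξ t = 0) :
    ∀ᵐ t, t ∈ Ioo a b → ξ t = 0 := by
  have h1 := (HasAEDeriv.const hab 0).congr h
  filter_upwards [((hM.position_deriv hξ x).mono ha hab hb).deriv, h1.deriv] with t h2 h3 ht
  linarith [(h2 ht).unique (h3 ht)]

/-- The costate of an equilibrium strategy is constant as long as the position is not closed. -/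
theorem nash_costate_const_of_lt (hδ : δ = (N : ℝ)⁻¹) {x : Fin N → ℝ} {ξ : Fin N → ℝ → ℝ}
    (h : M.IsNash x ξ) (i : Fin N) {τ b : ℝ} (hb : b ∈ Ioo 0 τ) (hτ : τ ≤ M.T)
    (hne : ∀ t ∈ Ico 0 τ, 0 < |position (x i) (ξ i) t|)
    (hz : ∀ t ∈ Icc τ M.T, position (x i) (ξ i) t = 0) :
    ∃ g, ∀ᵐ t, t ∈ Ioo 0 b → M.costate δ (x i) (avgRate ξ) (ξ i) t = g := by
  have hξ := (h.1 i).1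
  have hμ := hM.memLp_integrable (avgRate_memLp fun j => (h.1 j).1)
  set G := M.costate δ (x i) (avgRate ξ) (ξ i) with hG
  have hG2 : MemLp G 2 M.vol := hM.costate_memLp hξ hμ (x i)
  have hbT : b ≤ M.T := hb.2.le.trans hτ
  have hT := hM.T_pos
  -- The direction is the deviation of the costate from its mean on $[0,b]$. It integrates to zero,
  -- so the position is unchanged after $b$, and the first variation becomes $-\int d^2$.
  set m := (∫ t in (0 : ℝ)..b, G t) / b with hm
  set d := (Iic b).indicator fun t => m - G t with hd
  have hd2 : MemLp d 2 M.vol := ((memLp_const m).sub hG2).indicator measurableSet_Iic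
  have hdi := hM.memLp_integrable hd2
  have hD := hM.position_deriv hdi 0
  have hDb : position 0 d b = 0 := by
    have h1 : ∫ t in (0 : ℝ)..b, d t = ∫ t in (0 : ℝ)..b, (m - G t) := by
      refine intervalIntegral.integral_congr fun t ht => ?_
      rw [uIcc_of_le hb.1.le] at ht
      exact indicator_of_mem (show t ∈ Iic b from ht.2) _
    rw [position, h1, intervalIntegral.integral_sub intervalIntegrable_const
      (hM.integrable_mono (hM.memLp_integrable hG2) (left_mem_Icc.2 hT.le) ⟨hb.1.le, hbT⟩),
      intervalIntegral.integral_const, hm, smul_eq_mul]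
    have := hb.1.ne'
    field_simp
    ring
  have hDz : ∀ t ∈ Icc b M.T, position 0 d t = 0 :=
    ((hD.mono hb.1.le hbT le_rfl).congr_deriv' (g := fun _ => 0) fun t ht => by
      rw [hd, indicator_of_notMem (show t ∉ Iic b from not_le.2 ht.1), neg_zero]).eqOn
        (HasAEDeriv.const hbT 0) hDb
  have hXc : ContinuousOn (position (x i) (ξ i)) (Icc 0 M.T) :=
    (hM.position_deriv (hM.memLp_integrable hξ) _).continuousOn
  obtain ⟨C, hC⟩ := exists_bound_cont (M := M) hD.continuousOn
  have hC0 : 0 ≤ C := (abs_nonneg _).trans (hC 0 (left_mem_Icc.2 hT.le))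
  -- Since $b<\tau$, the position is bounded away from $0$ on $[0,b]$, and a step of size at most
  -- $\varepsilon/(C+1)$ cannot create an earlier zero.
  obtain ⟨r, hr, hmin⟩ := isCompact_Icc.exists_isMinOn (nonempty_Icc.2 hb.1.le)
    (hXc.mono (Icc_subset_Icc_right hbT)).abs
  have hε : 0 < |position (x i) (ξ i) r| := hne r ⟨hr.1, hr.2.trans_lt hb.2⟩
  set ε := |position (x i) (ξ i) r|
  have hL := hM.nash_firstVariation_nonneg hδ h i hd2 (s₀ := ε / (C + 1)) (by positivity)
    fun s hs => by
    have hpos : ∀ t ∈ Icc 0 M.T, position (x i) (fun t => ξ i t + s * d t) t =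
        position (x i) (ξ i) t + s * position 0 d t := fun t ht => by
      rw [hM.position_add (hM.memLp_integrable hξ) (hdi.const_mul s) _ ht, position_mul]
    refine ⟨hξ.add (hd2.const_mul s), τ, ⟨hb.1.le.trans hb.2.le, hτ⟩, fun t ht => ?_,
      fun t ht => ?_⟩
    · rw [hpos t ⟨ht.1, ht.2.le.trans hτ⟩]
      rcases le_total t b with htb | htb
      · have h1 : ε ≤ |position (x i) (ξ i) t| := hmin ⟨ht.1, htb⟩
        have h2 := hC t ⟨ht.1, htb.trans hbT⟩
        have h3 : s * (C + 1) ≤ ε := by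
          rw [← le_div_iff₀ (by linarith)]; exact hs.2
        have h4 : |s * position 0 d t| < ε := by
          rw [abs_mul, abs_of_pos hs.1]
          nlinarith [mul_le_mul_of_nonneg_left h2 hs.1.le, hs.1]
        have h5 := abs_sub_abs_le_abs_sub (position (x i) (ξ i) t) (-(s * position 0 d t))
        rw [abs_neg, sub_neg_eq_add] at h5
        linarith
      · rw [hDz t ⟨htb, ht.2.le.trans hτ⟩, mul_zero, add_zero]
        exact hne t ht
    · rw [hpos t ⟨hb.1.le.trans (hb.2.le.trans ht.1), ht.2⟩, hz t ht,
        hDz t ⟨hb.2.le.trans ht.1, ht.2⟩, mul_zero, add_zero]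
  have hDT := hDz M.T ⟨hbT, le_rfl⟩
  have hd0 : ∫ t in (0 : ℝ)..M.T, d t = 0 := by
    rw [position] at hDT; linarith
  have hdd := hM.memLp_mul_integrable hd2 hd2
  rw [hM.firstVariation_eq hξ hμ hd2 _ hDT, ← hG,
    show (fun t => G t * d t) = fun t => m * d t - d t * d t from by
      funext t
      by_cases ht : t ∈ Iic b
      · rw [hd, indicator_of_mem ht]; ring
      · rw [hd, indicator_of_notMem ht]; ring,
    intervalIntegral.integral_sub (hdi.const_mul m) hdd, intervalIntegral.integral_const_mul, hd0,
    mul_zero, zero_sub] at hL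
  have hF := HasAEDeriv.of_eq_integral (F := fun t => ∫ s in (0 : ℝ)..t, d s * d s) hT.le hdd
    fun t _ => by simp
  have h0 := hF.ae_eq_zero (Eventually.of_forall fun t _ => mul_self_nonneg _) (by
    simpa using hL)
  refine ⟨m, ?_⟩
  filter_upwards [h0] with t ht htm
  have h1 := mul_self_eq_zero.1 (ht ⟨htm.1, htm.2.trans_le hbT⟩)
  rw [hd, indicator_of_mem (show t ∈ Iic b from htm.2.le)] at h1
  linarith

/-- The constants obtained for $b\uparrow\tau$ agree, since all the intervals contain $(0,\tau/2)$.
-/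
theorem nash_costate_const (hδ : δ = (N : ℝ)⁻¹) {x : Fin N → ℝ} {ξ : Fin N → ℝ → ℝ}
    (h : M.IsNash x ξ) (i : Fin N) {τ : ℝ} (h0 : 0 < τ) (hτ : τ ≤ M.T)
    (hne : ∀ t ∈ Ico 0 τ, 0 < |position (x i) (ξ i) t|)
    (hz : ∀ t ∈ Icc τ M.T, position (x i) (ξ i) t = 0) :
    ∃ g, ∀ᵐ t, t ∈ Ioo 0 τ → M.costate δ (x i) (avgRate ξ) (ξ i) t = g := by
  set G := M.costate δ (x i) (avgRate ξ) (ξ i)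
  have key : ∀ b ∈ Ioo 0 τ, ∃ g, ∀ᵐ t, t ∈ Ioo 0 b → G t = g := fun b hb =>
    hM.nash_costate_const_of_lt hδ h i hb hτ hne hz
  obtain ⟨g, hg⟩ := key (τ / 2) ⟨by linarith, by linarith⟩
  obtain ⟨u, -, hu, hlim⟩ := exists_seq_strictMono_tendsto' (show τ / 2 < τ by linarith)
  have hn : ∀ n, ∀ᵐ t, t ∈ Ioo 0 (u n) → G t = g := fun n => by
    obtain ⟨g', hg'⟩ := key (u n) ⟨by linarith [(hu n).1], (hu n).2⟩
    have : g' = g := by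
      by_contra hne
      refine not_ae_false_Ioo (show (0 : ℝ) < τ / 2 by linarith) ?_
      filter_upwards [hg, hg'] with t h1 h2 ht
      exact hne ((h2 ⟨ht.1, ht.2.trans (hu n).1⟩).symm.trans (h1 ht))
    rwa [this] at hg'
  refine ⟨g, ?_⟩
  filter_upwards [ae_all_iff.2 hn] with t ht htm
  obtain ⟨n, hn⟩ := (hlim.eventually (lt_mem_nhds htm.2)).exists
  exact ht n ⟨htm.1, hn⟩

/-- The tent function of height `ε` centred at `τ`. -/
theorem tent_deriv {τ ε : ℝ} (h0 : 0 < ε) (h1 : ε ≤ τ) (h2 : τ + ε ≤ M.T) (g h : ℝ) :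
    HasAEDeriv (fun t => g * (max (t - (τ - ε)) 0 - max (t - τ) 0) -
        h * (max (t - τ) 0 - max (t - (τ + ε)) 0))
      (fun t => g * ((Ioi (τ - ε)).indicator 1 t - (Ioi τ).indicator 1 t) -
        h * ((Ioi τ).indicator 1 t - (Ioi (τ + ε)).indicator 1 t)) 0 M.T := by
  have key : ∀ σ ∈ Icc 0 M.T, HasAEDeriv (fun t => max (t - σ) 0)
      (fun t => (Ioi σ).indicator (1 : ℝ → ℝ) t) 0 M.T := fun σ hσ =>
    (HasAEDeriv.of_hasDerivAt (F := fun t => t) (f := 1) hM.T_pos.le continuousOn_id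
      (fun t _ => hasDerivAt_id t) intervalIntegrable_const).pos_part hσ
      (fun t ht => ht.2) (fun _ t ht => ht.1)
  have k1 := key (τ - ε) ⟨by linarith, by linarith⟩
  have k2 := key τ ⟨by linarith, by linarith⟩
  have k3 := key (τ + ε) ⟨by linarith, by linarith⟩
  exact ((k1.sub k2).const_mul g).sub ((k2.sub k3).const_mul h)

/-- Optimality of the liquidation time against staying in the market longer. -/
theorem nash_costate_le (hδ : δ = (N : ℝ)⁻¹) {x : Fin N → ℝ} {ξ : Fin N → ℝ → ℝ}
    (h : M.IsNash x ξ) (i : Fin N) {τ g : ℝ} (h0 : 0 < τ) (hτ : τ < M.T)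
    (hpos : ∀ t ∈ Ico 0 τ, 0 < position (x i) (ξ i) t)
    (hz : ∀ t ∈ Icc τ M.T, position (x i) (ξ i) t = 0)
    (hg : ∀ᵐ t, t ∈ Ioo 0 τ → M.costate δ (x i) (avgRate ξ) (ξ i) t = g) :
    g ≤ ∫ s in (0 : ℝ)..τ, (M.lam s * position (x i) (ξ i) s + M.κ s * avgRate ξ s) := by
  have hξ := (h.1 i).1
  have hμ := hM.memLp_integrable (avgRate_memLp fun j => (h.1 j).1)
  have hT := hM.T_pos
  have hPd := hM.source_primitive_deriv hξ hμ (x i)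
  set P := fun t => ∫ s in (0 : ℝ)..t, (M.lam s * position (x i) (ξ i) s + M.κ s * avgRate ξ s)
    with hP
  change g ≤ P τ
  by_contra! hlt
  -- Assuming $P_\tau<c<g$, continuity keeps the source primitive $P$ below $c$ shortly after
  -- $\tau$.
  obtain ⟨c, hc1, hc2⟩ := exists_between hlt
  have hev : ∀ᶠ t in 𝓝 τ, P t < c :=
    (hPd.continuousOn.continuousAt (Icc_mem_nhds h0 hτ)).eventually (gt_mem_nhds hc1)
  obtain ⟨e, he, hball⟩ := Metric.eventually_nhds_iff.1 hev
  obtain ⟨ε, hε, hεm⟩ := exists_between (lt_min (half_pos he) (lt_min h0 (sub_pos.2 hτ)))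
  have hε1 : ε < e / 2 := hεm.trans_le (min_le_left _ _)
  have hε2 : ε < τ := hεm.trans_le ((min_le_right _ _).trans (min_le_left _ _))
  have hε3 : ε < M.T - τ := hεm.trans_le ((min_le_right _ _).trans (min_le_right _ _))
  -- The change of position is a tent over $(\tau-\varepsilon,\tau+\varepsilon)$. Being positive, it
  -- keeps the portfolio positive and only postpones its closing to $\tau+\varepsilon$, so the
  -- deviation is admissible.
  set D := fun t => 1 * (max (t - (τ - ε)) 0 - max (t - τ) 0) -
    1 * (max (t - τ) 0 - max (t - (τ + ε)) 0) with hD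
  set d : ℝ → ℝ := fun t => -(1 * ((Ioi (τ - ε)).indicator 1 t - (Ioi τ).indicator 1 t) -
    1 * ((Ioi τ).indicator 1 t - (Ioi (τ + ε)).indicator 1 t)) with hd
  have hDd := hM.tent_deriv hε hε2.le (by linarith) 1 1
  have hd2 : MemLp d 2 M.vol := by
    have key : ∀ σ : ℝ, MemLp (fun t => (Ioi σ).indicator (1 : ℝ → ℝ) t) 2 M.vol := fun σ =>
      (memLp_const (1 : ℝ)).indicator measurableSet_Ioi
    exact ((((key _).sub (key _)).const_mul 1).sub (((key _).sub (key _)).const_mul 1)).neg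
  have hdi := hM.memLp_integrable hd2
  have hDlow : ∀ t ≤ τ - ε, D t = 0 := fun t ht => by
    simp only [hD]
    rw [max_eq_right (by linarith), max_eq_right (by linarith), max_eq_right (by linarith)]
    ring
  have hpD : ∀ t ∈ Icc 0 M.T, position 0 d t = D t := by
    refine ((hM.position_deriv hdi 0).congr_deriv' fun t _ => ?_).eqOn hDd ?_
    · simp only [hd, neg_neg]
    · rw [position_start]; exact (hDlow 0 (by linarith)).symm
  have hDpos : ∀ t ∈ Ioo (τ - ε) (τ + ε), 0 < D t := fun t ht => by
    simp only [hD]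
    rw [max_eq_left (by linarith [ht.1]), max_eq_right (by linarith [ht.2] : t - (τ + ε) ≤ 0)]
    rcases le_total t τ with htτ | htτ
    · rw [max_eq_right (by linarith)]; linarith [ht.1]
    · rw [max_eq_left (by linarith)]; linarith [ht.2]
  have hDhigh : ∀ t, τ + ε ≤ t → D t = 0 := fun t ht => by
    simp only [hD]
    rw [max_eq_left (by linarith), max_eq_left (by linarith), max_eq_left (by linarith)]
    ring
  have hL := hM.nash_firstVariation_nonneg hδ h i hd2 one_pos fun s hs => by
    have hps : ∀ t ∈ Icc 0 M.T, position (x i) (fun t => ξ i t + s * d t) t =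
        position (x i) (ξ i) t + s * D t := fun t ht => by
      rw [hM.position_add (hM.memLp_integrable hξ) (hdi.const_mul s) _ ht, position_mul, hpD t ht]
    refine ⟨hξ.add (hd2.const_mul s), τ + ε, ⟨by linarith, by linarith⟩, fun t ht => ?_,
      fun t ht => ?_⟩
    · rw [hps t ⟨ht.1, by linarith [ht.2]⟩]
      refine abs_pos_of_pos ?_
      rcases le_or_gt t (τ - ε) with h1 | h1
      · rw [hDlow t h1, mul_zero, add_zero]
        exact hpos t ⟨ht.1, by linarith⟩
      · have h2 := mul_pos hs.1 (hDpos t ⟨h1, ht.2⟩)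
        rcases lt_or_ge t τ with h3 | h3
        · linarith [hpos t ⟨ht.1, h3⟩]
        · rw [hz t ⟨h3, by linarith [ht.2]⟩]; linarith
    · rw [hps t ⟨by linarith [ht.1], ht.2⟩, hz t ⟨by linarith [ht.1], ht.2⟩, hDhigh t ht.1]
      ring
  have hDT : position 0 d M.T = 0 := by
    rw [hpD M.T (right_mem_Icc.2 hT.le)]; exact hDhigh _ (by linarith)
  rw [hM.firstVariation_eq hξ hμ hd2 _ hDT] at hL
  set G := M.costate δ (x i) (avgRate ξ) (ξ i) with hG
  have hGd := hM.memLp_mul_integrable (hM.costate_memLp (δ := δ) hξ hμ (x i)) hd2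
  have hI := HasAEDeriv.of_eq_integral (F := fun t => ∫ s in (0 : ℝ)..t, G s * d s) hT.le hGd
    fun t _ => by simp [hG]
  -- The costate is $g$ before $\tau$ and, as $\xi=X=0$ afterwards, equals $P<c$ after $\tau$. The
  -- weighted tent thus bounds the first variation by $(c-g)\varepsilon<0$.
  have hmono := ((hM.tent_deriv hε hε2.le (by linarith) (-g) (-c)).sub hI).monotoneOn (by
    filter_upwards [hg, hM.rate_ae_zero (hM.memLp_integrable hξ) h0.le hτ.le le_rfl hz,
      compl_mem_ae_iff.2 (measure_singleton τ)] with t h1 h2 hne ht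
    have ind1 : ∀ {σ : ℝ}, σ < t → (Ioi σ).indicator (1 : ℝ → ℝ) t = 1 := fun hσ =>
      indicator_of_mem (mem_Ioi.2 hσ) _
    have ind0 : ∀ {σ : ℝ}, t ≤ σ → (Ioi σ).indicator (1 : ℝ → ℝ) t = 0 := fun hσ =>
      indicator_of_notMem (not_lt.2 hσ) _
    rcases lt_or_ge τ t with h3 | h3
    · have h4 : G t = P t := by
        rw [hG, costate, h2 ⟨h3, ht.2⟩, hz t ⟨h3.le, ht.2.le⟩, mul_zero, mul_zero, zero_add,
          zero_add]
      rcases lt_or_ge (τ + ε) t with h5 | h5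
      · simp only [hd, ind1 h3, ind1 h5, ind1 (show τ - ε < t by linarith)]
        simp
      · have h6 : P t < c := hball (by
          rw [Real.dist_eq, abs_of_pos (sub_pos.2 h3)]; linarith)
        simp only [hd, ind1 h3, ind0 h5, ind1 (show τ - ε < t by linarith)]
        linarith
    · rcases lt_or_ge (τ - ε) t with h5 | h5
      · have h6 := h1 ⟨ht.1, lt_of_le_of_ne h3 hne⟩
        simp only [hd, ind0 h3, ind1 h5, ind0 (show t ≤ τ + ε by linarith)]
        linarith
      · simp only [hd, ind0 h3, ind0 h5, ind0 (show t ≤ τ + ε by linarith)]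
        simp)
  have hfin := hmono (left_mem_Icc.2 hT.le) (right_mem_Icc.2 hT.le) hT.le
  simp only [intervalIntegral.integral_same] at hfin
  rw [max_eq_right (by linarith), max_eq_right (by linarith), max_eq_right (by linarith),
    max_eq_left (by linarith), max_eq_left (by linarith), max_eq_left (by linarith)] at hfin
  nlinarith

/-- The costate does not become negative before the position is closed. -/
theorem costate_nonneg {x τ g : ℝ} {μ ξ : ℝ → ℝ} (hξ : MemLp ξ 2 M.vol)
    (hμ : IntervalIntegrable μ volume 0 M.T) (h0 : 0 < τ) (hτ : τ < M.T)
    (hpos : ∀ t ∈ Ico 0 τ, 0 < position x ξ t) (hz : position x ξ τ = 0)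
    (hg : ∀ᵐ t, t ∈ Ioo 0 τ → M.costate δ x μ ξ t = g) :
    ∫ s in (0 : ℝ)..τ, (M.lam s * position x ξ s + M.κ s * μ s) ≤ g := by
  have hPd := hM.source_primitive_deriv hξ hμ x
  set P := fun t => ∫ s in (0 : ℝ)..t, (M.lam s * position x ξ s + M.κ s * μ s) with hP
  change P τ ≤ g
  by_contra! hlt
  have hev : ∀ᶠ t in 𝓝 τ, g < P t :=
    (hPd.continuousOn.continuousAt (Icc_mem_nhds h0 hτ)).eventually (lt_mem_nhds hlt)
  obtain ⟨e, he, hball⟩ := Metric.eventually_nhds_iff.1 hev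
  obtain ⟨ε, hε, hεm⟩ := exists_between (lt_min he h0)
  have hε1 : ε < e := hεm.trans_le (min_le_left _ _)
  have hε2 : ε < τ := hεm.trans_le (min_le_right _ _)
  have hX := (hM.position_deriv (hM.memLp_integrable hξ) x).mono (c := τ - ε) (d := τ)
    (by linarith) (by linarith) hτ.le
  -- Just before $\tau$ one has $g<P$, hence $\eta\xi=g-P-\delta\kappa X\le0$, and a positive
  -- position would not decrease to $0$.
  have hmono := hX.monotoneOn (by
    filter_upwards [hg] with t h1 ht
    have ht0 : 0 < t := by linarith [ht.1]
    have htI : t ∈ Icc 0 M.T := ⟨ht0.le, ht.2.le.trans hτ.le⟩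
    have h2 : g < P t := hball (by
      rw [Real.dist_eq, abs_sub_comm, abs_of_pos (sub_pos.2 ht.2)]; linarith [ht.1])
    have h3 := h1 ⟨ht0, ht.2⟩
    have h4 : M.costate δ x μ ξ t = M.η t * ξ t + (δ * M.κ t * position x ξ t + P t) := rfl
    have h5 := mul_nonneg (mul_nonneg hM.δ_nonneg (hM.κ_nonneg t htI)) (hpos t ⟨ht0.le, ht.2⟩).le
    have h6 : M.η t * ξ t ≤ 0 := by linarith
    linarith [nonpos_of_mul_nonpos_right h6 (hM.η_pos t htI)])
  have h1 := hmono (left_mem_Icc.2 hX.le) (right_mem_Icc.2 hX.le) hX.le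
  rw [hz] at h1
  linarith [hpos (τ - ε) ⟨by linarith, by linarith⟩]

/-- A strategy with constant costate that closes at the level of the source primitive is the rate
of a flow. -/
theorem isFlow_of_costate {x τ g : ℝ} {μ ξ : ℝ → ℝ} (hξ : MemLp ξ 2 M.vol)
    (hμ : IntervalIntegrable μ volume 0 M.T) (hτ : τ ∈ Icc 0 M.T)
    (hz : ∀ t ∈ Icc τ M.T, position x ξ t = 0)
    (hg : ∀ᵐ t, t ∈ Ioo 0 τ → M.costate δ x μ ξ t = g)
    (hgτ : τ < M.T → g = ∫ s in (0 : ℝ)..τ, (M.lam s * position x ξ s + M.κ s * μ s)) :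
    ∃ Y, M.IsFlow δ τ x μ (position x ξ) Y := by
  have hξi := hM.memLp_integrable hξ
  have hX := hM.position_deriv hξi x
  have hi := (hM.source_integrable hμ hX.continuousOn).indicator_Iic τ
  set p := (Iic τ).indicator fun s => M.lam s * position x ξ s + M.κ s * μ s with hp
  have hpP : ∀ t ∈ Icc 0 τ, ∫ s in (0 : ℝ)..t, p s =
      ∫ s in (0 : ℝ)..t, (M.lam s * position x ξ s + M.κ s * μ s) := fun t ht => by
    refine intervalIntegral.integral_congr fun s hs => ?_
    rw [uIcc_of_le ht.1] at hs
    exact indicator_of_mem (show s ∈ Iic τ from hs.2.trans ht.2) _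
  -- The adjoint is the costate constant minus the source primitive, frozen after $\tau$; the
  -- condition on $g$ is exactly its vanishing at $\tau$.
  refine ⟨fun t => g - ∫ s in (0 : ℝ)..t, p s, position_start _ _, hX.congr_deriv ?_,
    HasAEDeriv.of_eq_integral hM.T_pos.le hi.neg fun t _ => ?_, hz _ (right_mem_Icc.2 hτ.2),
    fun h => ?_⟩
  · filter_upwards [hg, hM.rate_ae_zero hξi hτ.1 hτ.2 le_rfl hz,
      compl_mem_ae_iff.2 (measure_singleton τ)] with t h1 h2 hne ht
    rcases lt_or_ge τ t with h3 | h3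
    · rw [indicator_of_notMem (show t ∉ Iic τ from not_le.2 h3), h2 ⟨h3, ht.2⟩]
    · rw [indicator_of_mem (show t ∈ Iic τ from h3), hpP t ⟨ht.1.le, h3⟩,
        ← h1 ⟨ht.1, lt_of_le_of_ne h3 hne⟩, costate]
      have := (hM.η_pos t (Ioo_subset_Icc_self ht)).ne'
      field_simp
      ring
  · rw [intervalIntegral.integral_same, intervalIntegral.integral_neg]; ring
  · rw [hpP τ ⟨hτ.1, le_rfl⟩, ← hgτ h, sub_self]

theorem admissible_pos {x : ℝ} {ξ : ℝ → ℝ} (hx : 0 < x) (hξ : MemLp ξ 2 M.vol) {τ : ℝ}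
    (hτ : τ ∈ Icc 0 M.T) (hne : ∀ t ∈ Ico 0 τ, 0 < |position x ξ t|) :
    ∀ t ∈ Ico 0 τ, 0 < position x ξ t := by
  intro t ht
  by_contra! hle
  have hc := (hM.position_deriv (hM.memLp_integrable hξ) x).continuousOn
  obtain ⟨s, hs, hs0⟩ : ∃ s ∈ Icc 0 t, position x ξ s = 0 :=
    intermediate_value_Icc' ht.1 (hc.mono (Icc_subset_Icc_right (ht.2.le.trans hτ.2)))
      ⟨hle, by rw [position_start]; exact hx.le⟩
  have := hne s ⟨hs.1, hs.2.trans_lt ht.2⟩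
  rw [hs0, abs_zero] at this
  exact lt_irrefl _ this

/-- Equilibrium strategies are flows; initially positive positions stay positive until closed. -/
theorem nash_isFlow_of_pos (hδ : δ = (N : ℝ)⁻¹) {x : Fin N → ℝ} {ξ : Fin N → ℝ → ℝ}
    (h : M.IsNash x ξ) (i : Fin N) (hx : 0 < x i) :
    ∃ τ ∈ Icc 0 M.T, ∃ Y, M.IsFlow δ τ (x i) (avgRate ξ) (position (x i) (ξ i)) Y ∧
      ∀ t ∈ Ico 0 τ, 0 < position (x i) (ξ i) t := by
  obtain ⟨hξ, τ, hτ, hne, hz⟩ := h.1 i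
  have hμ := hM.memLp_integrable (avgRate_memLp fun j => (h.1 j).1)
  have hpos := hM.admissible_pos hx hξ hτ hne
  have h0 : 0 < τ := by
    refine lt_of_le_of_ne hτ.1 fun h0 => hx.ne' ?_
    rw [← position_start (x i) (ξ i)]
    exact hz 0 ⟨h0.ge, hM.T_pos.le⟩
  obtain ⟨g, hg⟩ := hM.nash_costate_const hδ h i h0 hτ.2 hne hz
  obtain ⟨Y, hY⟩ := hM.isFlow_of_costate hξ hμ hτ hz hg fun hlt =>
    le_antisymm (hM.nash_costate_le hδ h i h0 hlt hpos hz hg)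
      (hM.costate_nonneg hξ hμ h0 hlt hpos (hz τ ⟨le_rfl, hτ.2⟩) hg)
  exact ⟨τ, hτ, Y, hY, hpos⟩

/-- The profile of an equilibrium consists of flows with the right sign. -/
theorem nash_isFlow (hδ : δ = (N : ℝ)⁻¹) {x : Fin N → ℝ} {ξ : Fin N → ℝ → ℝ}
    (h : M.IsNash x ξ) (i : Fin N) :
    ∃ τ ∈ Icc 0 M.T, ∃ Y, M.IsFlow δ τ (x i) (avgRate ξ) (position (x i) (ξ i)) Y ∧
      (0 < x i → ∀ t ∈ Ico 0 τ, 0 < position (x i) (ξ i) t) ∧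
      (x i < 0 → ∀ t ∈ Ico 0 τ, position (x i) (ξ i) t < 0) ∧ (x i = 0 → τ = 0) := by
  rcases lt_trichotomy (x i) 0 with hx | hx | hx
  · obtain ⟨τ, hτ, Y, hY, hpos⟩ := hM.nash_isFlow_of_pos hδ h.neg i (by linarith)
    have hn := hY.neg
    simp only [neg_neg, avgRate_neg, position_neg] at hn hpos
    exact ⟨τ, hτ, _, hn, fun h => absurd h (by linarith), fun _ t ht => by linarith [hpos t ht],
      fun h => absurd h hx.ne⟩
  · obtain ⟨hξ, τ, hτ, hne, hz⟩ := h.1 i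
    have hμ := hM.memLp_integrable (avgRate_memLp fun j => (h.1 j).1)
    have h0 : τ = 0 := by
      by_contra h0
      have := hne 0 ⟨le_rfl, lt_of_le_of_ne hτ.1 (Ne.symm h0)⟩
      rw [position_start, hx, abs_zero] at this
      exact lt_irrefl _ this
    -- For $x_i=0$ the position is closed at time $0$, the costate condition is void, and $g=0$ is
    -- the value compatible with dropping out at $0$.
    obtain ⟨Y, hY⟩ := hM.isFlow_of_costate (δ := δ) (g := 0) hξ hμ hτ hz
      (Eventually.of_forall fun t ht => absurd (ht.1.trans ht.2) (by rw [h0]; exact lt_irrefl _))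
      (fun _ => by rw [h0, intervalIntegral.integral_same])
    exact ⟨τ, hτ, Y, hY, fun h => absurd h (by linarith), fun h => absurd h (by linarith),
      fun _ => h0⟩
  · obtain ⟨τ, hτ, Y, hY, hpos⟩ := hM.nash_isFlow_of_pos hδ h i hx
    exact ⟨τ, hτ, Y, hY, fun _ => hpos, fun h => absurd h (by linarith),
      fun h => absurd h hx.ne'⟩

end Regular

end Market

end Liquidation

/-! ### Identification of equilibria with candidates, and sufficiency. -/

namespace Liquidation

namespace Market

variable {M : Market} {δ : ℝ} {N : ℕ}

namespace Regular

variable (hM : M.Regular δ)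
include hM

theorem flow_rate_ae {τ x : ℝ} {μ ξ Y : ℝ → ℝ} (hξ : IntervalIntegrable ξ volume 0 M.T)
    (hτ : τ ∈ Icc 0 M.T) (h : M.IsFlow δ τ x μ (position x ξ) Y) :
    ∀ᵐ t, t ∈ Icc 0 M.T → ξ t = (Y t - δ * M.κ t * position x ξ t) / M.η t := by
  refine HasAEDeriv.ae_Ioo_of_ae_Icc ?_
  filter_upwards [(h.dX' hτ).deriv, (hM.position_deriv hξ x).deriv] with t h1 h2 ht
  exact neg_inj.1 ((h2 ht).unique (h1 ht))

/-- Every equilibrium profile consists of the candidate flows driven by its average rate. -/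
theorem nash_isEquilibriumFlow (hδ : δ = (N : ℝ)⁻¹) {x : Fin N → ℝ} {ξ : Fin N → ℝ → ℝ}
    (h : M.IsNash x ξ) : ∃ Y, M.IsEquilibriumFlow δ x (fun j => M.liqTime δ (x j) (avgRate ξ))
      (avgRate ξ) (fun j => position (x j) (ξ j)) Y := by
  have hμ := hM.memLp_integrable (avgRate_memLp fun j => (h.1 j).1)
  choose τ hτ Y hY hp hn h0 using hM.nash_isFlow hδ h
  have hE : M.IsEquilibriumFlow δ x τ (avgRate ξ) (fun j => position (x j) (ξ j)) Y := by
    refine ⟨hτ, hY, hμ, ?_⟩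
    filter_upwards [ae_all_iff.2 fun j =>
      hM.flow_rate_ae (hM.memLp_integrable (h.1 j).1) (hτ j) (hY j)] with t ht htm
    rw [avgRate, hδ]
    exact congrArg _ (Finset.sum_congr rfl fun j _ => by rw [ht j htm, hδ])
  -- The sign of $\mu$ is obtained first, with the players' own closing times; only then can these
  -- be identified with first hitting times of $f_\mu$.
  have hsign := hM.equilibrium_rate_sign hE
  have hτl : τ = fun j => M.liqTime δ (x j) (avgRate ξ) := by
    funext j
    rcases lt_trichotomy (x j) 0 with hx | hx | hx
    · rw [← liqTime_neg]
      refine hM.eq_liqTime_of_pos hμ.neg (hτ j) (hY j).neg (neg_pos.2 hx)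
        (fun t ht => neg_pos.2 (hn j hx t ht)) ?_
      rcases hsign with hs | hs
      · exact Or.inr (hs.mono fun t ht htm => neg_nonneg.2 (ht htm))
      · exact Or.inl (hs.mono fun t ht htm => neg_nonpos.2 (ht htm))
    · rw [h0 j hx, hx, hM.liqTime_zero]
    · exact hM.eq_liqTime_of_pos hμ (hτ j) (hY j) hx (hp j hx) hsign
  exact ⟨Y, hτl ▸ hE⟩

theorem nash_eq_candidate (hδ : δ = (N : ℝ)⁻¹) {x : Fin N → ℝ} {ξ : Fin N → ℝ → ℝ}
    (h : M.IsNash x ξ) (i : Fin N) : ξ i =ᵐ[M.vol] M.candidate δ (x i) (avgRate ξ) := by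
  obtain ⟨Y, hE⟩ := hM.nash_isEquilibriumFlow hδ h
  refine ae_vol_iff.2 ?_
  filter_upwards [hM.flow_rate_ae (hM.memLp_integrable (h.1 i).1) (hE.τ_mem i) (hE.flow i)]
    with t ht htm
  rw [ht htm, hM.candidate_eq hE.integrable (hE.flow i) htm]

theorem candidate_congr {x : ℝ} {μ μ' : ℝ → ℝ} (hμ : IntervalIntegrable μ volume 0 M.T)
    (hμ' : IntervalIntegrable μ' volume 0 M.T) (h : ∀ᵐ t, t ∈ Icc 0 M.T → μ t = μ' t) {t : ℝ}
    (ht : t ∈ Icc 0 M.T) : M.candidate δ x μ t = M.candidate δ x μ' t := by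
  have hf := (hM.fbSolution_spec hμ x).congr_ae h
  rw [liqTime_congr h] at hf
  rw [hM.candidate_eq hμ' hf ht, candidate]

section Sufficiency

variable {x : ℝ} {μ X Y : ℝ → ℝ}

theorem flow_position (hτ : M.liqTime δ x μ ∈ Icc 0 M.T)
    (h : M.IsFlow δ (M.liqTime δ x μ) x μ X Y) :
    ∀ t ∈ Icc 0 M.T, position x (fun t => (Y t - δ * M.κ t * X t) / M.η t) t = X t :=
  (hM.position_deriv (hM.intervalIntegrable_of_cont
    (hM.rate_cont h.dX.continuousOn h.dY.continuousOn)) x).eqOn (h.dX' hτ)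
      (by rw [position_start, h.zero])

/-- Before the candidate time $f_\mu$ has not reached $x$, so `flow_pos`, or its reflection, shows
that the position has not vanished. -/
theorem flow_admissible (hμ : IntervalIntegrable μ volume 0 M.T)
    (h : M.IsFlow δ (M.liqTime δ x μ) x μ X Y) :
    M.Admissible x fun t => (Y t - δ * M.κ t * X t) / M.η t := by
  have hτ := hM.liqTime_mem (δ := δ) x μ
  refine ⟨memLp_of_cont (hM.rate_cont h.dX.continuousOn h.dY.continuousOn),
    M.liqTime δ x μ, hτ, fun t ht => ?_, fun t ht => ?_⟩
  · rw [hM.flow_position hτ h t ⟨ht.1, ht.2.le.trans hτ.2⟩, abs_pos]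
    rcases lt_trichotomy x 0 with hx | hx | hx
    · have hn := h.neg
      rw [← liqTime_neg] at hn ht
      have := hM.flow_pos hμ.neg (hM.liqTime_mem _ _) hn (neg_pos.2 hx)
        (fun t ht => hM.fFun_lt hμ.neg (neg_pos.2 hx) ht) t ht
      exact (neg_pos.1 this).ne
    · rw [hx, hM.liqTime_zero] at ht
      exact absurd (ht.1.trans_lt ht.2) (lt_irrefl _)
    · exact (hM.flow_pos hμ hτ h hx (fun t ht => hM.fFun_lt hμ hx ht) t ht).ne'
  · rw [hM.flow_position hτ h t ⟨hτ.1.trans ht.1, ht.2⟩, h.X_after hτ t ht]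

theorem admissible_nonneg {ξ : ℝ → ℝ} (h : M.Admissible x ξ) (hx : 0 ≤ x) :
    ∀ t ∈ Icc 0 M.T, 0 ≤ position x ξ t := by
  obtain ⟨hξ, σ, hσ, hne, hz⟩ := h
  intro t ht
  rcases lt_or_ge t σ with h1 | h1
  · rcases hx.eq_or_lt with h0 | h0
    · have := hne 0 ⟨le_rfl, ht.1.trans_lt h1⟩
      rw [position_start, ← h0, abs_zero] at this
      exact absurd this (lt_irrefl _)
    · exact (hM.admissible_pos h0 hξ hσ hne t ⟨ht.1, h1⟩).le
  · exact (hz t ⟨h1, ht.2⟩).ge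

omit hM in
theorem admissible_terminal {ξ : ℝ → ℝ} (h : M.Admissible x ξ) : position x ξ M.T = 0 := by
  obtain ⟨-, σ, hσ, -, hz⟩ := h
  exact hz _ (right_mem_Icc.2 hσ.2)

/-- Adding $(YD)'$ to the integrand, with $D$ the change of position, cancels everything before
$\tau$ and leaves $\kappa\mu D$ after $\tau$. For $\mu\ge0$ a player stopped early has $x\ge0$, and
an admissible competitor keeps a nonnegative position, so $D\ge0$ where $X=0$. -/
theorem flow_firstVariation_nonneg (hμ : IntervalIntegrable μ volume 0 M.T)
    (h0 : ∀ᵐ t, t ∈ Icc 0 M.T → 0 ≤ μ t) (h : M.IsFlow δ (M.liqTime δ x μ) x μ X Y)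
    {d : ℝ → ℝ} (hd : MemLp d 2 M.vol)
    (hζ : M.Admissible x fun t => (Y t - δ * M.κ t * X t) / M.η t + d t) :
    0 ≤ M.firstVariation δ x μ (fun t => (Y t - δ * M.κ t * X t) / M.η t) d := by
  have hτ := hM.liqTime_mem (δ := δ) x μ
  set τ := M.liqTime δ x μ
  set ξ := fun t => (Y t - δ * M.κ t * X t) / M.η t with hξ
  have hξ2 : MemLp ξ 2 M.vol := (hM.flow_admissible hμ h).1
  have hT := hM.T_pos
  have hpos : ∀ t ∈ Icc 0 M.T, position x (fun t => ξ t + d t) t = X t + position 0 d t :=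
    fun t ht => by
      rw [hM.position_add (hM.memLp_integrable hξ2) (hM.memLp_integrable hd) x ht,
        hM.flow_position hτ h t ht]
  have hDT : position 0 d M.T = 0 := by
    have := hpos M.T (right_mem_Icc.2 hT.le)
    rw [admissible_terminal hζ, h.terminal, zero_add] at this
    exact this.symm
  have hYD := (h.dY' hτ).mul (hM.position_deriv (hM.memLp_integrable hd) 0)
  have hI := HasAEDeriv.of_eq_integral
    (F := fun t => ∫ s in (0 : ℝ)..t, ((M.η s * ξ s + δ * M.κ s * position x ξ s) * d s +
      (M.lam s * position x ξ s + M.κ s * μ s) * position 0 d s)) hT.le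
    (hM.firstVariation_integrable hξ2 hμ hd x) fun t _ => by simp
  have hmono := (hYD.add hI).monotoneOn (by
    filter_upwards [h0] with t hμt ht
    have htI := Ioo_subset_Icc_self ht
    have hη := (hM.η_pos t htI).ne'
    have hηξ : M.η t * ξ t = Y t - δ * M.κ t * X t := by
      simp only [hξ]; field_simp
    rw [hηξ, hM.flow_position hτ h t htI]
    rcases le_or_gt t τ with h1 | h1
    · rw [indicator_of_mem (show t ∈ Iic τ from h1)]
      refine le_of_eq ?_
      ring
    · rw [indicator_of_notMem (show t ∉ Iic τ from not_le.2 h1)]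
      have hX0 : X t = 0 := h.X_after hτ t ⟨h1.le, ht.2.le⟩
      have hx : 0 ≤ x := by
        by_contra! hx
        have := hM.liqTime_eq_T (δ := δ) hμ h0 hx
        linarith [ht.2]
      have hD : 0 ≤ position 0 d t := by
        have h2 := hM.admissible_nonneg hζ hx t htI
        rwa [hpos t htI, hX0, zero_add] at h2
      have := mul_nonneg (mul_nonneg (hM.κ_nonneg t htI) (hμt htI)) hD
      refine this.trans (le_of_eq ?_)
      ring)
  have hfin := hmono (left_mem_Icc.2 hT.le) (right_mem_Icc.2 hT.le) hT.le
  simp only [intervalIntegral.integral_same, position_start, hDT, mul_zero, zero_add] at hfin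
  exact hfin

end Sufficiency

theorem equilibriumFlow_isNash_of_nonneg (hδ : δ = (N : ℝ)⁻¹) {x : Fin N → ℝ} {μ : ℝ → ℝ}
    {X Y : Fin N → ℝ → ℝ} (h : M.IsEquilibriumFlow δ x (fun j => M.liqTime δ (x j) μ) μ X Y)
    (h0 : ∀ᵐ t, t ∈ Icc 0 M.T → 0 ≤ μ t) :
    M.IsNash x fun j t => (Y j t - δ * M.κ t * X j t) / M.η t := by
  set ξ := fun j t => (Y j t - δ * M.κ t * X j t) / M.η t with hξ
  have hadm : ∀ i, M.Admissible (x i) (ξ i) := fun i => hM.flow_admissible h.integrable (h.flow i)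
  refine ⟨hadm, fun i ζ hζ => ?_⟩
  have hμ : ∀ᵐ t, t ∈ Icc 0 M.T → μ t = avgRate ξ t := by
    filter_upwards [h.avg] with t ht htm
    rw [ht htm, avgRate, hδ]
    simp only [hξ, hδ]
  have hμi := hM.memLp_integrable (avgRate_memLp fun j => (hadm j).1)
  have hf : M.IsFlow δ (M.liqTime δ (x i) (avgRate ξ)) (x i) (avgRate ξ) (X i) (Y i) := by
    rw [← liqTime_congr hμ]; exact (h.flow i).congr_ae hμ
  have hd : MemLp (fun t => ζ t - ξ i t) 2 M.vol := hζ.1.sub (hadm i).1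
  have hζ' : ζ = fun t => ξ i t + (ζ t - ξ i t) := by funext t; ring
  have hL := hM.flow_firstVariation_nonneg hμi (by
    -- The driver $\mu$ and the average of the profile agree only a.e.; the flow has been
    -- transported to the latter, against which the cost is computed.
    filter_upwards [h0, hμ] with t h1 h2 ht
    rw [← h2 ht]; exact h1 ht) hf hd (by convert hζ using 2; simp [hξ])
  rw [hζ', hM.cost_update hδ (fun j => (hadm j).1) (x i) i hd]
  have hQ := hM.secondVariation_nonneg fun t => ζ t - ξ i t
  change 0 ≤ M.firstVariation δ (x i) (avgRate ξ) (ξ i) _ at hL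
  linarith

theorem equilibriumFlow_isNash (hδ : δ = (N : ℝ)⁻¹) {x : Fin N → ℝ} {μ : ℝ → ℝ}
    {X Y : Fin N → ℝ → ℝ} (h : M.IsEquilibriumFlow δ x (fun j => M.liqTime δ (x j) μ) μ X Y) :
    M.IsNash x fun j t => (Y j t - δ * M.κ t * X j t) / M.η t := by
  rcases hM.equilibrium_rate_sign h with hs | hs
  · have hn := h.neg
    simp only [← liqTime_neg (x _) μ] at hn
    have := (hM.equilibriumFlow_isNash_of_nonneg hδ hn
      (hs.mono fun t ht htm => neg_nonneg.2 (ht htm))).neg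
    simp only [neg_neg] at this
    convert this using 3
    ring
  · exact hM.equilibriumFlow_isNash_of_nonneg hδ h hs

end Regular

end Market

end Liquidation

theorem mainTheorem4
    (M : Liquidation.Market) (N : ℕ) (hN : 0 < N) (x : Fin N → ℝ)
    (hT : 0 < M.T)
    -- the coefficients: `λ ∈ L^∞₊`, `κ ∈ C¹₊`, `η ∈ C¹` with `η > 0`
    (hlam : MemLp M.lam ⊤ M.vol)
    (hlam0 : ∀ᵐ t ∂M.vol, 0 ≤ M.lam t)
    (hκ : ContDiffOn ℝ 1 M.κ (Set.Icc 0 M.T))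
    (hκ0 : ∀ t ∈ Set.Icc (0 : ℝ) M.T, 0 ≤ M.κ t)
    (hη : ContDiffOn ℝ 1 M.η (Set.Icc 0 M.T))
    (hη0 : ∀ t ∈ Set.Icc (0 : ℝ) M.T, 0 < M.η t)
    -- `λ + κ'/N ≥ 0`, `η - κ/N > 0`, `λ - κ/N ≥ 0`
    (hlamκ' : ∀ᵐ t ∂M.vol, 0 ≤ M.lam t + (N : ℝ)⁻¹ * derivWithin M.κ (Set.Icc 0 M.T) t)
    (hηκ : ∀ t ∈ Set.Icc (0 : ℝ) M.T, 0 < M.η t - (N : ℝ)⁻¹ * M.κ t)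
    (hlamκ : ∀ᵐ t ∂M.vol, 0 ≤ M.lam t - (N : ℝ)⁻¹ * M.κ t) :
    -- (1) equilibria whose average trading rate does not change sign
    (∀ ξ : Fin N → ℝ → ℝ, M.IsNash x ξ →
      ((∀ᵐ t ∂M.vol, Liquidation.Market.avgRate ξ t ≤ 0) ∨
        (∀ᵐ t ∂M.vol, 0 ≤ Liquidation.Market.avgRate ξ t)) →
      (∀ i, ξ i =ᵐ[M.vol] M.candidate (N : ℝ)⁻¹ (x i) (Liquidation.Market.avgRate ξ)) ∧
      M.IsFixedPoint (N : ℝ)⁻¹ (Liquidation.Market.empirical x)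
        (Liquidation.Market.avgRate ξ) ∧
      ∀ m : ℝ → ℝ, M.IsFixedPoint (N : ℝ)⁻¹ (Liquidation.Market.empirical x) m →
        m =ᵐ[M.vol] Liquidation.Market.avgRate ξ) ∧
    -- (2) existence and uniqueness of an equilibrium with continuous aggregate trading rate
    (∃ ξ : Fin N → ℝ → ℝ, M.IsNash x ξ ∧ M.HasContinuousAvgRate ξ ∧
      ∀ ξ' : Fin N → ℝ → ℝ, M.IsNash x ξ' → M.HasContinuousAvgRate ξ' →
        ∀ i, ξ' i =ᵐ[M.vol] ξ i) := by
  have hM : M.Regular (N : ℝ)⁻¹ :=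
    ⟨hT, by positivity, hlam, Liquidation.Market.ae_vol_iff.1 hlam0, hκ, hκ0, hη, hη0,
      Liquidation.Market.ae_vol_iff.1 hlamκ', hηκ, Liquidation.Market.ae_vol_iff.1 hlamκ⟩
  have hδN : (N : ℝ)⁻¹ * N ≤ 1 := (inv_mul_cancel₀ (Nat.cast_ne_zero.2 hN.ne')).le
  refine ⟨fun ξ h _ => ?_, ?_⟩
  -- The average rate of an equilibrium drives an equilibrium flow, which is the same as solving the
  -- fixed-point equation; uniqueness is that of equilibrium flows.
  · obtain ⟨Y, hE⟩ := hM.nash_isEquilibriumFlow rfl h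
    refine ⟨hM.nash_eq_candidate rfl h, (hM.isFixedPoint_iff rfl).2 ⟨_, _, hE⟩, fun m hm => ?_⟩
    obtain ⟨X', Y', hE'⟩ := (hM.isFixedPoint_iff rfl).1 hm
    exact Liquidation.Market.ae_vol_iff.2 (hM.equilibrium_unique hδN hE' hE)
  -- The profile built from an equilibrium flow has rates $(Y^j-\delta\kappa X^j)/\eta$ with
  -- continuous $X^j,Y^j$, so its average is itself continuous. Any other equilibrium has the same
  -- driver a.e., hence the same candidates.
  · obtain ⟨μ, X, Y, hE⟩ := hM.exists_equilibriumFlow hδN x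
    refine ⟨_, hM.equilibriumFlow_isNash rfl hE, ⟨_, ?_, ae_eq_refl _⟩, fun ξ' h' _ i => ?_⟩
    · exact continuousOn_const.mul (continuousOn_finsetSum _ fun j _ =>
        hM.rate_cont (hE.flow j).dX.continuousOn (hE.flow j).dY.continuousOn)
    · obtain ⟨Y', hE'⟩ := hM.nash_isEquilibriumFlow rfl h'
      filter_upwards [hM.nash_eq_candidate rfl h' i,
        Liquidation.Market.ae_vol_iff.2 (Eventually.of_forall fun t ht => ht)] with t h1 ht
      rw [h1, hM.candidate_congr hE'.integrable hE.integrable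
        (hM.equilibrium_unique hδN hE' hE) ht, hM.candidate_eq hE.integrable (hE.flow i) ht]
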